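/- **Setting.** Write $v=(v_1,v_2,v_3)\in\mathbb R^3$, $Rv=(-v_1,v_2,v_3)$. For $g\ge 0$ on $\mathbb R^3$ put $\rho=\int g\,dv$, $\rho U=\int g\,v\,dv$, $3\rho T=\int g|v-U|^2dv$, $\rho\Theta=\int g\,(v-U)\otimes(v-U)\,dv$, $\mathcal T_\nu=(1-\nu)T\,\mathbb I_3+\nu\Theta$ and $$\mathcal M_\nu(g)(v)=\frac{\rho}{\sqrt{\det(2\pi\mathcal T_\nu)}}\exp\Big(-\tfrac12(v-U)^\top\mathcal T_\nu^{-1}(v-U)\Big).$$ Fix wall temperatures $T_w(0),T_w(1)>0$ and the wall Maxwellians of unit flux $M_w(i,v)=\frac{1}{2\pi T_w(i)^2}e^{-|v|^2/(2T_w(i))}$, so that $\int_{v_1>0}M_w(i,v)|v_1|dv=\int_{v_1<0}M_w(i,v)|v_1|dv=1$. Consider, for $\tau>0$ and $\delta_1,\delta_2,\delta_3\ge0$ with $\delta_1+\delta_2+\delta_3=1$, the boundary value problem on $[0,1]\times\mathbb R^3$ $$v_1\partial_x f=\tfrac1\tau(\mathcal M_\nu(f)-f),$$ $$f(0,v)=\delta_1f_L(v)+\delta_2\Big(\int_{w_1<0}f(0,w)|w_1|dw\Big)M_w(0,v)+\delta_3f(0,Rv)\quad(v_1>0),$$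 $$f(1,v)=\delta_1f_R(v)+\delta_2\Big(\int_{w_1>0}f(1,w)|w_1|dw\Big)M_w(1,v)+\delta_3f(1,Rv)\quad(v_1<0).$$ A *mild solution* is a measurable $f$ with $\sup_{x\in[0,1]}\int|f(x,v)|(1+|v|^2)dv<\infty$ (in particular with traces $f(0,\cdot),f(1,\cdot)$ integrable against $(1+|v|^2)dv$) such that for a.e. $v$ the function $y\mapsto\mathcal M_\nu(f(y,\cdot))(v)$ is integrable on $[0,1]$, the boundary conditions hold, and for all $x\in[0,1]$ $$f(x,v)=e^{-\frac{x}{\tau|v_1|}}f(0,v)+\frac1{\tau|v_1|}\int_0^xe^{-\frac{x-y}{\tau|v_1|}}\mathcal M_\nu(f(y,\cdot))(v)\,dy\quad(v_1>0),$$ $$f(x,v)=e^{-\frac{1-x}{\tau|v_1|}}f(1,v)+\frac1{\tau|v_1|}\int_x^1e^{-\frac{y-x}{\tau|v_1|}}\mathcal M_\nu(f(y,\cdot))(v)\,dy\quad(v_1<0).$$ **Data.** Put $f_{LR}=f_L1_{v_1>0}+f_R1_{v_1<0}$ and $M_w(v)=M_w(0,v)1_{v_1>0}+M_w(1,v)1_{v_1<0}$.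 The conditions on the data are: * $(P_1)$ $f_{LR}\ge0$ a.e., $f_{LR}$ is not a.e. zero, and $\int f_{LR}(1+|v|^2)dv<\infty$. * $(P_2)$ $\int_{\mathbb R^2}f_L\,v_i\,dv_2dv_3=0$ for a.e. $v_1>0$ and $\int_{\mathbb R^2}f_R\,v_i\,dv_2dv_3=0$ for a.e. $v_1<0$ ($i=2,3$). For a function $h(v)$ the trace norm $\|h\|_{L^1_{\gamma,\langle v\rangle}}$ is the sum of the outward part $\int_{v_1<0}|h|(1+|v|^2)dv+\int_{v_1>0}|h|(1+|v|^2)dv$ (traces at $x=0$ and $x=1$) and the inward part $\int_{v_1>0}|h|(1+|v|^2)dv+\int_{v_1<0}|h|(1+|v|^2)dv$, that is $2\int|h|(1+|v|^2)dv$. Define $$C_{LR,1}=\|f_{LR}\|_{L^1_{\gamma,\langle v\rangle}}\|M_w\|_{L^1_{\gamma,\langle v\rangle}},\qquad a_{\ell,1}=\int e^{-\frac1{|v_1|}}f_{LR}\,dv,$$ $$\gamma_{\ell,1}=\Big(\int_{v_1>0}e^{-\frac1{|v_1|}}f_L|v_1|dv\Big)\Big(\int_{v_1<0}e^{-\frac1{|v_1|}}f_R|v_1|dv\Big),\qquad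 a_{-1/2,1}=\inf_{|\kappa|=1}\int e^{-\frac1{|v_1|}}f_{LR}\{|v|^2-(v\cdot\kappa)^2\}dv,$$ and $C^1_\nu=\min\{1-\nu,1+2\nu\}$, $C^2_\nu=\max\{1-\nu,1+2\nu\}$. **Theorem.** (1) Let $-1/2<\nu<1$. There are constants $K_1>0$, $\epsilon>0$, depending only on $\nu$, $T_w$ and, among the data, on the values of $C_{LR,1},a_{\ell,1},\gamma_{\ell,1},a_{-1/2,1}$, such that the following holds for all $f_L,f_R$ satisfying $(P_1)$ and $(P_2)$. If $\tau>K_1$ and $\delta_2+\delta_3<\epsilon$, there is a unique (up to a null set of velocities) mild solution $f\ge0$ of the boundary value problem such that for all $x\in[0,1]$ and all $|\kappa|=1$ $$\int f(x,v)dv\ge a_{\ell,1},\qquad\int f(x,v)(1+|v|^2)dv\le2C_{LR,1},$$ $$C^1_\nu\delta_1^2\frac{\gamma_{\ell,1}}{3C_{LR,1}^2}\le\kappa^\top\mathcal T_\nu(x)\kappa\le\frac{2}{3a_{\ell,1}\delta_1}C^2_\nu C_{LR,1}.$$ Moreover $\gamma_{\ell,1}>0$ if neither $f_L1_{v_1>0}$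 nor $f_R1_{v_1<0}$ is a.e. zero. (2) Let $\nu=-1/2$. There are constants $K_1,\epsilon_1,\epsilon_2>0$, depending only on $T_w$ and, among the data, on the values of $C_{LR,1},a_{\ell,1},a_{-1/2,1}$, such that the following holds for all $f_L,f_R$ satisfying $(P_1)$ and $(P_2)$. If $\tau>K_1$, $\delta_2+\delta_3<\epsilon_1$ and $$\Big|\int_{v_1>0}f_L|v_1|dv-\int_{v_1<0}f_R|v_1|dv\Big|\le\epsilon_2,$$ there is a unique (up to a null set of velocities) mild solution $f\ge0$ of the boundary value problem such that for all $x\in[0,1]$ and all $|\kappa|=1$ $$\int f(x,v)dv\ge\delta_1a_{\ell,1},\qquad\int f(x,v)|v|^2dv\le2C_{LR,1},$$ $$\delta_1\frac{a_{-1/2,1}}{2C_{LR,1}}\le\kappa^\top\mathcal T_{-1/2}(x)\kappa\le\frac{3}{2a_{\ell,1}}C_{LR,1}.$$ Moreover $a_{-1/2,1}>0$. -/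

import Mathlib

open MeasureTheory Set

noncomputable section

namespace ESBGK

/-- The velocity space `ℝ³`. The component `v₁` of the text is `v 0`, and so on. -/
abbrev V : Type := EuclideanSpace ℝ (Fin 3)

/-! ### Macroscopic fields and the ellipsoidal Gaussian of a velocity distribution `g`

`g` stands for `f(x, ·)` at a fixed position `x`. -/

/-- Local density `ρ`. -/
def density (g : V → ℝ) : ℝ := ∫ v, g v

/-- Bulk velocity `U`, from `ρ U = ∫ g v dv`. -/
def bulkVelocity (g : V → ℝ) : V := (density g)⁻¹ • ∫ v, g v • v

/-- Local temperature `T`, from `3 ρ T = ∫ g |v - U|² dv`. -/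
def temperature (g : V → ℝ) : ℝ :=
  (3 * density g)⁻¹ * ∫ v, g v * ‖v - bulkVelocity g‖ ^ 2

/-- Stress tensor `Θ`, from `ρ Θ = ∫ g (v - U) ⊗ (v - U) dv`. -/
def stressTensor (g : V → ℝ) : Matrix (Fin 3) (Fin 3) ℝ :=
  Matrix.of fun i j =>
    (density g)⁻¹ * ∫ v, g v * ((v i - bulkVelocity g i) * (v j - bulkVelocity g j))

/-- Temperature tensor `𝒯_ν = (1 - ν) T I + ν Θ`. -/
def temperatureTensor (ν : ℝ) (g : V → ℝ) : Matrix (Fin 3) (Fin 3) ℝ :=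
  ((1 - ν) * temperature g) • (1 : Matrix (Fin 3) (Fin 3) ℝ) + ν • stressTensor g

/-- The quadratic form `κᵀ A κ`. -/
def quadForm (A : Matrix (Fin 3) (Fin 3) ℝ) (κ : V) : ℝ :=
  dotProduct κ.ofLp (A.mulVec κ.ofLp)

/-- The ellipsoidal Gaussian
`ℳ_ν(g)(v) = ρ / √det(2π 𝒯_ν) · exp(-½ (v - U)ᵀ 𝒯_ν⁻¹ (v - U))`. -/
def ellipsoidalGaussian (ν : ℝ) (g : V → ℝ) (v : V) : ℝ :=
  density g / Real.sqrt ((2 * Real.pi) • temperatureTensor ν g).det *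
    Real.exp (-(1 / 2) * quadForm (temperatureTensor ν g)⁻¹ (v - bulkVelocity g))

/-! ### Boundary data -/

/-- Specular reflection `R(v₁, v₂, v₃) = (-v₁, v₂, v₃)`. -/
def reflect (v : V) : V := !₂[-(v 0), v 1, v 2]

/-- Wall Maxwellian of wall temperature `θ`, normalized to have unit flux:
`∫_{v₁ > 0} M |v₁| dv = ∫_{v₁ < 0} M |v₁| dv = 1`. -/
def wallMaxwellian (θ : ℝ) (v : V) : ℝ :=
  1 / (2 * Real.pi * θ ^ 2) * Real.exp (-(‖v‖ ^ 2) / (2 * θ))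

/-- `h_L 1_{v₁ > 0} + h_R 1_{v₁ < 0}`. It is used for `f_{LR}`, from `f_L` and `f_R`, and for
`M_w`, from `M_w(0, ·)` and `M_w(1, ·)`. -/
def glue (hL hR : V → ℝ) (v : V) : ℝ :=
  if 0 < v 0 then hL v else if v 0 < 0 then hR v else 0

/-- Outward trace norm `‖·‖_{L¹_{γ,⟨v⟩,+}}` of boundary values `h₀` at `x = 0`, `h₁` at `x = 1`. -/
def traceNormOut (h₀ h₁ : V → ℝ) : ℝ :=
  (∫ v in {v : V | v 0 < 0}, |h₀ v| * (1 + ‖v‖ ^ 2)) +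
    ∫ v in {v : V | 0 < v 0}, |h₁ v| * (1 + ‖v‖ ^ 2)

/-- Inward trace norm `‖·‖_{L¹_{γ,⟨v⟩,-}}` of boundary values `h₀` at `x = 0`, `h₁` at `x = 1`. -/
def traceNormIn (h₀ h₁ : V → ℝ) : ℝ :=
  (∫ v in {v : V | 0 < v 0}, |h₀ v| * (1 + ‖v‖ ^ 2)) +
    ∫ v in {v : V | v 0 < 0}, |h₁ v| * (1 + ‖v‖ ^ 2)

/-- Trace norm `‖·‖_{L¹_{γ,⟨v⟩}}` of a function `h` of the velocity alone, regarded as a function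
of `(x, v)` that does not depend on `x`. -/
def traceNorm (h : V → ℝ) : ℝ := traceNormOut h h + traceNormIn h h

/-- Property (P₁): `f_{LR} ≥ 0` is not identically `0` (as a class modulo null sets) and has finite
trace norm `‖f_{LR}‖_{L¹_{γ,⟨v⟩}}`. -/
structure P1 (fL fR : V → ℝ) : Prop where
  nonneg : ∀ᵐ v : V, 0 ≤ glue fL fR v
  nontrivial : ¬ ∀ᵐ v : V, glue fL fR v = 0
  finite : Integrable fun v : V => glue fL fR v * (1 + ‖v‖ ^ 2)

/-- Property (P₂): no vertical flow is induced, i.e. `∫_{ℝ²} f_L v_i dv₂ dv₃ = 0` for almost every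
`v₁ > 0` and `∫_{ℝ²} f_R v_i dv₂ dv₃ = 0` for almost every `v₁ < 0`, where `i = 2, 3`. -/
structure P2 (fL fR : V → ℝ) : Prop where
  left₂ : ∀ᵐ s : ℝ, 0 < s → ∫ w : ℝ × ℝ, fL !₂[s, w.1, w.2] * w.1 = 0
  left₃ : ∀ᵐ s : ℝ, 0 < s → ∫ w : ℝ × ℝ, fL !₂[s, w.1, w.2] * w.2 = 0
  right₂ : ∀ᵐ s : ℝ, s < 0 → ∫ w : ℝ × ℝ, fR !₂[s, w.1, w.2] * w.1 = 0
  right₃ : ∀ᵐ s : ℝ, s < 0 → ∫ w : ℝ × ℝ, fR !₂[s, w.1, w.2] * w.2 = 0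

/-- `C_{LR,1} = ‖f_{LR}‖_{L¹_{γ,⟨v⟩}} ‖M_w‖_{L¹_{γ,⟨v⟩}}`, with wall temperatures `θ₀` at `x = 0` and
`θ₁` at `x = 1`. -/
def CLR (θ₀ θ₁ : ℝ) (fL fR : V → ℝ) : ℝ :=
  traceNorm (glue fL fR) * traceNorm (glue (wallMaxwellian θ₀) (wallMaxwellian θ₁))

/-- `a_{ℓ,1} = ∫ e^{-1/|v₁|} f_{LR} dv`. -/
def aEll (fL fR : V → ℝ) : ℝ := ∫ v : V, Real.exp (-(1 / |v 0|)) * glue fL fR v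

/-- `γ_{ℓ,1} = (∫_{v₁>0} e^{-1/|v₁|} f_L |v₁| dv) (∫_{v₁<0} e^{-1/|v₁|} f_R |v₁| dv)`. -/
def gammaEll (fL fR : V → ℝ) : ℝ :=
  (∫ v in {v : V | 0 < v 0}, Real.exp (-(1 / |v 0|)) * fL v * |v 0|) *
    ∫ v in {v : V | v 0 < 0}, Real.exp (-(1 / |v 0|)) * fR v * |v 0|

/-- `a_{-1/2,1} = inf_{|κ|=1} ∫ e^{-1/|v₁|} f_{LR} {|v|² - (v·κ)²} dv`. -/
def aCrit (fL fR : V → ℝ) : ℝ :=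
  ⨅ κ : Metric.sphere (0 : V) 1,
    ∫ v : V, Real.exp (-(1 / |v 0|)) * glue fL fR v * (‖v‖ ^ 2 - (inner ℝ v (κ : V)) ^ 2)

/-- The discrepancy `|∫_{v₁>0} f_L |v₁| dv - ∫_{v₁<0} f_R |v₁| dv|` of the boundary fluxes. -/
def fluxDiscrepancy (fL fR : V → ℝ) : ℝ :=
  abs ((∫ v in {v : V | 0 < v 0}, fL v * |v 0|) - (∫ v in {v : V | v 0 < 0}, fR v * |v 0|))

/-! ### Mild solutions -/

/-- `f` is a mild solution of `v₁ ∂ₓ f = (ℳ_ν(f) - f) / τ` on `[0, 1] × ℝ³` with the mixed boundary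
conditions of weights `δ₁` (inflow), `δ₂` (diffuse), `δ₃` (specular). The representative is the one
for which the integral equation holds at every `x ∈ [0, 1]`, for almost every `v`; its traces are then
its values at `x = 0` and `x = 1`. The second and third fields say that
`f ∈ L^∞([0,1]; L¹₂(ℝ³))` and, at `x = 0` and `x = 1`, that the trace lies in `L¹_{γ,⟨v⟩}`. -/
structure IsMildSolution (ν τ δ₁ δ₂ δ₃ θ₀ θ₁ : ℝ) (fL fR : V → ℝ) (f : ℝ → V → ℝ) : Prop where
  measurable : AEStronglyMeasurable (Function.uncurry f)
    ((volume.restrict (Icc (0 : ℝ) 1)).prod (volume : Measure V))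
  integrable : ∀ x ∈ Icc (0 : ℝ) 1, Integrable fun v : V => f x v * (1 + ‖v‖ ^ 2)
  bounded : ∃ B : ℝ, ∀ x ∈ Icc (0 : ℝ) 1, ∫ v : V, |f x v| * (1 + ‖v‖ ^ 2) ≤ B
  gaussian_integrable : ∀ᵐ v : V,
    IntervalIntegrable (fun y => ellipsoidalGaussian ν (f y) v) volume 0 1
  mild_pos : ∀ᵐ v : V, 0 < v 0 → ∀ x ∈ Icc (0 : ℝ) 1,
    f x v = Real.exp (-(x / (τ * |v 0|))) * f 0 v +
      1 / (τ * |v 0|) *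
        ∫ y in (0 : ℝ)..x, Real.exp (-((x - y) / (τ * |v 0|))) * ellipsoidalGaussian ν (f y) v
  mild_neg : ∀ᵐ v : V, v 0 < 0 → ∀ x ∈ Icc (0 : ℝ) 1,
    f x v = Real.exp (-((1 - x) / (τ * |v 0|))) * f 1 v +
      1 / (τ * |v 0|) *
        ∫ y in x..(1 : ℝ), Real.exp (-((y - x) / (τ * |v 0|))) * ellipsoidalGaussian ν (f y) v
  boundary_left : ∀ᵐ v : V, 0 < v 0 →
    f 0 v = δ₁ * fL v
      + δ₂ * (∫ w in {w : V | w 0 < 0}, f 0 w * |w 0|) * wallMaxwellian θ₀ v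
      + δ₃ * f 0 (reflect v)
  boundary_right : ∀ᵐ v : V, v 0 < 0 →
    f 1 v = δ₁ * fR v
      + δ₂ * (∫ w in {w : V | 0 < w 0}, f 1 w * |w 0|) * wallMaxwellian θ₁ v
      + δ₃ * f 1 (reflect v)

/-- `f ≥ 0`. -/
def Nonneg (f : ℝ → V → ℝ) : Prop := ∀ᵐ v : V, ∀ x ∈ Icc (0 : ℝ) 1, 0 ≤ f x v

/-- Two solutions are identified when they agree for almost every velocity, at all positions. -/
def SameSolution (f g : ℝ → V → ℝ) : Prop := ∀ᵐ v : V, ∀ x ∈ Icc (0 : ℝ) 1, f x v = g x v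

/-- The bounds on density, energy and temperature tensor in the non-critical case, with
`C¹_ν = min {1 - ν, 1 + 2ν}` and `C²_ν = max {1 - ν, 1 + 2ν}`. -/
def NoncriticalBounds (ν δ₁ θ₀ θ₁ : ℝ) (fL fR : V → ℝ) (f : ℝ → V → ℝ) : Prop :=
  ∀ x ∈ Icc (0 : ℝ) 1,
    aEll fL fR ≤ ∫ v : V, f x v ∧
    ∫ v : V, f x v * (1 + ‖v‖ ^ 2) ≤ 2 * CLR θ₀ θ₁ fL fR ∧
    ∀ κ : V, ‖κ‖ = 1 →
      min (1 - ν) (1 + 2 * ν) * δ₁ ^ 2 * (gammaEll fL fR / (3 * CLR θ₀ θ₁ fL fR ^ 2))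
          ≤ quadForm (temperatureTensor ν (f x)) κ ∧
      quadForm (temperatureTensor ν (f x)) κ
          ≤ 2 / (3 * aEll fL fR * δ₁) * max (1 - ν) (1 + 2 * ν) * CLR θ₀ θ₁ fL fR

/-- The bounds on density, energy and temperature tensor in the critical case `ν = -1/2`. -/
def CriticalBounds (δ₁ θ₀ θ₁ : ℝ) (fL fR : V → ℝ) (f : ℝ → V → ℝ) : Prop :=
  ∀ x ∈ Icc (0 : ℝ) 1,
    δ₁ * aEll fL fR ≤ ∫ v : V, f x v ∧
    ∫ v : V, f x v * ‖v‖ ^ 2 ≤ 2 * CLR θ₀ θ₁ fL fR ∧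
    ∀ κ : V, ‖κ‖ = 1 →
      δ₁ * (aCrit fL fR / (2 * CLR θ₀ θ₁ fL fR))
          ≤ quadForm (temperatureTensor (-1 / 2) (f x)) κ ∧
      quadForm (temperatureTensor (-1 / 2) (f x)) κ
          ≤ 3 / (2 * aEll fL fR) * CLR θ₀ θ₁ fL fR

end ESBGK

end

open ESBGK

noncomputable section

namespace ESBGK

/-! ### The ellipsoidal Gaussian as a function of the moments -/

/-! The Gaussian depends on `f` only through its mass, momentum and second moments. On a set of
moments with density bounded below, bounded norm and uniformly elliptic temperature tensor, it is
bounded by, and Lipschitz with modulus, one fixed function `Ψ` of finite energy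
(`Moments.exists_gaussian_lipschitz`). Along a characteristic the collisions of one crossing
therefore contribute at most (1 - exp(-1/(τ|v₁|))) Ψ(v), whose energy tends to 0 as τ → ∞
(`tendsto_integral_absorbed`). Diffuse and specular re-emission contribute an energy of order δ₂ +
δ₃. The problem is thus a small perturbation of free transport of the inflow data.

The unknown is reduced to a pair: the path of moments and the energy-weighted outgoing trace. Such a
pair determines a linear transport problem, whose explicit solution returns a new pair. This map
contracts by 1/2 (`integral_diff_le`), and Banach's theorem gives existence (`exists_fixed_field`,
`exists_mild_solution`). The same estimate, iterated on the difference of two solutions, gives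
uniqueness (`mild_solution_unique`).

What remains is invariance: a field close to free transport, in the sense of `NearFree`, must have
admissible moments. Mass and energy are compared with the data; ellipticity is the real issue. For ν
> -1/2 the tensor dominates a multiple of the total variance. By (P₂) the damped data carry no
momentum in the directions 2 and 3, so recentring cannot lower their tangential energy, which is at
least a_{-1/2,1} (`AboveData.variance_ge`). The ellipticity constant thus does not use γ_{ℓ,1},
which may vanish; the stated bound with γ_{ℓ,1} comes separately from Cauchy–Schwarz and (A₊ + A₋)²
- (A₊ - A₋)² = 4 A₊A₋ for the two half fluxes. For ν = -1/2 the variance in direction κ is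
subtracted entirely, and one needs ρ|U|² small: (P₂) controls the components 2 and 3 of the
momentum, the small flux discrepancy the first one (`quadForm_critical_bounds`).

The density bound a_{ℓ,1} of the non-critical case carries no factor δ₁. It holds because slow
collisions damp strictly less than exp(-1/|v₁|), and this gain pays for δ₁ < 1 (`aEll_gain_le`). -/

/-- Values of the mass, the momentum and the second moments. -/
abbrev Moments : Type := ℝ × (Fin 3 → ℝ) × (Fin 3 → Fin 3 → ℝ)

/-- The moments of a velocity distribution. -/
def moments (g : V → ℝ) : Moments :=
  (∫ v, g v, fun i => ∫ v, g v * v i, fun i j => ∫ v, g v * (v i * v j))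

namespace Moments

/-- Bulk velocity. -/
def velocity (m : Moments) : V := WithLp.toLp 2 fun i => m.1⁻¹ * m.2.1 i

/-- Stress tensor. -/
def stress (m : Moments) : Matrix (Fin 3) (Fin 3) ℝ :=
  Matrix.of fun i j => m.1⁻¹ * m.2.2 i j - m.1⁻¹ * m.2.1 i * (m.1⁻¹ * m.2.1 j)

/-- Temperature tensor. -/
def tensor (ν : ℝ) (m : Moments) : Matrix (Fin 3) (Fin 3) ℝ :=
  ((1 - ν) * (m.stress.trace / 3)) • (1 : Matrix (Fin 3) (Fin 3) ℝ) + ν • m.stress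

/-- Ellipsoidal Gaussian with given moments. -/
def gaussian (ν : ℝ) (m : Moments) (v : V) : ℝ :=
  m.1 / Real.sqrt ((2 * Real.pi) • m.tensor ν).det *
    Real.exp (-(1 / 2) * quadForm (m.tensor ν)⁻¹ (v - m.velocity))

/-- Moments with density bounded below, bounded norm and uniformly elliptic symmetric temperature
tensor. -/
def Admissible (ν r B c : ℝ) : Set Moments :=
  {m | r ≤ m.1 ∧ ‖m‖ ≤ B ∧ (∀ κ : V, c * ‖κ‖ ^ 2 ≤ quadForm (m.tensor ν) κ) ∧
    ∀ i j, m.2.2 i j = m.2.2 j i}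

end Moments

theorem quadForm_eq_sum (A : Matrix (Fin 3) (Fin 3) ℝ) (κ : V) :
    quadForm A κ = ∑ i, ∑ j, A i j * (κ i * κ j) := by
  simp only [quadForm, dotProduct, Matrix.mulVec, Finset.mul_sum]
  refine Finset.sum_congr rfl fun i _ => Finset.sum_congr rfl fun j _ => ?_
  ring

/-! ### Smooth dependence of determinants and inverses on parameters -/

section Smoothness

variable {E : Type*} [NormedAddCommGroup E] [NormedSpace ℝ E]

theorem contDiffAt_det {M : E → Matrix (Fin 3) (Fin 3) ℝ} {x : E}
    (hM : ∀ i j, ContDiffAt ℝ 1 (fun y => M y i j) x) :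
    ContDiffAt ℝ 1 (fun y => (M y).det) x := by
  simp only [Matrix.det_apply]
  exact ContDiffAt.sum fun σ _ => (contDiffAt_prod fun i _ => hM _ _).const_smul _

/-- Cramer's rule: the entries of the inverse are minors divided by the determinant. -/
theorem contDiffAt_inv_matrix {M : E → Matrix (Fin 3) (Fin 3) ℝ} {x : E}
    (hM : ∀ i j, ContDiffAt ℝ 1 (fun y => M y i j) x) (hdet : (M x).det ≠ 0) (i j : Fin 3) :
    ContDiffAt ℝ 1 (fun y => (M y)⁻¹ i j) x := by
  simp only [Matrix.inv_def, Ring.inverse_eq_inv', Matrix.smul_apply, smul_eq_mul,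
    Matrix.adjugate_apply]
  refine ((contDiffAt_det hM).inv hdet).mul (contDiffAt_det fun k l => ?_)
  rcases eq_or_ne k j with rfl | hk
  · simp only [Matrix.updateRow_self]
    exact contDiffAt_const
  · simp only [Matrix.updateRow_ne hk]
    exact hM k l

end Smoothness

namespace Moments

variable {ν r B c : ℝ} {m : Moments}

theorem contDiffAt_velocity (hm : m.1 ≠ 0) (i : Fin 3) :
    ContDiffAt ℝ 1 (fun m : Moments => m.velocity i) m := by
  change ContDiffAt ℝ 1 (fun m : Moments => m.1⁻¹ * m.2.1 i) m
  exact (contDiffAt_fst.inv hm).mul (by fun_prop)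

theorem contDiffAt_stress (hm : m.1 ≠ 0) (i j : Fin 3) :
    ContDiffAt ℝ 1 (fun m : Moments => m.stress i j) m := by
  change ContDiffAt ℝ 1
    (fun m : Moments => m.1⁻¹ * m.2.2 i j - m.1⁻¹ * m.2.1 i * (m.1⁻¹ * m.2.1 j)) m
  have h1 : ContDiffAt ℝ 1 (fun m : Moments => m.1⁻¹) m := contDiffAt_fst.inv hm
  fun_prop

theorem contDiffAt_tensor (hm : m.1 ≠ 0) (i j : Fin 3) :
    ContDiffAt ℝ 1 (fun m : Moments => m.tensor ν i j) m := by
  simp only [tensor, Matrix.add_apply, Matrix.smul_apply, smul_eq_mul, Matrix.trace,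
    Matrix.diag_apply]
  have h := fun i j => contDiffAt_stress hm i j
  have h3 : ContDiffAt ℝ 1 (fun m : Moments => ∑ i, m.stress i i) m :=
    ContDiffAt.sum fun i _ => h i i
  have := h i j
  fun_prop

theorem Admissible.pos (hr : 0 < r) (hm : m ∈ Admissible ν r B c) : 0 < m.1 := hr.trans_le hm.1

/-- The symmetry condition in `Admissible` serves here: positive definiteness in the Hermitian sense
needs it besides ellipticity of the form. -/
theorem Admissible.det_pos (hc : 0 < c) (hm : m ∈ Admissible ν r B c) :
    0 < (m.tensor ν).det := by
  refine Matrix.PosDef.det_pos (Matrix.PosDef.of_dotProduct_mulVec_pos ?_ fun x hx => ?_)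
  · ext i j
    simp only [Matrix.conjTranspose_apply, star_trivial, tensor, stress, Matrix.add_apply,
      Matrix.smul_apply, Matrix.of_apply, Matrix.one_apply, hm.2.2.2 j i, eq_comm (a := j)]
    ring
  · have h := hm.2.2.1 (WithLp.toLp 2 x)
    have h2 : 0 < ‖(WithLp.toLp 2 x : V)‖ := norm_pos_iff.2 (by simpa using hx)
    exact lt_of_lt_of_le (by positivity) h

/-- The quadratic polynomial with given coefficients. -/
def poly (m : Moments) (v : V) : ℝ := m.1 + ∑ i, m.2.1 i * v i + ∑ i, ∑ j, m.2.2 i j * (v i * v j)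

/-- The coefficients of the exponent of the Gaussian. -/
def exponent (ν : ℝ) (m : Moments) : Moments :=
  (-(1 / 2) * ∑ i, ∑ j, (m.tensor ν)⁻¹ i j * (m.velocity i * m.velocity j),
    fun i => (1 / 2) * ∑ j, ((m.tensor ν)⁻¹ i j + (m.tensor ν)⁻¹ j i) * m.velocity j,
    fun i j => -(1 / 2) * (m.tensor ν)⁻¹ i j)

/-- The normalization of the Gaussian. -/
def normalization (ν : ℝ) (m : Moments) : ℝ :=
  m.1 / Real.sqrt ((2 * Real.pi) • m.tensor ν).det

/-- This separates the moments from the velocity: only finitely many coefficients depend on `m`, so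
regularity in `m` becomes a finite-dimensional question. -/
theorem gaussian_eq (m : Moments) (v : V) :
    m.gaussian ν v = m.normalization ν * Real.exp ((m.exponent ν).poly v) := by
  rw [gaussian, normalization]
  congr 2
  rw [quadForm_eq_sum]
  simp only [poly, exponent, Fin.sum_univ_three, PiLp.sub_apply]
  ring

/-- The constant counts the coefficients, 1 + 3 + 9, each at most the sup norm of `m`. -/
theorem abs_poly_le (m : Moments) (v : V) : |m.poly v| ≤ 13 * ‖m‖ * (1 + ‖v‖ ^ 2) := by
  have h1 : |m.1| ≤ ‖m‖ := norm_fst_le m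
  have h2 : ∀ i, |m.2.1 i| ≤ ‖m‖ := fun i =>
    (norm_le_pi_norm m.2.1 i).trans ((norm_fst_le m.2).trans (norm_snd_le m))
  have h3 : ∀ i j, |m.2.2 i j| ≤ ‖m‖ := fun i j =>
    (norm_le_pi_norm (m.2.2 i) j).trans ((norm_le_pi_norm m.2.2 i).trans
      ((norm_snd_le m.2).trans (norm_snd_le m)))
  have hv : ∀ i, |v i| ≤ ‖v‖ := fun i => PiLp.norm_apply_le v i
  have hm0 : 0 ≤ ‖m‖ := norm_nonneg _
  have hs1 : |∑ i, m.2.1 i * v i| ≤ ∑ _i : Fin 3, ‖m‖ * ‖v‖ :=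
    (Finset.abs_sum_le_sum_abs _ _).trans (Finset.sum_le_sum fun i _ => by
      rw [abs_mul]; exact mul_le_mul (h2 i) (hv i) (abs_nonneg _) hm0)
  have hs2 : |∑ i, ∑ j, m.2.2 i j * (v i * v j)| ≤ ∑ _i : Fin 3, ∑ _j : Fin 3, ‖m‖ * (‖v‖ * ‖v‖) :=
    (Finset.abs_sum_le_sum_abs _ _).trans (Finset.sum_le_sum fun i _ =>
      (Finset.abs_sum_le_sum_abs _ _).trans (Finset.sum_le_sum fun j _ => by
        rw [abs_mul, abs_mul]
        exact mul_le_mul (h3 i j) (mul_le_mul (hv i) (hv j) (abs_nonneg _) (norm_nonneg _))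
          (by positivity) hm0))
  simp only [Finset.sum_const, Finset.card_univ, Fintype.card_fin, nsmul_eq_mul] at hs1 hs2
  have := (abs_add_le (m.1 + ∑ i, m.2.1 i * v i) (∑ i, ∑ j, m.2.2 i j * (v i * v j))).trans
    (add_le_add (abs_add_le _ _) le_rfl)
  rw [poly]
  push_cast at *
  nlinarith [mul_nonneg hm0 (sq_nonneg (‖v‖ - 1)), mul_nonneg hm0 (sq_nonneg ‖v‖)]

theorem poly_sub (m m' : Moments) (v : V) : (m - m').poly v = m.poly v - m'.poly v := by
  simp only [poly, Prod.fst_sub, Prod.snd_sub, Pi.sub_apply, Fin.sum_univ_three]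
  ring

theorem contDiffAt_exponent (hm : m.1 ≠ 0) (hdet : (m.tensor ν).det ≠ 0) :
    ContDiffAt ℝ 1 (exponent ν) m := by
  have hU := fun i => contDiffAt_velocity hm i
  have hA := fun i j => contDiffAt_inv_matrix (M := tensor ν) (contDiffAt_tensor hm) hdet i j
  unfold exponent
  refine ContDiffAt.prodMk ?_ (ContDiffAt.prodMk ?_ ?_)
  · exact contDiffAt_const.mul (ContDiffAt.sum fun i _ => ContDiffAt.sum fun j _ =>
      (hA i j).mul ((hU i).mul (hU j)))
  · exact contDiffAt_pi.2 fun i => contDiffAt_const.mul (ContDiffAt.sum fun j _ =>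
      ((hA i j).add (hA j i)).mul (hU j))
  · exact contDiffAt_pi.2 fun i => contDiffAt_pi.2 fun j => contDiffAt_const.mul (hA i j)

theorem contDiffAt_normalization (hm : m.1 ≠ 0) (hdet : 0 < (m.tensor ν).det) :
    ContDiffAt ℝ 1 (normalization ν) m := by
  have hd : 0 < ((2 * Real.pi) • m.tensor ν).det := by
    rw [Matrix.det_smul]; positivity
  have h := contDiffAt_det (M := fun m : Moments => (2 * Real.pi) • m.tensor ν) (x := m)
    fun i j => contDiffAt_const.mul (contDiffAt_tensor hm i j)
  exact contDiffAt_fst.div (h.sqrt hd.ne') (Real.sqrt_pos.2 hd).ne'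

/-! ### Compactness of the admissible moments and uniform Gaussian bounds -/

theorem isCompact_admissible (hr : 0 < r) : IsCompact (Admissible ν r B c) := by
  refine Metric.isCompact_of_isClosed_isBounded ?_ ?_
  · have h1 : IsClosed {m : Moments | r ≤ m.1} := isClosed_le continuous_const continuous_fst
    -- The tensor is continuous only where the density is nonzero, so ellipticity is shown to be
    -- closed inside the half space `r ≤ m.1`.
    have h2 : ∀ κ : V, IsClosed
        ({m : Moments | r ≤ m.1} ∩ (fun m => quadForm (m.tensor ν) κ) ⁻¹' Ici (c * ‖κ‖ ^ 2)) := by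
      refine fun κ => ContinuousOn.preimage_isClosed_of_isClosed (fun m hm => ?_) h1 isClosed_Ici
      simp only [quadForm_eq_sum]
      have hm' : m.1 ≠ 0 := (hr.trans_le hm).ne'
      exact (tendsto_finsetSum _ fun i _ => tendsto_finsetSum _ fun j _ =>
        (contDiffAt_tensor hm' i j).continuousAt.continuousWithinAt.mul
          continuousWithinAt_const)
    have h3 : IsClosed {m : Moments | ‖m‖ ≤ B} := isClosed_le continuous_norm continuous_const
    have h4 : IsClosed {m : Moments | ∀ i j, m.2.2 i j = m.2.2 j i} := by
      simp only [ofPred_forall]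
      exact isClosed_iInter fun i => isClosed_iInter fun j =>
        isClosed_eq (by fun_prop) (by fun_prop)
    convert! ((h1.inter h3).inter (isClosed_iInter h2)).inter h4 using 1
    ext m
    simp only [Admissible, mem_ofPred_eq, mem_inter_iff, mem_iInter, mem_preimage, mem_Ici]
    grind
  · exact Metric.isBounded_closedBall (x := (0 : Moments)) (r := B) |>.subset fun m hm => by
      simpa using hm.2.1

/-- A C¹ map is locally Lipschitz, and compactness makes the constant global; convexity of the
admissible set is not needed. -/
theorem exists_lipschitz {F : Type*} [NormedAddCommGroup F] [NormedSpace ℝ F] {f : Moments → F}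
    (hr : 0 < r) (hf : ∀ m ∈ Admissible ν r B c, ContDiffAt ℝ 1 f m) :
    ∃ K : ℝ, 0 ≤ K ∧ (∀ m ∈ Admissible ν r B c, ‖f m‖ ≤ K) ∧
      ∀ m ∈ Admissible ν r B c, ∀ m' ∈ Admissible ν r B c, ‖f m - f m'‖ ≤ K * ‖m - m'‖ := by
  have hK := isCompact_admissible (ν := ν) (B := B) (c := c) hr
  have hl : LocallyLipschitzOn (Admissible ν r B c) f := by
    intro m hm
    obtain ⟨K, t, ht, h⟩ := (hf m hm).exists_lipschitzOnWith
    exact ⟨K, t, mem_nhdsWithin_of_mem_nhds ht, h⟩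
  obtain ⟨K, h⟩ := hl.exists_lipschitzOnWith_of_compact hK
  obtain ⟨M, hM⟩ := hK.exists_bound_of_continuousOn
    (fun m hm => (hf m hm).continuousAt.continuousWithinAt)
  refine ⟨max K M, K.2.trans (le_max_left _ _), fun m hm => (hM m hm).trans (le_max_right _ _),
    fun m hm m' hm' => ?_⟩
  exact (h.norm_sub_le hm hm').trans
    (mul_le_mul_of_nonneg_right (le_max_left _ _) (norm_nonneg _))

/-- The form of A⁻¹ at w is the form of A at A⁻¹w, hence positive. Its minimum over admissible
moments and unit vectors is attained, and homogeneity of degree two does the rest. -/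
theorem exists_quadForm_inv_ge (hr : 0 < r) (hc : 0 < c) :
    ∃ l > 0, ∀ m ∈ Admissible ν r B c, ∀ w : V, l * ‖w‖ ^ 2 ≤ quadForm (m.tensor ν)⁻¹ w := by
  have hK := (isCompact_admissible (ν := ν) (B := B) (c := c) hr).prod
    (isCompact_sphere (0 : V) 1)
  have hpos : ∀ m ∈ Admissible ν r B c, ∀ w : V, w ≠ 0 → 0 < quadForm (m.tensor ν)⁻¹ w := by
    intro m hm w hw
    have hdet := (Admissible.det_pos hc hm).ne'
    set y : V := WithLp.toLp 2 ((m.tensor ν)⁻¹.mulVec w.ofLp) with hy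
    have hwy : (m.tensor ν).mulVec y.ofLp = w.ofLp := by
      simp [hy, Matrix.mulVec_mulVec, Matrix.mul_nonsing_inv _ (isUnit_iff_ne_zero.2 hdet)]
    have hq : quadForm (m.tensor ν)⁻¹ w = quadForm (m.tensor ν) y := by
      rw [quadForm, quadForm, hwy, dotProduct_comm]
    have hy0 : y ≠ 0 := by
      intro h0
      apply hw
      ext i
      rw [← hwy, h0]
      simp
    rw [hq]
    exact lt_of_lt_of_le (by have := norm_pos_iff.2 hy0; positivity) (hm.2.2.1 y)
  rcases (Admissible ν r B c).eq_empty_or_nonempty with he | hne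
  · exact ⟨1, one_pos, by simp [he]⟩
  have hcont : ContinuousOn (fun q : Moments × V => quadForm (q.1.tensor ν)⁻¹ q.2)
      (Admissible ν r B c ×ˢ Metric.sphere (0 : V) 1) := by
    simp only [quadForm_eq_sum]
    refine continuousOn_finsetSum _ fun i _ => continuousOn_finsetSum _ fun j _ =>
      ContinuousOn.mul (fun q hq => ?_) (by fun_prop)
    have := (contDiffAt_inv_matrix (M := tensor ν)
      (contDiffAt_tensor (Admissible.pos hr hq.1).ne') (Admissible.det_pos hc hq.1).ne' i j).continuousAt
    exact (ContinuousAt.comp (f := Prod.fst) this continuousAt_fst).continuousWithinAt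
  obtain ⟨q, hq, hmin⟩ := hK.exists_isMinOn
    (hne.prod ⟨EuclideanSpace.single 0 1, by simp⟩) hcont
  have hq1 : q.2 ≠ 0 := by
    intro h
    simpa [h] using hq.2
  refine ⟨_, hpos q.1 hq.1 q.2 hq1, fun m hm w => ?_⟩
  rcases eq_or_ne w 0 with rfl | hw
  · simp [quadForm]
  have hw' : 0 < ‖w‖ := norm_pos_iff.2 hw
  have h1 := hmin (show (m, ‖w‖⁻¹ • w) ∈ _ ×ˢ _ from ⟨hm, by simp [norm_smul, hw'.ne']⟩)
  simp only [mem_ofPred_eq] at h1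
  have h2 : quadForm (m.tensor ν)⁻¹ (‖w‖⁻¹ • w) = (‖w‖⁻¹) ^ 2 * quadForm (m.tensor ν)⁻¹ w := by
    simp only [quadForm_eq_sum, PiLp.smul_apply, smul_eq_mul, Fin.sum_univ_three]
    ring
  rw [h2] at h1
  calc _ ≤ (‖w‖⁻¹) ^ 2 * quadForm (m.tensor ν)⁻¹ w * ‖w‖ ^ 2 := by gcongr
    _ = _ := by field_simp

/-- This is 1 + (y - x) ≤ exp (y - x), multiplied by the exponential at the larger point. -/
theorem abs_exp_sub_exp_le (x y : ℝ) :
    |Real.exp x - Real.exp y| ≤ |x - y| * Real.exp (max x y) := by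
  wlog h : y ≤ x generalizing x y
  · rw [abs_sub_comm, abs_sub_comm x, max_comm]
    exact this y x (le_of_not_ge h)
  rw [max_eq_left h, abs_of_nonneg (sub_nonneg.2 (Real.exp_le_exp.2 h)),
    abs_of_nonneg (sub_nonneg.2 h)]
  have h1 : Real.exp y = Real.exp x * Real.exp (y - x) := by rw [← Real.exp_add]; ring_nf
  have h2 := Real.add_one_le_exp (y - x)
  rw [h1]
  nlinarith [Real.exp_pos x]

/-- Normalization and exponent are C¹ in the moments, hence bounded and Lipschitz on the compact
set. The exponent is at most a constant minus a multiple of |v|², so a difference of exponentials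
costs only a factor 1 + |v|². -/
theorem exists_gaussian_bound (hr : 0 < r) (hc : 0 < c) :
    ∃ L l : ℝ, 0 ≤ L ∧ 0 < l ∧
      (∀ m ∈ Admissible ν r B c, ∀ v, 0 ≤ m.gaussian ν v ∧
        m.gaussian ν v ≤ L * (1 + ‖v‖ ^ 2) * Real.exp (-l * ‖v‖ ^ 2)) ∧
      ∀ m ∈ Admissible ν r B c, ∀ m' ∈ Admissible ν r B c, ∀ v,
        |m.gaussian ν v - m'.gaussian ν v| ≤
          ‖m - m'‖ * (L * (1 + ‖v‖ ^ 2) * Real.exp (-l * ‖v‖ ^ 2)) := by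
  obtain ⟨l, hl, hq⟩ := exists_quadForm_inv_ge (ν := ν) (B := B) hr hc
  obtain ⟨KN, hKN, hN, hN'⟩ := exists_lipschitz (ν := ν) (B := B) (f := normalization ν) hr
    fun m hm => contDiffAt_normalization (Admissible.pos hr hm).ne' (Admissible.det_pos hc hm)
  obtain ⟨KE, hKE, hE, hE'⟩ := exists_lipschitz (ν := ν) (B := B) (f := exponent ν) hr
    fun m hm => contDiffAt_exponent (Admissible.pos hr hm).ne' (Admissible.det_pos hc hm).ne'
  obtain ⟨KU, hKU, hU, -⟩ := exists_lipschitz (ν := ν) (B := B) (c := c)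
    (f := fun m => m.velocity) hr
    fun m hm => contDiffAt_piLp 2 |>.2 fun i => contDiffAt_velocity (Admissible.pos hr hm).ne' i
  have hexp : ∀ m ∈ Admissible ν r B c, ∀ v, Real.exp ((m.exponent ν).poly v) ≤
      Real.exp (l / 2 * KU ^ 2) * Real.exp (-(l / 4) * ‖v‖ ^ 2) := by
    intro m hm v
    have h1 : (m.exponent ν).poly v = -(1 / 2) * quadForm (m.tensor ν)⁻¹ (v - m.velocity) := by
      rw [quadForm_eq_sum]
      simp only [poly, exponent, Fin.sum_univ_three, PiLp.sub_apply]
      ring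
    rw [← Real.exp_add, h1]
    refine Real.exp_le_exp.2 ?_
    have h2 := hq m hm (v - m.velocity)
    have h3 : ‖v‖ ≤ ‖v - m.velocity‖ + KU := by
      have := norm_add_le (v - m.velocity) m.velocity
      rw [sub_add_cancel] at this
      linarith [hU m hm]
    -- Replacing |v - U|² by |v|² halves the decay rate and produces the factor exp(l/2 · KU²).
    have h4 : ‖v‖ ^ 2 ≤ 2 * ‖v - m.velocity‖ ^ 2 + 2 * KU ^ 2 := by
      nlinarith [norm_nonneg v, sq_nonneg (‖v - m.velocity‖ - KU), norm_nonneg (v - m.velocity)]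
    nlinarith
  set X := Real.exp (l / 2 * KU ^ 2) with hX
  have hX0 : 0 < X := Real.exp_pos _
  have hNpos : ∀ m ∈ Admissible ν r B c, 0 ≤ normalization ν m := fun m hm =>
    div_nonneg (Admissible.pos hr hm).le (Real.sqrt_nonneg _)
  refine ⟨KN * X + KN * (13 * KE) * X, l / 4, by positivity, by positivity, fun m hm v => ?_,
    fun m hm m' hm' v => ?_⟩
  · rw [gaussian_eq]
    refine ⟨mul_nonneg (hNpos m hm) (Real.exp_pos _).le, ?_⟩
    have h1 : normalization ν m ≤ KN := (le_abs_self _).trans (hN m hm)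
    calc _ ≤ KN * (X * Real.exp (-(l / 4) * ‖v‖ ^ 2)) :=
          mul_le_mul h1 (hexp m hm v) (Real.exp_pos _).le hKN
      _ = (KN * X) * 1 * Real.exp (-(l / 4) * ‖v‖ ^ 2) := by ring
      _ ≤ _ := by
          gcongr
          · exact le_add_of_nonneg_right (by positivity)
          · nlinarith [sq_nonneg ‖v‖]
  · rw [gaussian_eq, gaussian_eq]
    set Y := Real.exp (-(l / 4) * ‖v‖ ^ 2) with hY
    have hY0 : 0 < Y := Real.exp_pos _
    set e := (m.exponent ν).poly v
    set e' := (m'.exponent ν).poly v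
    have h1 : |e - e'| ≤ 13 * (KE * ‖m - m'‖) * (1 + ‖v‖ ^ 2) := by
      rw [← poly_sub]
      refine (abs_poly_le _ _).trans ?_
      gcongr
      exact hE' m hm m' hm'
    have h2 : Real.exp (max e e') ≤ X * Y := by
      rcases max_choice e e' with h | h <;> rw [h]
      exacts [hexp m hm v, hexp m' hm' v]
    have h3 := abs_exp_sub_exp_le e e'
    have h4 : |normalization ν m - normalization ν m'| ≤ KN * ‖m - m'‖ := hN' m hm m' hm'
    have h5 : |normalization ν m'| ≤ KN := hN m' hm'
    have h6 : normalization ν m * Real.exp e - normalization ν m' * Real.exp e' =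
      (normalization ν m - normalization ν m') * Real.exp e +
        normalization ν m' * (Real.exp e - Real.exp e') := by ring
    rw [h6]
    refine (abs_add_le _ _).trans ?_
    rw [abs_mul, abs_mul, abs_of_pos (Real.exp_pos e)]
    calc _ ≤ KN * ‖m - m'‖ * (X * Y) +
          KN * (13 * (KE * ‖m - m'‖) * (1 + ‖v‖ ^ 2) * (X * Y)) := by
          refine add_le_add (mul_le_mul h4 (hexp m hm v) (Real.exp_pos _).le (by positivity))
            (mul_le_mul h5 (h3.trans (mul_le_mul h1 h2 (Real.exp_pos _).le (by positivity)))
              (abs_nonneg _) hKN)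
      _ ≤ KN * ‖m - m'‖ * (X * Y) * (1 + ‖v‖ ^ 2) +
          KN * (13 * (KE * ‖m - m'‖) * (1 + ‖v‖ ^ 2) * (X * Y)) :=
          add_le_add_left (le_mul_of_one_le_right (by positivity) (by nlinarith [sq_nonneg ‖v‖])) _
      _ = _ := by ring

/-- Half of the decay absorbs the polynomial: tᵏ ≤ k! eᵗ at t = (l/2)(1 + |v|²). -/
theorem integrable_pow_mul_exp {l : ℝ} (hl : 0 < l) (k : ℕ) :
    Integrable fun v : V => (1 + ‖v‖ ^ 2) ^ k * Real.exp (-l * ‖v‖ ^ 2) := by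
  have hg : Integrable fun v : V => Real.exp (-(l / 2) * ‖v‖ ^ 2) := by
    have h := (GaussianFourier.integrable_cexp_neg_mul_sq_norm_add_of_euclideanSpace
      (ι := Fin 3) (b := ((l / 2 : ℝ) : ℂ)) (by simpa using hl) 0 0).re
    refine h.congr (ae_of_all _ fun v => ?_)
    simp only [zero_mul, add_zero]
    norm_cast
  refine ((hg.const_mul ((Nat.factorial k) * (2 / l) ^ k * Real.exp (l / 2))).mono'
    (by fun_prop) (ae_of_all _ fun v => ?_))
  rw [Real.norm_of_nonneg (by positivity)]
  have h1 := Real.pow_div_factorial_le_exp (l / 2 * (1 + ‖v‖ ^ 2)) (by positivity) k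
  have h2 : (1 + ‖v‖ ^ 2) ^ k ≤
      (Nat.factorial k) * (2 / l) ^ k * Real.exp (l / 2 * (1 + ‖v‖ ^ 2)) := by
    calc (1 + ‖v‖ ^ 2) ^ k = (Nat.factorial k) * (2 / l) ^ k *
          ((l / 2 * (1 + ‖v‖ ^ 2)) ^ k / (Nat.factorial k)) := by
          rw [mul_pow, div_pow, div_pow]
          have : (Nat.factorial k : ℝ) ≠ 0 := by positivity
          field_simp
      _ ≤ _ := by gcongr
  calc _ ≤ (Nat.factorial k) * (2 / l) ^ k * Real.exp (l / 2 * (1 + ‖v‖ ^ 2)) *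
        Real.exp (-l * ‖v‖ ^ 2) := by gcongr
    _ = _ := by
      rw [mul_assoc _ (Real.exp _), mul_assoc _ (Real.exp _), ← Real.exp_add, ← Real.exp_add]
      ring_nf

/-- On admissible moments the Gaussian is bounded and Lipschitz, with an integrable modulus. -/
theorem exists_gaussian_lipschitz (hr : 0 < r) (hc : 0 < c) :
    ∃ Ψ : V → ℝ, Continuous Ψ ∧ (∀ v, 0 ≤ Ψ v) ∧ Integrable (fun v => Ψ v * (1 + ‖v‖ ^ 2)) ∧
      (∀ m ∈ Admissible ν r B c, ∀ v, 0 ≤ m.gaussian ν v ∧ m.gaussian ν v ≤ Ψ v) ∧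
      ∀ m ∈ Admissible ν r B c, ∀ m' ∈ Admissible ν r B c, ∀ v,
        |m.gaussian ν v - m'.gaussian ν v| ≤ ‖m - m'‖ * Ψ v := by
  obtain ⟨L, l, hL, hl, h1, h2⟩ := exists_gaussian_bound (ν := ν) (B := B) hr hc
  refine ⟨fun v => L * (1 + ‖v‖ ^ 2) * Real.exp (-l * ‖v‖ ^ 2), by fun_prop,
    fun v => by positivity, ?_, h1, h2⟩
  refine ((integrable_pow_mul_exp hl 2).const_mul L).congr (ae_of_all _ fun v => ?_)
  simp only
  ring

theorem continuousOn_gaussian (hr : 0 < r) (hc : 0 < c) :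
    ContinuousOn (fun q : Moments × V => q.1.gaussian ν q.2) (Admissible ν r B c ×ˢ univ) := by
  simp only [gaussian_eq]
  intro q hq
  have h1 := (contDiffAt_normalization (ν := ν) (Admissible.pos hr hq.1).ne'
    (Admissible.det_pos hc hq.1)).continuousAt.comp (f := Prod.fst) (x := q) continuousAt_fst
  have h2 := (contDiffAt_exponent (ν := ν) (Admissible.pos hr hq.1).ne'
    (Admissible.det_pos hc hq.1).ne').continuousAt.comp (f := Prod.fst) (x := q) continuousAt_fst
  have h3 : Continuous fun q : Moments × V => q.1.poly q.2 := by
    unfold poly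
    fun_prop
  exact (h1.mul (Real.continuous_exp.continuousAt.comp
    (h3.continuousAt.comp (h2.prodMk continuousAt_snd)))).continuousWithinAt

end Moments

/-! ### Moments of velocity distributions with finite energy -/

section WeightedIntegrability

/-- Shorter expansions are padded with a summand of coefficient zero, which explains the terms `0 *
_` in later integrands. -/
theorem integral_combination {f₁ f₂ f₃ f₄ : V → ℝ} (h₁ : Integrable f₁) (h₂ : Integrable f₂)
    (h₃ : Integrable f₃) (h₄ : Integrable f₄) (a b c : ℝ) :
    ∫ v, (f₁ v + a * f₂ v + b * f₃ v + c * f₄ v) =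
      (∫ v, f₁ v) + a * (∫ v, f₂ v) + b * (∫ v, f₃ v) + c * ∫ v, f₄ v := by
  have h12 : Integrable fun v => f₁ v + a * f₂ v := h₁.add (h₂.const_mul a)
  have h123 : Integrable fun v => f₁ v + a * f₂ v + b * f₃ v := h12.add (h₃.const_mul b)
  rw [integral_add h123 (h₄.const_mul c), integral_add h12 (h₃.const_mul b),
    integral_add h₁ (h₂.const_mul a)]
  simp only [integral_const_mul]

variable {g : V → ℝ}

theorem aestronglyMeasurable_of_energy (hg : Integrable fun v : V => g v * (1 + ‖v‖ ^ 2)) :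
    AEStronglyMeasurable g := by
  have h : AEStronglyMeasurable (fun v : V => (1 + ‖v‖ ^ 2)⁻¹) :=
    (Continuous.inv₀ (by fun_prop) fun v => by positivity).aestronglyMeasurable
  refine (hg.aestronglyMeasurable.mul h).congr (ae_of_all _ fun v => ?_)
  have : (1 + ‖v‖ ^ 2) ≠ 0 := by positivity
  simp [this]

theorem integrable_energy_of_le {h : V → ℝ} (hg : Integrable fun v : V => g v * (1 + ‖v‖ ^ 2))
    (hh : AEStronglyMeasurable h) (hle : ∀ᵐ v, |h v| ≤ |g v|) :
    Integrable fun v : V => h v * (1 + ‖v‖ ^ 2) := by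
  refine hg.mono (hh.mul (by fun_prop)) ?_
  filter_upwards [hle] with v hv
  rw [norm_mul, norm_mul]
  exact mul_le_mul_of_nonneg_right hv (norm_nonneg _)

theorem integrable_mul_of_energy {q : V → ℝ} {C : ℝ}
    (hg : Integrable fun v : V => g v * (1 + ‖v‖ ^ 2)) (hq : AEStronglyMeasurable q)
    (hle : ∀ v, |q v| ≤ C * (1 + ‖v‖ ^ 2)) : Integrable fun v => g v * q v := by
  refine (hg.const_mul C).mono ((aestronglyMeasurable_of_energy hg).mul hq) (ae_of_all _ fun v => ?_)
  have h1 : |q v| ≤ |C| * (1 + ‖v‖ ^ 2) := (hle v).trans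
    (mul_le_mul_of_nonneg_right (le_abs_self C) (by positivity))
  have h2 : ‖1 + ‖v‖ ^ 2‖ = 1 + ‖v‖ ^ 2 := Real.norm_of_nonneg (by positivity)
  rw [norm_mul, norm_mul, norm_mul, h2]
  calc ‖g v‖ * ‖q v‖ ≤ ‖g v‖ * (|C| * (1 + ‖v‖ ^ 2)) := by gcongr; exact h1
    _ = _ := by rw [Real.norm_eq_abs C]; ring

theorem abs_apply_le (v : V) (i : Fin 3) : |v i| ≤ 1 * (1 + ‖v‖ ^ 2) := by
  have : |v i| ≤ ‖v‖ := PiLp.norm_apply_le v i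
  nlinarith [sq_nonneg (‖v‖ - 1), sq_nonneg ‖v‖]

theorem abs_apply_mul_le (v : V) (i j : Fin 3) : |v i * v j| ≤ 1 * (1 + ‖v‖ ^ 2) := by
  have h1 : |v i| ≤ ‖v‖ := PiLp.norm_apply_le v i
  have h2 : |v j| ≤ ‖v‖ := PiLp.norm_apply_le v j
  rw [abs_mul]
  nlinarith [mul_le_mul h1 h2 (abs_nonneg _) (norm_nonneg _)]

theorem abs_inner_le (v κ : V) : |inner ℝ v κ| ≤ ‖κ‖ * (1 + ‖v‖ ^ 2) := by
  have h1 := abs_real_inner_le_norm v κ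
  nlinarith [sq_nonneg (‖v‖ - 1), sq_nonneg ‖v‖, norm_nonneg κ, mul_nonneg (norm_nonneg κ)
    (sq_nonneg (‖v‖ - 1)), mul_nonneg (norm_nonneg κ) (sq_nonneg ‖v‖)]

theorem abs_inner_sq_le (v κ : V) : |inner ℝ v κ ^ 2| ≤ ‖κ‖ ^ 2 * (1 + ‖v‖ ^ 2) := by
  have h1 := abs_real_inner_le_norm v κ
  rw [abs_pow]
  calc _ ≤ (‖v‖ * ‖κ‖) ^ 2 := by gcongr
    _ ≤ _ := by nlinarith [sq_nonneg ‖κ‖]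

theorem integrable_of_energy (hg : Integrable fun v : V => g v * (1 + ‖v‖ ^ 2))
    : Integrable g := by
  simpa using integrable_mul_of_energy (q := fun _ => 1) (C := 1) hg (by fun_prop)
    fun v => by simp

theorem integrable_mul_apply (hg : Integrable fun v : V => g v * (1 + ‖v‖ ^ 2))
    (i : Fin 3) : Integrable fun v => g v * v i :=
  integrable_mul_of_energy hg (by fun_prop) fun v => abs_apply_le v i

theorem integrable_mul_apply_mul (hg : Integrable fun v : V => g v * (1 + ‖v‖ ^ 2))
    (i j : Fin 3) : Integrable fun v => g v * (v i * v j) :=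
  integrable_mul_of_energy hg (by fun_prop) fun v => abs_apply_mul_le v i j

theorem integrable_mul_norm_sq (hg : Integrable fun v : V => g v * (1 + ‖v‖ ^ 2))
    : Integrable fun v => g v * ‖v‖ ^ 2 :=
  integrable_mul_of_energy (C := 1) hg (by fun_prop) fun v => by
    rw [abs_of_nonneg (sq_nonneg _)]; linarith

theorem integrable_mul_inner (hg : Integrable fun v : V => g v * (1 + ‖v‖ ^ 2))
    (κ : V) : Integrable fun v => g v * inner ℝ v κ :=
  integrable_mul_of_energy hg (by fun_prop) fun v => abs_inner_le v κ

theorem integrable_mul_inner_sq (hg : Integrable fun v : V => g v * (1 + ‖v‖ ^ 2))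
    (κ : V) : Integrable fun v => g v * inner ℝ v κ ^ 2 :=
  integrable_mul_of_energy hg (by fun_prop) fun v => abs_inner_sq_le v κ

theorem integrable_abs_energy (hg : Integrable fun v : V => g v * (1 + ‖v‖ ^ 2))
    : Integrable fun v : V => |g v| * (1 + ‖v‖ ^ 2) := by
  refine hg.norm.congr (ae_of_all _ fun v => ?_)
  have h2 : ‖1 + ‖v‖ ^ 2‖ = 1 + ‖v‖ ^ 2 := Real.norm_of_nonneg (by positivity)
  simp only [norm_mul, h2, Real.norm_eq_abs]

theorem abs_integral_mul_le (hg : Integrable fun v : V => g v * (1 + ‖v‖ ^ 2))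
    {q : V → ℝ} (hle : ∀ v, |q v| ≤ 1 * (1 + ‖v‖ ^ 2)) :
    |∫ v, g v * q v| ≤ ∫ v, |g v| * (1 + ‖v‖ ^ 2) := by
  rw [← Real.norm_eq_abs]
  refine norm_integral_le_of_norm_le (integrable_abs_energy hg) (ae_of_all _ fun v => ?_)
  rw [norm_mul, Real.norm_eq_abs, Real.norm_eq_abs]
  exact mul_le_mul_of_nonneg_left (by simpa using hle v) (abs_nonneg _)

theorem norm_moments_le (hg : Integrable fun v : V => g v * (1 + ‖v‖ ^ 2))
    : ‖moments g‖ ≤ ∫ v, |g v| * (1 + ‖v‖ ^ 2) := by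
  have h0 : 0 ≤ ∫ v, |g v| * (1 + ‖v‖ ^ 2) := integral_nonneg fun v => by positivity
  refine norm_prod_le_iff.2 ⟨?_, norm_prod_le_iff.2
    ⟨(pi_norm_le_iff_of_nonneg h0).2 fun i => ?_,
      (pi_norm_le_iff_of_nonneg h0).2 fun i => (pi_norm_le_iff_of_nonneg h0).2 fun j => ?_⟩⟩
  · simpa [moments] using abs_integral_mul_le hg (q := fun _ => 1) fun v => by simp
  · exact abs_integral_mul_le hg fun v => abs_apply_le v i
  · exact abs_integral_mul_le hg fun v => abs_apply_mul_le v i j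

theorem moments_sub (hg : Integrable fun v : V => g v * (1 + ‖v‖ ^ 2))
    {h : V → ℝ} (hh : Integrable fun v : V => h v * (1 + ‖v‖ ^ 2)) :
    moments g - moments h = moments fun v => g v - h v := by
  have h1 : (∫ v, g v) - ∫ v, h v = ∫ v, (g v - h v) :=
    (integral_sub (integrable_of_energy hg) (integrable_of_energy hh)).symm
  have h2 : ∀ i, (∫ v, g v * v i) - ∫ v, h v * v i = ∫ v, (g v - h v) * v i := fun i => by
    rw [← integral_sub (integrable_mul_apply hg i) (integrable_mul_apply hh i)]
    simp only [sub_mul]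
  have h3 : ∀ i j, (∫ v, g v * (v i * v j)) - ∫ v, h v * (v i * v j) =
      ∫ v, (g v - h v) * (v i * v j) := fun i j => by
    rw [← integral_sub (integrable_mul_apply_mul hg i j) (integrable_mul_apply_mul hh i j)]
    simp only [sub_mul]
  exact Prod.ext h1 (Prod.ext (funext h2) (funext fun i => funext (h3 i)))

/-- All polynomials of degree at most two that enter the moments are dominated by 1 + |v|². So an
energy-weighted L¹ estimate controls the moments. -/
theorem norm_moments_sub_le (hg : Integrable fun v : V => g v * (1 + ‖v‖ ^ 2))
    {h : V → ℝ} (hh : Integrable fun v : V => h v * (1 + ‖v‖ ^ 2)) :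
    ‖moments g - moments h‖ ≤ ∫ v, |g v - h v| * (1 + ‖v‖ ^ 2) := by
  rw [moments_sub hg hh]
  refine norm_moments_le ((hg.sub hh).congr (ae_of_all _ fun v => ?_))
  simp [sub_mul]

theorem integrable_smul_id (hg : Integrable fun v : V => g v * (1 + ‖v‖ ^ 2))
    : Integrable fun v : V => g v • v := by
  refine (integrable_abs_energy hg).mono' ((aestronglyMeasurable_of_energy hg).smul (by fun_prop))
    (ae_of_all _ fun v => ?_)
  rw [norm_smul, Real.norm_eq_abs]
  exact mul_le_mul_of_nonneg_left (by nlinarith [sq_nonneg (‖v‖ - 1), sq_nonneg ‖v‖])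
    (abs_nonneg _)

theorem integral_mul_inner (hg : Integrable fun v : V => g v * (1 + ‖v‖ ^ 2))
    (κ : V) :
    ∫ v, g v * inner ℝ v κ = inner ℝ (∫ v, g v • v) κ := by
  rw [real_inner_comm, ← integral_inner (𝕜 := ℝ) (integrable_smul_id hg) κ]
  refine integral_congr_ae (ae_of_all _ fun v => ?_)
  simp only [inner_smul_right, real_inner_comm]

theorem bulkVelocity_apply (hg : Integrable fun v : V => g v * (1 + ‖v‖ ^ 2))
    (i : Fin 3) :
    bulkVelocity g i = (density g)⁻¹ * ∫ v, g v * v i := by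
  have h := integral_mul_inner hg (EuclideanSpace.single i 1)
  simp only [EuclideanSpace.inner_single_right, one_mul, conj_trivial] at h
  rw [bulkVelocity, PiLp.smul_apply, smul_eq_mul, h]

theorem bulkVelocity_eq (hg : Integrable fun v : V => g v * (1 + ‖v‖ ^ 2))
    : bulkVelocity g = (moments g).velocity := by
  ext i
  exact bulkVelocity_apply hg i

theorem integrable_mul_norm_sub_sq (hg : Integrable fun v : V => g v * (1 + ‖v‖ ^ 2))
    : Integrable fun v => g v * ‖v - bulkVelocity g‖ ^ 2 := by
  refine integrable_mul_of_energy (C := 2 + 2 * ‖bulkVelocity g‖ ^ 2) hg (by fun_prop) fun v => ?_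
  rw [abs_of_nonneg (sq_nonneg _)]
  have := norm_sub_le v (bulkVelocity g)
  nlinarith [sq_nonneg (‖v‖ - ‖bulkVelocity g‖), norm_nonneg (v - bulkVelocity g), sq_nonneg ‖v‖,
    mul_nonneg (sq_nonneg ‖v‖) (sq_nonneg ‖bulkVelocity g‖)]

theorem integrable_mul_inner_sub_sq (hg : Integrable fun v : V => g v * (1 + ‖v‖ ^ 2))
    (κ : V) :
    Integrable fun v => g v * inner ℝ (v - bulkVelocity g) κ ^ 2 := by
  refine ((integrable_mul_norm_sub_sq hg).const_mul (‖κ‖ ^ 2)).mono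
    ((aestronglyMeasurable_of_energy hg).mul (by fun_prop)) (ae_of_all _ fun v => ?_)
  rw [norm_mul, norm_mul, norm_mul]
  have h1 := abs_real_inner_le_norm (v - bulkVelocity g) κ
  have h2 : ‖inner ℝ (v - bulkVelocity g) κ ^ 2‖ ≤ ‖κ‖ ^ 2 * ‖v - bulkVelocity g‖ ^ 2 := by
    rw [norm_pow, Real.norm_eq_abs]
    calc _ ≤ (‖v - bulkVelocity g‖ * ‖κ‖) ^ 2 := by gcongr
      _ = _ := by ring
  rw [Real.norm_of_nonneg (sq_nonneg ‖κ‖), Real.norm_of_nonneg (sq_nonneg ‖v - bulkVelocity g‖)]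
  calc _ ≤ ‖g v‖ * (‖κ‖ ^ 2 * ‖v - bulkVelocity g‖ ^ 2) := by gcongr
    _ = _ := by ring

theorem integral_mul_inner_eq (hg : Integrable fun v : V => g v * (1 + ‖v‖ ^ 2))
    (hρ : density g ≠ 0) (κ : V) :
    ∫ v, g v * inner ℝ v κ = density g * inner ℝ (bulkVelocity g) κ := by
  rw [integral_mul_inner hg, bulkVelocity, real_inner_smul_left, mul_inv_cancel_left₀ hρ]

theorem integral_mul_inner_sub_sq (hg : Integrable fun v : V => g v * (1 + ‖v‖ ^ 2))
    (hρ : density g ≠ 0) (κ : V) :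
    ∫ v, g v * inner ℝ (v - bulkVelocity g) κ ^ 2 =
      (∫ v, g v * inner ℝ v κ ^ 2) - density g * inner ℝ (bulkVelocity g) κ ^ 2 := by
  have h1 := integral_mul_inner_eq hg hρ κ
  set a : ℝ := inner ℝ (bulkVelocity g) κ with ha
  have : ∀ v, g v * inner ℝ (v - bulkVelocity g) κ ^ 2 =
      g v * inner ℝ v κ ^ 2 + -(2 * a) * (g v * inner ℝ v κ) + a ^ 2 * g v + 0 * g v := fun v => by
    rw [inner_sub_left, ← ha]; ring
  simp only [this]
  rw [integral_combination (integrable_mul_inner_sq hg κ) (integrable_mul_inner hg κ)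
    (integrable_of_energy hg) (integrable_of_energy hg), h1]
  simp only [density]
  ring

theorem integral_mul_norm_sub_sq (hg : Integrable fun v : V => g v * (1 + ‖v‖ ^ 2))
    (hρ : density g ≠ 0) :
    ∫ v, g v * ‖v - bulkVelocity g‖ ^ 2 =
      (∫ v, g v * ‖v‖ ^ 2) - density g * ‖bulkVelocity g‖ ^ 2 := by
  have h1 := integral_mul_inner_eq hg hρ (bulkVelocity g)
  rw [real_inner_self_eq_norm_sq] at h1
  have : ∀ v, g v * ‖v - bulkVelocity g‖ ^ 2 =
      g v * ‖v‖ ^ 2 + -2 * (g v * inner ℝ v (bulkVelocity g)) + ‖bulkVelocity g‖ ^ 2 * g v +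
        0 * g v := fun v => by rw [norm_sub_sq_real]; ring
  simp only [this]
  rw [integral_combination (integrable_mul_norm_sq hg) (integrable_mul_inner hg _)
    (integrable_of_energy hg) (integrable_of_energy hg), h1]
  simp only [density]
  ring

theorem stressTensor_eq (hg : Integrable fun v : V => g v * (1 + ‖v‖ ^ 2))
    (hρ : density g ≠ 0) : stressTensor g = (moments g).stress := by
  ext i j
  simp only [stressTensor, Moments.stress, Matrix.of_apply]
  have hi : ∀ i, ∫ v, g v * v i = density g * bulkVelocity g i := fun i => by
    rw [bulkVelocity_apply hg, mul_inv_cancel_left₀ hρ]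
  have e : ∀ v : V, g v * ((v i - bulkVelocity g i) * (v j - bulkVelocity g j)) =
      g v * (v i * v j) + -bulkVelocity g i * (g v * v j) + -bulkVelocity g j * (g v * v i) +
        bulkVelocity g i * bulkVelocity g j * g v := fun v => by ring
  simp only [e]
  rw [integral_combination (integrable_mul_apply_mul hg i j) (integrable_mul_apply hg j)
    (integrable_mul_apply hg i) (integrable_of_energy hg), hi, hi]
  change _ = (density g)⁻¹ * (∫ v, g v * (v i * v j)) -
    (density g)⁻¹ * (∫ v, g v * v i) * ((density g)⁻¹ * ∫ v, g v * v j)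
  rw [hi, hi]
  simp only [← density.eq_1]
  field_simp
  ring

theorem temperature_eq (hg : Integrable fun v : V => g v * (1 + ‖v‖ ^ 2))
    (hρ : density g ≠ 0) : temperature g = (moments g).stress.trace / 3 := by
  rw [← stressTensor_eq hg hρ, temperature]
  simp only [Matrix.trace, Matrix.diag_apply, stressTensor, Matrix.of_apply, ← Finset.mul_sum]
  have h : ∫ v, g v * ‖v - bulkVelocity g‖ ^ 2 =
      ∑ i, ∫ v, g v * ((v i - bulkVelocity g i) * (v i - bulkVelocity g i)) := by
    rw [← integral_finsetSum]
    · refine integral_congr_ae (ae_of_all _ fun v => ?_)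
      simp only [EuclideanSpace.norm_sq_eq, PiLp.sub_apply, Real.norm_eq_abs, sq_abs,
        Finset.mul_sum]
      exact Finset.sum_congr rfl fun i _ => by ring
    · intro i _
      have := (((integrable_mul_apply_mul hg i i).sub ((integrable_mul_apply hg i).const_mul
        (2 * bulkVelocity g i)))).add ((integrable_of_energy hg).const_mul (bulkVelocity g i ^ 2))
      refine this.congr (ae_of_all _ fun v => ?_)
      simp only [Pi.add_apply, Pi.sub_apply]
      ring
  rw [h]
  field_simp

theorem temperatureTensor_eq (hg : Integrable fun v : V => g v * (1 + ‖v‖ ^ 2))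
    (hρ : density g ≠ 0) (ν : ℝ) : temperatureTensor ν g = (moments g).tensor ν := by
  rw [temperatureTensor, Moments.tensor, stressTensor_eq hg hρ, temperature_eq hg hρ]

/-- This reduces the nonlinearity to a function on a finite-dimensional space. A nonzero density is
needed to expand the centred moments. -/
theorem ellipsoidalGaussian_eq (hg : Integrable fun v : V => g v * (1 + ‖v‖ ^ 2))
    (hρ : density g ≠ 0) (ν : ℝ) (v : V) :
    ellipsoidalGaussian ν g v = (moments g).gaussian ν v := by
  rw [ellipsoidalGaussian, Moments.gaussian, temperatureTensor_eq hg hρ, bulkVelocity_eq hg]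
  rfl

/-- Since 3ρT is the total variance, the isotropic part of the tensor carries one third of it. The
bounds on the temperature tensor all start from this identity. -/
theorem density_mul_quadForm (hg : Integrable fun v : V => g v * (1 + ‖v‖ ^ 2))
    (hρ : density g ≠ 0) (ν : ℝ) (κ : V) :
    density g * quadForm (temperatureTensor ν g) κ =
      (1 - ν) / 3 * ‖κ‖ ^ 2 * (∫ v, g v * ‖v - bulkVelocity g‖ ^ 2) +
        ν * ∫ v, g v * inner ℝ (v - bulkVelocity g) κ ^ 2 := by
  have hT : density g * temperature g = (1 / 3) * ∫ v, g v * ‖v - bulkVelocity g‖ ^ 2 := by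
    rw [temperature]; field_simp
  have hS : density g * quadForm (stressTensor g) κ =
      ∫ v, g v * inner ℝ (v - bulkVelocity g) κ ^ 2 := by
    rw [integral_mul_inner_sub_sq hg hρ, stressTensor_eq hg hρ, quadForm_eq_sum]
    have h1 : ∫ v, g v * inner ℝ v κ ^ 2 = ∑ i, ∑ j, (∫ v, g v * (v i * v j)) * (κ i * κ j) := by
      have e : ∀ v, g v * inner ℝ v κ ^ 2 = ∑ i, ∑ j, g v * (v i * v j) * (κ i * κ j) := by
        intro v
        simp only [PiLp.inner_apply, RCLike.inner_apply, conj_trivial, Fin.sum_univ_three]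
        ring
      simp only [e]
      rw [integral_finsetSum _ fun i _ => integrable_finsetSum _ fun j _ =>
        (integrable_mul_apply_mul hg i j).mul_const _]
      refine Finset.sum_congr rfl fun i _ => ?_
      rw [integral_finsetSum _ fun j _ => (integrable_mul_apply_mul hg i j).mul_const _]
      exact Finset.sum_congr rfl fun j _ => integral_mul_const _ _
    have h2 : inner ℝ (bulkVelocity g) κ = ∑ i, (density g)⁻¹ * (∫ v, g v * v i) * κ i := by
      simp only [PiLp.inner_apply, RCLike.inner_apply, conj_trivial, bulkVelocity_apply hg]
      exact Finset.sum_congr rfl fun i _ => mul_comm _ _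
    rw [h1, h2]
    simp only [Moments.stress, Matrix.of_apply, moments, Fin.sum_univ_three]
    simp only [← density.eq_1]
    field_simp
    ring
  have hq : quadForm (temperatureTensor ν g) κ =
      (1 - ν) * temperature g * ‖κ‖ ^ 2 + ν * quadForm (stressTensor g) κ := by
    simp only [quadForm_eq_sum, temperatureTensor, EuclideanSpace.norm_sq_eq, Real.norm_eq_abs,
      sq_abs, Matrix.add_apply, Matrix.smul_apply, smul_eq_mul, Fin.sum_univ_three,
      Matrix.one_apply]
    simp
    ring
  rw [hq, ← hS]
  linear_combination ((1 - ν) * ‖κ‖ ^ 2) * hT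

end WeightedIntegrability

/-! ### Exponential relaxation along a characteristic -/

/-- Mild solution of `s φ' = g - φ` with zero initial value. -/
def relax (s : ℝ) (φ : ℝ → ℝ) (x : ℝ) : ℝ :=
  1 / s * ∫ y in (0 : ℝ)..x, Real.exp (-((x - y) / s)) * φ y

section Relax

variable {s x M : ℝ} {φ ψ : ℝ → ℝ}

theorem relax_const (hs : s ≠ 0) (x M : ℝ) :
    relax s (fun _ => M) x = (1 - Real.exp (-(x / s))) * M := by
  have h : ∀ y ∈ uIcc 0 x, HasDerivAt (fun y => s * Real.exp (-((x - y) / s)) * M)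
      (Real.exp (-((x - y) / s)) * M) y := by
    intro y _
    have h1 : HasDerivAt (fun y => -((x - y) / s)) (1 / s) y := by
      convert! (((hasDerivAt_id y).const_sub x).div_const s).neg using 1
      ring
    convert! ((h1.exp.const_mul s).mul_const M) using 1
    field_simp
  rw [relax, intervalIntegral.integral_eq_sub_of_hasDerivAt h
    (Continuous.intervalIntegrable (by fun_prop) _ _)]
  simp only [sub_self, zero_div, neg_zero, Real.exp_zero, sub_zero]
  field_simp

theorem abs_relax_le (hs : 0 ≤ s) (hx : x ∈ Icc (0 : ℝ) 1) (hφ : ∀ y ∈ Icc (0 : ℝ) 1, |φ y| ≤ M) :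
    |relax s φ x| ≤ (1 - Real.exp (-(1 / s))) * M := by
  -- The case `s = 0` is a grazing velocity; with `1 / 0 = 0` both sides vanish.
  rcases hs.eq_or_lt with rfl | hs
  · simp [relax]
  have hM : 0 ≤ M := (abs_nonneg _).trans (hφ 0 (by simp))
  have h1 : |∫ y in (0 : ℝ)..x, Real.exp (-((x - y) / s)) * φ y| ≤
      ∫ y in (0 : ℝ)..x, Real.exp (-((x - y) / s)) * M := by
    rw [← Real.norm_eq_abs]
    refine intervalIntegral.norm_integral_le_of_norm_le hx.1 (ae_of_all _ fun y hy => ?_)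
      (Continuous.intervalIntegrable (by fun_prop) _ _)
    rw [norm_mul, Real.norm_of_nonneg (Real.exp_pos _).le]
    exact mul_le_mul_of_nonneg_left (hφ y ⟨hy.1.le, hy.2.trans hx.2⟩) (Real.exp_pos _).le
  have h2 : |relax s φ x| ≤ relax s (fun _ => M) x := by
    rw [relax, relax, abs_mul, abs_of_pos (by positivity : 0 < 1 / s)]
    exact mul_le_mul_of_nonneg_left h1 (by positivity)
  rw [relax_const hs.ne'] at h2
  refine h2.trans (mul_le_mul_of_nonneg_right ?_ hM)
  have : x / s ≤ 1 / s := div_le_div_of_nonneg_right hx.2 hs.le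
  have := Real.exp_le_exp.2 (neg_le_neg this)
  linarith

theorem relax_nonneg (hs : 0 ≤ s) (hx : x ∈ Icc (0 : ℝ) 1) (hφ : ∀ y ∈ Icc (0 : ℝ) 1, 0 ≤ φ y) :
    0 ≤ relax s φ x :=
  mul_nonneg (by positivity) (intervalIntegral.integral_nonneg hx.1 fun y hy =>
    mul_nonneg (Real.exp_pos _).le (hφ y ⟨hy.1, hy.2.trans hx.2⟩))

theorem relax_sub (hx : x ∈ Icc (0 : ℝ) 1) (hφ : IntervalIntegrable φ volume 0 1)
    (hψ : IntervalIntegrable ψ volume 0 1) :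
    relax s φ x - relax s ψ x = relax s (fun y => φ y - ψ y) x := by
  have h : ∀ φ : ℝ → ℝ, IntervalIntegrable φ volume 0 1 →
      IntervalIntegrable (fun y => Real.exp (-((x - y) / s)) * φ y) volume 0 x := by
    intro φ hφ
    have : IntervalIntegrable φ volume 0 x := hφ.mono_set (by
      rw [uIcc_of_le hx.1, uIcc_of_le zero_le_one]
      exact Icc_subset_Icc le_rfl hx.2)
    exact this.continuousOn_mul (by fun_prop)
  rw [relax, relax, relax, ← mul_sub, ← intervalIntegral.integral_sub (h φ hφ) (h ψ hψ)]
  simp only [mul_sub]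

theorem relax_congr (hx : x ∈ Icc (0 : ℝ) 1) (h : ∀ y ∈ Icc (0 : ℝ) 1, φ y = ψ y) :
    relax s φ x = relax s ψ x := by
  rw [relax, relax]
  congr 1
  refine intervalIntegral.integral_congr fun y hy => ?_
  rw [uIcc_of_le hx.1] at hy
  simp only [h y ⟨hy.1, hy.2.trans hx.2⟩]

theorem continuous_relax (s : ℝ) (hφ : Continuous φ) : Continuous (relax s φ) :=
  continuous_const.mul (intervalIntegral.continuous_parametric_intervalIntegral_of_continuous
    (by fun_prop) continuous_id)

end Relax

/-! ### Transport with a source -/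

/-- Position measured from the wall at which the velocity points inwards. -/
def depth (x : ℝ) (v : V) : ℝ := if 0 < v 0 then x else 1 - x

/-- Damping of the inflow up to position `x`. -/
def attenuation (τ x : ℝ) (v : V) : ℝ := Real.exp (-(depth x v / (τ * |v 0|)))

/-- Fraction of the particles which collide within one crossing. -/
def absorbed (τ : ℝ) (v : V) : ℝ := 1 - Real.exp (-(1 / (τ * |v 0|)))

/-- Contribution of the source `Q`. -/
def collision (τ : ℝ) (Q : ℝ → V → ℝ) (x : ℝ) (v : V) : ℝ :=
  relax (τ * |v 0|) (fun y => Q (depth y v) v) (depth x v)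

/-- Mild solution of `v₁ ∂ₓ f = (Q - f) / τ` with inflow `k`. -/
def transport (τ : ℝ) (k : V → ℝ) (Q : ℝ → V → ℝ) (x : ℝ) (v : V) : ℝ :=
  attenuation τ x v * k v + collision τ Q x v

section Transport

variable {τ x : ℝ} {v : V}

theorem depth_mem (hx : x ∈ Icc (0 : ℝ) 1) (v : V) : depth x v ∈ Icc (0 : ℝ) 1 := by
  unfold depth
  split_ifs
  · exact hx
  · exact ⟨by linarith [hx.2], by linarith [hx.1]⟩

theorem continuous_depth (v : V) : Continuous fun x => depth x v := by
  unfold depth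
  split_ifs <;> fun_prop

theorem measurable_depth (x : ℝ) : Measurable (depth x) :=
  Measurable.ite (measurableSet_lt (by fun_prop) (by fun_prop)) measurable_const measurable_const

theorem measurable_attenuation (τ x : ℝ) : Measurable (attenuation τ x) :=
  Real.measurable_exp.comp ((measurable_depth x).div (by fun_prop)).neg

theorem measurable_absorbed (τ : ℝ) : Measurable (absorbed τ) := by
  unfold absorbed
  fun_prop

theorem attenuation_pos (τ x : ℝ) (v : V) : 0 < attenuation τ x v := Real.exp_pos _

theorem attenuation_le_one (hτ : 0 ≤ τ) (hx : x ∈ Icc (0 : ℝ) 1) (v : V) :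
    attenuation τ x v ≤ 1 := by
  rw [attenuation, Real.exp_le_one_iff]
  have := (depth_mem hx v).1
  have : 0 ≤ depth x v / (τ * |v 0|) := by positivity
  linarith

theorem exp_le_attenuation (hτ : 0 ≤ τ) (hx : x ∈ Icc (0 : ℝ) 1) (v : V) :
    Real.exp (-(1 / (τ * |v 0|))) ≤ attenuation τ x v :=
  Real.exp_le_exp.2 (neg_le_neg (div_le_div_of_nonneg_right (depth_mem hx v).2 (by positivity)))

theorem absorbed_nonneg (hτ : 0 ≤ τ) (v : V) : 0 ≤ absorbed τ v := by
  have : 0 ≤ 1 / (τ * |v 0|) := by positivity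
  have : Real.exp (-(1 / (τ * |v 0|))) ≤ 1 := Real.exp_le_one_iff.2 (by linarith)
  rw [absorbed]
  linarith

theorem absorbed_le_one (τ : ℝ) (v : V) : absorbed τ v ≤ 1 := by
  have := Real.exp_pos (-(1 / (τ * |v 0|)))
  rw [absorbed]
  linarith

theorem abs_collision_le (hτ : 0 ≤ τ) (hx : x ∈ Icc (0 : ℝ) 1) {Q : ℝ → V → ℝ} {M : ℝ}
    (hQ : ∀ y ∈ Icc (0 : ℝ) 1, |Q y v| ≤ M) : |collision τ Q x v| ≤ absorbed τ v * M :=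
  abs_relax_le (by positivity) (depth_mem hx v) fun y hy => hQ _ (depth_mem hy v)

theorem collision_nonneg (hτ : 0 ≤ τ) (hx : x ∈ Icc (0 : ℝ) 1) {Q : ℝ → V → ℝ}
    (hQ : ∀ y ∈ Icc (0 : ℝ) 1, 0 ≤ Q y v) : 0 ≤ collision τ Q x v :=
  relax_nonneg (by positivity) (depth_mem hx v) fun y hy => hQ _ (depth_mem hy v)

theorem intervalIntegrable_depth {Q : ℝ → V → ℝ}
    (hQ : IntervalIntegrable (fun y => Q y v) volume 0 1) :
    IntervalIntegrable (fun y => Q (depth y v) v) volume 0 1 := by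
  unfold depth
  split_ifs
  · exact hQ
  · simpa using (hQ.comp_sub_left 1).symm

theorem collision_sub (hx : x ∈ Icc (0 : ℝ) 1) {Q Q' : ℝ → V → ℝ}
    (hQ : IntervalIntegrable (fun y => Q y v) volume 0 1)
    (hQ' : IntervalIntegrable (fun y => Q' y v) volume 0 1) :
    collision τ Q x v - collision τ Q' x v = collision τ (fun y v => Q y v - Q' y v) x v :=
  relax_sub (depth_mem hx v) (intervalIntegrable_depth hQ) (intervalIntegrable_depth hQ')

theorem collision_congr (hx : x ∈ Icc (0 : ℝ) 1) {Q Q' : ℝ → V → ℝ}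
    (h : ∀ y ∈ Icc (0 : ℝ) 1, Q y v = Q' y v) : collision τ Q x v = collision τ Q' x v :=
  relax_congr (depth_mem hx v) fun _ hy => h _ (depth_mem hy v)

/-- Stability of transport with respect to the inflow and the source. -/
theorem abs_transport_sub_le (hτ : 0 ≤ τ) (hx : x ∈ Icc (0 : ℝ) 1) {k k' : V → ℝ}
    {Q Q' : ℝ → V → ℝ} {M : ℝ} (hQ : IntervalIntegrable (fun y => Q y v) volume 0 1)
    (hQ' : IntervalIntegrable (fun y => Q' y v) volume 0 1)
    (hM : ∀ y ∈ Icc (0 : ℝ) 1, |Q y v - Q' y v| ≤ M) :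
    |transport τ k Q x v - transport τ k' Q' x v| ≤ |k v - k' v| + absorbed τ v * M := by
  have h : transport τ k Q x v - transport τ k' Q' x v =
      attenuation τ x v * (k v - k' v) + collision τ (fun y v => Q y v - Q' y v) x v := by
    rw [← collision_sub hx hQ hQ', transport, transport]
    ring
  rw [h]
  refine (abs_add_le _ _).trans (add_le_add ?_ (abs_collision_le hτ hx hM))
  rw [abs_mul, abs_of_pos (attenuation_pos _ _ _)]
  exact mul_le_of_le_one_left (abs_nonneg _) (attenuation_le_one hτ hx v)

theorem continuous_attenuation (τ : ℝ) (v : V) : Continuous fun x => attenuation τ x v :=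
  Real.continuous_exp.comp ((continuous_depth v).div_const _).neg

theorem continuous_collision {Q : ℝ → V → ℝ} (τ : ℝ) (v : V) (hQ : Continuous (Q · v)) :
    Continuous fun x => collision τ Q x v :=
  (continuous_relax _ (hQ.comp (continuous_depth v))).comp (continuous_depth v)

/-- On each half space the depth is the same number for all velocities. The collision term is there
a parametric integral with fixed endpoints, measurable by Fubini. -/
theorem stronglyMeasurable_collision {Q : ℝ → V → ℝ} (τ x : ℝ)
    (hQ : Measurable (Function.uncurry Q)) : StronglyMeasurable (collision τ Q x) := by
  have key : ∀ (a : ℝ) (φ : V → ℝ → ℝ), Measurable (Function.uncurry φ) →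
      StronglyMeasurable fun v : V => 1 / (τ * |v 0|) *
        ∫ y in (0 : ℝ)..a, Real.exp (-((a - y) / (τ * |v 0|))) * φ v y := by
    intro a φ hφ
    have h1 : StronglyMeasurable (Function.uncurry fun (v : V) (y : ℝ) =>
        Real.exp (-((a - y) / (τ * |v 0|))) * φ v y) := by
      refine Measurable.stronglyMeasurable (Measurable.mul ?_ hφ)
      fun_prop
    refine StronglyMeasurable.mul (Measurable.stronglyMeasurable (by fun_prop)) ?_
    unfold intervalIntegral
    exact h1.integral_prod_right.sub h1.integral_prod_right
  have h2 : collision τ Q x = fun v : V => if 0 < v 0 then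
      1 / (τ * |v 0|) * (∫ y in (0 : ℝ)..x, Real.exp (-((x - y) / (τ * |v 0|))) * Q y v) else
      1 / (τ * |v 0|) * ∫ y in (0 : ℝ)..(1 - x),
        Real.exp (-((1 - x - y) / (τ * |v 0|))) * Q (1 - y) v := by
    ext v
    unfold collision relax depth
    split_ifs <;> rfl
  rw [h2]
  refine StronglyMeasurable.ite (measurableSet_lt (by fun_prop) (by fun_prop))
    (key x (fun v y => Q y v) (hQ.comp measurable_swap))
    (key (1 - x) (fun v y => Q (1 - y) v)
      (hQ.comp (g := Function.uncurry Q) (f := fun q : V × ℝ => (1 - q.2, q.1)) (by fun_prop)))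

/-- The absorbed fraction tends to 0 at every velocity, but not uniformly near v₁ = 0; dominated
convergence is enough, and no rate in τ is needed. -/
theorem tendsto_integral_absorbed {Φ : V → ℝ} (hΦ : Integrable Φ) :
    Filter.Tendsto (fun τ => ∫ v, absorbed τ v * Φ v) Filter.atTop (nhds 0) := by
  rw [← integral_zero V ℝ]
  refine tendsto_integral_filter_of_dominated_convergence (fun v => ‖Φ v‖)
    (Filter.Eventually.of_forall fun τ =>
      (measurable_absorbed τ).aestronglyMeasurable.mul hΦ.aestronglyMeasurable)
    ?_ hΦ.norm (ae_of_all _ fun v => ?_)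
  · filter_upwards [Filter.eventually_ge_atTop 0] with τ hτ
    refine ae_of_all _ fun v => ?_
    rw [norm_mul, Real.norm_of_nonneg (absorbed_nonneg hτ v)]
    exact mul_le_of_le_one_left (norm_nonneg _) (absorbed_le_one τ v)
  · rcases eq_or_ne (v 0) 0 with h | h
    · simp [absorbed, h]
    have h1 : Filter.Tendsto (fun τ : ℝ => 1 / (τ * |v 0|)) Filter.atTop (nhds 0) :=
      (Filter.tendsto_id.atTop_mul_const (abs_pos.2 h)).const_div_atTop 1
    have h2 := (Real.continuous_exp.tendsto 0).comp (by simpa using h1.neg)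
    have h3 := ((tendsto_const_nhds (x := (1 : ℝ))).sub h2).mul_const (Φ v)
    simpa [absorbed] using h3

end Transport

/-! ### Specular reflection -/

theorem reflect_reflect (v : V) : reflect (reflect v) = v := by
  ext i
  fin_cases i <;> simp [reflect]

/-- Specular reflection as a linear isometry. -/
def reflectIsometry : V ≃ₗᵢ[ℝ] V where
  toLinearEquiv := LinearEquiv.ofInvolutive
    { toFun := reflect
      map_add' := fun v w => by
        ext i
        fin_cases i <;> simp [reflect, add_comm]
      map_smul' := fun c v => by
        ext i
        fin_cases i <;> simp [reflect] } reflect_reflect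
  norm_map' := fun v => by
    have : ‖reflect v‖ = ‖v‖ := by
      simp [reflect, EuclideanSpace.norm_eq, Fin.sum_univ_three]
    exact this

theorem norm_reflect (v : V) : ‖reflect v‖ = ‖v‖ := reflectIsometry.norm_map v

theorem reflect_zero_apply (v : V) : reflect v 0 = -v 0 := by simp [reflect]

theorem measurePreserving_reflect : MeasurePreserving reflect (volume : Measure V) volume :=
  reflectIsometry.measurePreserving

theorem measurableEmbedding_reflect : MeasurableEmbedding reflect :=
  reflectIsometry.toHomeomorph.measurableEmbedding

theorem integral_comp_reflect (g : V → ℝ) : ∫ v, g (reflect v) = ∫ v, g v :=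
  measurePreserving_reflect.integral_comp measurableEmbedding_reflect g

theorem integrable_energy_reflect {h : V → ℝ}
    (hh : Integrable fun v : V => h v * (1 + ‖v‖ ^ 2)) :
    Integrable fun v : V => h (reflect v) * (1 + ‖v‖ ^ 2) := by
  have := (measurePreserving_reflect.integrable_comp_emb measurableEmbedding_reflect).2 hh
  refine this.congr (ae_of_all _ fun v => ?_)
  simp [norm_reflect]

theorem ae_comp_reflect {P : V → Prop} (h : ∀ᵐ v : V, P v) : ∀ᵐ v : V, P (reflect v) :=
  measurePreserving_reflect.quasiMeasurePreserving.ae h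

/-- A proper subspace is null, so the values chosen at v₁ = 0 in `depth`, `glue` and `outgoing` are
immaterial. -/
theorem ae_apply_zero_ne_zero : ∀ᵐ v : V, v 0 ≠ 0 := by
  have h := Measure.addHaar_submodule (volume : Measure V)
    (LinearMap.ker (EuclideanSpace.proj (𝕜 := ℝ) (0 : Fin 3)).toLinearMap) (by
      intro h
      have : (EuclideanSpace.single 0 1 : V) ∈
        LinearMap.ker (EuclideanSpace.proj (𝕜 := ℝ) (0 : Fin 3)).toLinearMap := h ▸ trivial
      simp at this)
  rw [ae_iff]
  convert! h using 2
  ext v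
  simp

/-! ### Mixed boundary conditions -/

/-- The outgoing mass flux at the wall where `v` points inwards. -/
def wallFlux (h : V → ℝ) (v : V) : ℝ :=
  if 0 < v 0 then ∫ w in {w : V | w 0 < 0}, h w * |w 0| else ∫ w in {w : V | 0 < w 0}, h w * |w 0|

/-- The inflow for outgoing traces `h`, inflow data `p` and wall distributions `W`. -/
def inflow (δ₁ δ₂ δ₃ : ℝ) (p W h : V → ℝ) (v : V) : ℝ :=
  δ₁ * p v + δ₂ * wallFlux h v * W v + δ₃ * h (reflect v)

/-- The part of the trace of `f` with velocities pointing out of the domain. -/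
def outgoing (f : ℝ → V → ℝ) (v : V) : ℝ := if 0 < v 0 then f 1 v else f 0 v

section Boundary

variable {δ₁ δ₂ δ₃ : ℝ} {p W h h' : V → ℝ}

theorem integrable_flux (hh : Integrable fun v : V => h v * (1 + ‖v‖ ^ 2)) :
    Integrable fun v : V => h v * |v 0| :=
  integrable_mul_of_energy (C := 1) hh (by fun_prop) fun v => by simpa using abs_apply_le v 0

theorem wallFlux_sub (hh : Integrable fun v : V => h v * (1 + ‖v‖ ^ 2))
    (hh' : Integrable fun v : V => h' v * (1 + ‖v‖ ^ 2)) (v : V) :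
    wallFlux h v - wallFlux h' v = wallFlux (fun v => h v - h' v) v := by
  unfold wallFlux
  simp only [sub_mul]
  split_ifs <;>
  exact (integral_sub (integrable_flux hh).integrableOn (integrable_flux hh').integrableOn).symm

/-- The flux weight |v₁| is at most 1 + |v|², so the energy norm of the trace bounds both wall
fluxes. -/
theorem abs_wallFlux_le (hh : Integrable fun v : V => h v * (1 + ‖v‖ ^ 2)) (v : V) :
    |wallFlux h v| ≤ ∫ w, |h w| * (1 + ‖w‖ ^ 2) := by
  have key : ∀ S : Set V, abs (∫ w in S, h w * |w 0|) ≤ ∫ w, |h w| * (1 + ‖w‖ ^ 2) := by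
    intro S
    rw [← Real.norm_eq_abs]
    refine (norm_integral_le_of_norm_le (integrable_abs_energy hh).integrableOn
      (ae_of_all _ fun v => ?_)).trans
      (setIntegral_le_integral (integrable_abs_energy hh) (ae_of_all _ fun v => by positivity))
    rw [norm_mul, Real.norm_eq_abs, Real.norm_eq_abs, abs_abs]
    exact mul_le_mul_of_nonneg_left (by simpa using abs_apply_le v 0) (abs_nonneg _)
  unfold wallFlux
  split_ifs
  exacts [key _, key _]

theorem wallFlux_nonneg (hh : ∀ᵐ v, 0 ≤ h v) (v : V) : 0 ≤ wallFlux h v := by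
  unfold wallFlux
  split_ifs <;>
  exact integral_nonneg_of_ae (ae_restrict_of_ae (hh.mono fun v hv => mul_nonneg hv (abs_nonneg _)))

theorem measurable_wallFlux (h : V → ℝ) : Measurable (wallFlux h) :=
  Measurable.ite (measurableSet_lt (by fun_prop) (by fun_prop)) measurable_const measurable_const

theorem integrable_inflow (hp : Integrable fun v : V => p v * (1 + ‖v‖ ^ 2))
    (hW : Integrable fun v : V => W v * (1 + ‖v‖ ^ 2))
    (hh : Integrable fun v : V => h v * (1 + ‖v‖ ^ 2)) :
    Integrable fun v : V => inflow δ₁ δ₂ δ₃ p W h v * (1 + ‖v‖ ^ 2) := by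
  have h2 : Integrable fun v : V => wallFlux h v * (W v * (1 + ‖v‖ ^ 2)) :=
    hW.bdd_mul (measurable_wallFlux h).aestronglyMeasurable
      (ae_of_all _ fun v => abs_wallFlux_le hh v)
  refine (((hp.const_mul δ₁).add (h2.const_mul δ₂)).add
    ((integrable_energy_reflect hh).const_mul δ₃)).congr (ae_of_all _ fun v => ?_)
  simp only [Pi.add_apply, inflow]
  ring

theorem abs_inflow_sub_le (hδ₂ : 0 ≤ δ₂) (hδ₃ : 0 ≤ δ₃) (hW : ∀ v, 0 ≤ W v)
    (hh : Integrable fun v : V => h v * (1 + ‖v‖ ^ 2))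
    (hh' : Integrable fun v : V => h' v * (1 + ‖v‖ ^ 2)) (v : V) :
    |inflow δ₁ δ₂ δ₃ p W h v - inflow δ₁ δ₂ δ₃ p W h' v| ≤
      δ₂ * (∫ w, |h w - h' w| * (1 + ‖w‖ ^ 2)) * W v + δ₃ * |h (reflect v) - h' (reflect v)| := by
  have e : inflow δ₁ δ₂ δ₃ p W h v - inflow δ₁ δ₂ δ₃ p W h' v =
      δ₂ * (wallFlux h v - wallFlux h' v) * W v + δ₃ * (h (reflect v) - h' (reflect v)) := by
    rw [inflow, inflow]; ring
  rw [e, wallFlux_sub hh hh']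
  refine (abs_add_le _ _).trans ?_
  rw [abs_mul, abs_mul, abs_mul, abs_of_nonneg hδ₂, abs_of_nonneg hδ₃, abs_of_nonneg (hW v)]
  have := abs_wallFlux_le (h := fun v => h v - h' v)
    ((hh.sub hh').congr (ae_of_all _ fun v => by simp [sub_mul])) v
  have := hW v
  gcongr

end Boundary

/-! ### The contraction estimate -/

/-- Conditions under which the solution map contracts: the Gaussian is bounded by `Ψ` and Lipschitz
with modulus `Ψ` on the set `Ω` of moments, and re-emission and collisions are weak. -/
structure WeakInteraction (ν τ δ₁ δ₂ δ₃ : ℝ) (p W : V → ℝ) (Ω : Set Moments) (Ψ : V → ℝ) :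
    Prop where
  time_pos : 0 < τ
  inflow_nonneg : 0 ≤ δ₁
  diffuse_nonneg : 0 ≤ δ₂
  specular_nonneg : 0 ≤ δ₃
  data_nonneg : ∀ᵐ v, 0 ≤ p v
  data_integrable : Integrable fun v : V => p v * (1 + ‖v‖ ^ 2)
  wall_nonneg : ∀ v, 0 ≤ W v
  wall_integrable : Integrable fun v : V => W v * (1 + ‖v‖ ^ 2)
  bound_nonneg : ∀ v, 0 ≤ Ψ v
  bound_integrable : Integrable fun v : V => Ψ v * (1 + ‖v‖ ^ 2)
  gaussian_mem : ∀ m ∈ Ω, ∀ v, 0 ≤ m.gaussian ν v ∧ m.gaussian ν v ≤ Ψ v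
  gaussian_lipschitz : ∀ m ∈ Ω, ∀ m' ∈ Ω, ∀ v,
    |m.gaussian ν v - m'.gaussian ν v| ≤ ‖m - m'‖ * Ψ v
  reemission_le : δ₂ * (∫ v, W v * (1 + ‖v‖ ^ 2)) + δ₃ ≤ 1 / 4
  collision_le : ∫ v, absorbed τ v * (Ψ v * (1 + ‖v‖ ^ 2)) ≤ 1 / 4

/-- `f` is the free transport of the inflow data, up to a nonnegative part of energy at most `η`. -/
structure NearFree (η δ₁ τ x : ℝ) (p f : V → ℝ) : Prop where
  integrable : Integrable fun v : V => f v * (1 + ‖v‖ ^ 2)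
  ge : ∀ᵐ v, δ₁ * (attenuation τ x v * p v) ≤ f v
  le : ∫ v, (f v - δ₁ * (attenuation τ x v * p v)) * (1 + ‖v‖ ^ 2) ≤ η

section Contraction

variable {ν τ δ₁ δ₂ δ₃ : ℝ} {p W : V → ℝ} {Ω : Set Moments} {Ψ : V → ℝ}

theorem integrable_absorbed_mul (hτ : 0 ≤ τ) {Φ : V → ℝ} (hΦ : Integrable Φ) :
    Integrable fun v => absorbed τ v * Φ v :=
  hΦ.bdd_mul (c := 1) (measurable_absorbed τ).aestronglyMeasurable (ae_of_all _ fun v => by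
    rw [Real.norm_of_nonneg (absorbed_nonneg hτ v)]; exact absorbed_le_one τ v)

/-- The number `D` bounds the distance of the traces and also of the moments, through the factor of
`Ψ`. Reflection preserves the energy norm, so re-emission contributes at most D/4, and the
collisions another D/4. -/
theorem integral_diff_le (H : WeakInteraction ν τ δ₁ δ₂ δ₃ p W Ω Ψ) {h h' F F' : V → ℝ} {D : ℝ}
    (hh : Integrable fun v : V => h v * (1 + ‖v‖ ^ 2))
    (hh' : Integrable fun v : V => h' v * (1 + ‖v‖ ^ 2))
    (hD : ∫ v, |h v - h' v| * (1 + ‖v‖ ^ 2) ≤ D)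
    (hF : ∀ᵐ v, |F v - F' v| ≤
      |inflow δ₁ δ₂ δ₃ p W h v - inflow δ₁ δ₂ δ₃ p W h' v| + absorbed τ v * (D * Ψ v)) :
    ∫ v, |F v - F' v| * (1 + ‖v‖ ^ 2) ≤ D / 2 := by
  have hd : Integrable fun v : V => |h v - h' v| * (1 + ‖v‖ ^ 2) :=
    integrable_abs_energy (g := fun v => h v - h' v)
      ((hh.sub hh').congr (ae_of_all _ fun v => by simp [sub_mul]))
  have hd0 : 0 ≤ ∫ v, |h v - h' v| * (1 + ‖v‖ ^ 2) := integral_nonneg fun v => by positivity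
  have hdr := integrable_energy_reflect hd
  have hW := H.wall_integrable
  have hΨ := integrable_absorbed_mul H.time_pos.le H.bound_integrable
  set e := ∫ v, |h v - h' v| * (1 + ‖v‖ ^ 2) with he
  have h1 : ∫ v, |F v - F' v| * (1 + ‖v‖ ^ 2) ≤
      ∫ v, ((δ₂ * e) * (W v * (1 + ‖v‖ ^ 2)) +
        δ₃ * (|h (reflect v) - h' (reflect v)| * (1 + ‖v‖ ^ 2)) +
        D * (absorbed τ v * (Ψ v * (1 + ‖v‖ ^ 2))) + 0 * (W v * (1 + ‖v‖ ^ 2))) := by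
    refine integral_mono_of_nonneg (ae_of_all _ fun v => by positivity)
      ((((hW.const_mul _).add (hdr.const_mul _)).add (hΨ.const_mul _)).add (hW.const_mul _)) ?_
    filter_upwards [hF] with v hv
    have h2 := abs_inflow_sub_le (δ₁ := δ₁) (p := p) H.diffuse_nonneg H.specular_nonneg
      H.wall_nonneg hh hh' v
    calc _ ≤ (δ₂ * e * W v + δ₃ * |h (reflect v) - h' (reflect v)| +
          absorbed τ v * (D * Ψ v)) * (1 + ‖v‖ ^ 2) := by
          gcongr
          exact hv.trans (add_le_add_left h2 _)
      _ = _ := by ring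
  have hr : ∫ v, |h (reflect v) - h' (reflect v)| * (1 + ‖v‖ ^ 2) = e := by
    rw [he, ← integral_comp_reflect fun v => |h v - h' v| * (1 + ‖v‖ ^ 2)]
    simp only [norm_reflect]
  have h3 : ∫ v, ((δ₂ * e) * (W v * (1 + ‖v‖ ^ 2)) +
        δ₃ * (|h (reflect v) - h' (reflect v)| * (1 + ‖v‖ ^ 2)) +
        D * (absorbed τ v * (Ψ v * (1 + ‖v‖ ^ 2))) + 0 * (W v * (1 + ‖v‖ ^ 2))) =
      (δ₂ * e) * (∫ v, W v * (1 + ‖v‖ ^ 2)) + δ₃ * e +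
        D * ∫ v, absorbed τ v * (Ψ v * (1 + ‖v‖ ^ 2)) := by
    have i1 := hW.const_mul (δ₂ * e)
    have := integral_combination i1 hdr hΨ hW δ₃ D 0
    rw [this, hr, integral_const_mul]
    ring
  rw [h3] at h1
  have h4 := H.reemission_le
  have h5 := H.collision_le
  have hD0 : 0 ≤ D := hd0.trans hD
  have h6 : (δ₂ * e) * (∫ v, W v * (1 + ‖v‖ ^ 2)) + δ₃ * e ≤ D * (1 / 4) := by
    calc _ = e * (δ₂ * (∫ v, W v * (1 + ‖v‖ ^ 2)) + δ₃) := by ring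
      _ ≤ e * (1 / 4) := by gcongr
      _ ≤ _ := by gcongr
  have h7 := mul_le_mul_of_nonneg_left h5 hD0
  linarith

/-- Beyond the attenuated data only attenuated re-emission and collisions are left, both
nonnegative. The position may depend on `v`, so that the estimate also covers the outgoing trace,
whose wall is selected by the sign of v₁. -/
theorem transport_remainder (H : WeakInteraction ν τ δ₁ δ₂ δ₃ p W Ω Ψ) {h f : V → ℝ}
    {Q : ℝ → V → ℝ} {x : V → ℝ} {B η : ℝ} (hx : ∀ v, x v ∈ Icc (0 : ℝ) 1)
    (hh : Integrable fun v : V => h v * (1 + ‖v‖ ^ 2)) (hh0 : ∀ᵐ v, 0 ≤ h v)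
    (hB : ∫ v, |h v| * (1 + ‖v‖ ^ 2) ≤ B)
    (hQ : ∀ y ∈ Icc (0 : ℝ) 1, ∀ v, 0 ≤ Q y v ∧ Q y v ≤ Ψ v)
    (hη : (δ₂ * (∫ v, W v * (1 + ‖v‖ ^ 2)) + δ₃) * B +
      ∫ v, absorbed τ v * (Ψ v * (1 + ‖v‖ ^ 2)) ≤ η)
    (hft : ∀ᵐ v, f v = transport τ (inflow δ₁ δ₂ δ₃ p W h) Q (x v) v) :
    (∀ᵐ v, δ₁ * (attenuation τ (x v) v * p v) ≤ f v) ∧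
      ∫ v, (f v - δ₁ * (attenuation τ (x v) v * p v)) * (1 + ‖v‖ ^ 2) ≤ η := by
  have e : ∀ v, transport τ (inflow δ₁ δ₂ δ₃ p W h) Q (x v) v - δ₁ * (attenuation τ (x v) v * p v) =
      attenuation τ (x v) v * (δ₂ * wallFlux h v * W v + δ₃ * h (reflect v)) +
        collision τ Q (x v) v := fun v => by
    rw [transport, inflow]; ring
  have hin : ∀ᵐ v, 0 ≤ δ₂ * wallFlux h v * W v + δ₃ * h (reflect v) := by
    filter_upwards [ae_comp_reflect hh0] with v hv
    have := wallFlux_nonneg hh0 v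
    have := H.wall_nonneg v
    have := H.diffuse_nonneg
    have := H.specular_nonneg
    positivity
  refine ⟨?_, ?_⟩
  · filter_upwards [hft, hin] with v hv hin
    have h1 := collision_nonneg (τ := τ) H.time_pos.le (hx v) fun y hy => (hQ y hy v).1
    have h2 := mul_nonneg (attenuation_pos τ (x v) v).le hin
    rw [hv]
    linarith [e v]
  · have hW := H.wall_integrable
    have hΨ := integrable_absorbed_mul H.time_pos.le H.bound_integrable
    have hr := integrable_energy_reflect (integrable_abs_energy hh)
    have hre : ∫ v, |h (reflect v)| * (1 + ‖v‖ ^ 2) = ∫ v, |h v| * (1 + ‖v‖ ^ 2) := by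
      rw [← integral_comp_reflect fun v => |h v| * (1 + ‖v‖ ^ 2)]
      simp only [norm_reflect]
    have hB0 : 0 ≤ ∫ v, |h v| * (1 + ‖v‖ ^ 2) := integral_nonneg fun v => by positivity
    have h1 : ∫ v, (f v - δ₁ * (attenuation τ (x v) v * p v)) * (1 + ‖v‖ ^ 2) ≤
        ∫ v, ((δ₂ * B) * (W v * (1 + ‖v‖ ^ 2)) + δ₃ * (|h (reflect v)| * (1 + ‖v‖ ^ 2)) +
          1 * (absorbed τ v * (Ψ v * (1 + ‖v‖ ^ 2))) + 0 * (W v * (1 + ‖v‖ ^ 2))) := by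
      refine integral_mono_of_nonneg ?_
        ((((hW.const_mul _).add (hr.const_mul _)).add (hΨ.const_mul _)).add (hW.const_mul _)) ?_
      · filter_upwards [hft, hin] with v hv hin
        have h1 := collision_nonneg (τ := τ) H.time_pos.le (hx v) fun y hy => (hQ y hy v).1
        have h2 := mul_nonneg (attenuation_pos τ (x v) v).le hin
        have h3 := e v
        rw [← hv] at h3
        rw [h3]
        exact mul_nonneg (add_nonneg h2 h1) (by positivity)
      · filter_upwards [hft, hin] with v hv hin
        have h3 := e v
        rw [← hv] at h3
        simp only [h3]
        have h4 : attenuation τ (x v) v * (δ₂ * wallFlux h v * W v + δ₃ * h (reflect v)) ≤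
            δ₂ * B * W v + δ₃ * |h (reflect v)| := by
          refine (mul_le_of_le_one_left hin (attenuation_le_one H.time_pos.le (hx v) v)).trans ?_
          have h5 := (le_abs_self _).trans ((abs_wallFlux_le hh v).trans hB)
          have := H.wall_nonneg v
          have := H.diffuse_nonneg
          have := H.specular_nonneg
          have := le_abs_self (h (reflect v))
          gcongr
        have h6 := (le_abs_self _).trans (abs_collision_le (τ := τ) H.time_pos.le (hx v)
          (Q := Q) (v := v) (M := Ψ v) fun y hy => by
            rw [abs_of_nonneg (hQ y hy v).1]; exact (hQ y hy v).2)
        calc _ ≤ (δ₂ * B * W v + δ₃ * |h (reflect v)| + absorbed τ v * Ψ v) * (1 + ‖v‖ ^ 2) := by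
              gcongr
          _ = _ := by ring
    have i1 := hW.const_mul (δ₂ * B)
    have h7 := integral_combination i1 hr hΨ hW δ₃ 1 0
    rw [h7, hre, integral_const_mul] at h1
    have h8 := mul_le_mul_of_nonneg_left hB H.specular_nonneg
    linarith

/-! ### The solution map -/

/-- The field with outgoing trace `h` entering the boundary condition and Gaussians of moments `m`. -/
def field (ν τ δ₁ δ₂ δ₃ : ℝ) (p W : V → ℝ) (m : ℝ → Moments) (h : V → ℝ) (x : ℝ) (v : V) : ℝ :=
  transport τ (inflow δ₁ δ₂ δ₃ p W h) (fun y v => (m y).gaussian ν v) x v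

/-- Bound for all fields. -/
def envelope (δ₁ δ₂ δ₃ : ℝ) (p W Ψ h : V → ℝ) (v : V) : ℝ := |inflow δ₁ δ₂ δ₃ p W h v| + Ψ v

section Field

variable {m : ℝ → Moments} {h : V → ℝ}

theorem integrable_envelope (H : WeakInteraction ν τ δ₁ δ₂ δ₃ p W Ω Ψ)
    (hh : Integrable fun v : V => h v * (1 + ‖v‖ ^ 2)) :
    Integrable fun v : V => envelope δ₁ δ₂ δ₃ p W Ψ h v * (1 + ‖v‖ ^ 2) := by
  refine ((integrable_abs_energy (integrable_inflow (δ₁ := δ₁) (δ₂ := δ₂) (δ₃ := δ₃)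
    H.data_integrable H.wall_integrable hh)).add H.bound_integrable).congr
    (ae_of_all _ fun v => ?_)
  simp only [Pi.add_apply, envelope]
  ring

theorem abs_field_le (H : WeakInteraction ν τ δ₁ δ₂ δ₃ p W Ω Ψ) (hmΩ : ∀ y, m y ∈ Ω) {x : ℝ}
    (hx : x ∈ Icc (0 : ℝ) 1) (v : V) :
    |field ν τ δ₁ δ₂ δ₃ p W m h x v| ≤ envelope δ₁ δ₂ δ₃ p W Ψ h v := by
  refine (abs_add_le _ _).trans (add_le_add ?_ ?_)
  · rw [abs_mul, abs_of_pos (attenuation_pos _ _ _)]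
    exact mul_le_of_le_one_left (abs_nonneg _) (attenuation_le_one H.time_pos.le hx v)
  · refine (abs_collision_le (M := Ψ v) H.time_pos.le hx fun y _ => ?_).trans
      (mul_le_of_le_one_left (H.bound_nonneg v) (absorbed_le_one τ v))
    rw [abs_of_nonneg (H.gaussian_mem _ (hmΩ y) v).1]
    exact (H.gaussian_mem _ (hmΩ y) v).2

theorem continuous_gaussian_comp
    (hG : ContinuousOn (fun q : Moments × V => q.1.gaussian ν q.2) (Ω ×ˢ univ))
    (hm : Continuous m) (hmΩ : ∀ y, m y ∈ Ω) :
    Continuous (Function.uncurry fun y v => (m y).gaussian ν v) :=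
  hG.comp_continuous (f := fun q : ℝ × V => (m q.1, q.2)) (by fun_prop) fun q => ⟨hmΩ q.1, trivial⟩

theorem continuous_gaussian_path
    (hG : ContinuousOn (fun q : Moments × V => q.1.gaussian ν q.2) (Ω ×ˢ univ))
    (hm : Continuous m) (hmΩ : ∀ y, m y ∈ Ω) (v : V) :
    Continuous fun y => (m y).gaussian ν v :=
  (continuous_gaussian_comp hG hm hmΩ).comp (by fun_prop : Continuous fun y : ℝ => (y, v))

theorem continuous_field
    (hG : ContinuousOn (fun q : Moments × V => q.1.gaussian ν q.2) (Ω ×ˢ univ))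
    (hm : Continuous m) (hmΩ : ∀ y, m y ∈ Ω) (v : V) :
    Continuous fun x => field ν τ δ₁ δ₂ δ₃ p W m h x v :=
  ((continuous_attenuation τ v).mul continuous_const).add
    (continuous_collision τ v (continuous_gaussian_path hG hm hmΩ v))

theorem aestronglyMeasurable_inflow (H : WeakInteraction ν τ δ₁ δ₂ δ₃ p W Ω Ψ)
    (hh : Integrable fun v : V => h v * (1 + ‖v‖ ^ 2)) :
    AEStronglyMeasurable (inflow δ₁ δ₂ δ₃ p W h) :=
  aestronglyMeasurable_of_energy (integrable_inflow H.data_integrable H.wall_integrable hh)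

theorem aestronglyMeasurable_field (H : WeakInteraction ν τ δ₁ δ₂ δ₃ p W Ω Ψ)
    (hG : ContinuousOn (fun q : Moments × V => q.1.gaussian ν q.2) (Ω ×ˢ univ))
    (hm : Continuous m) (hmΩ : ∀ y, m y ∈ Ω)
    (hh : Integrable fun v : V => h v * (1 + ‖v‖ ^ 2)) (x : ℝ) :
    AEStronglyMeasurable (field ν τ δ₁ δ₂ δ₃ p W m h x) :=
  ((measurable_attenuation τ x).aestronglyMeasurable.mul (aestronglyMeasurable_inflow H hh)).add
    (stronglyMeasurable_collision τ x
      (continuous_gaussian_comp hG hm hmΩ).measurable).aestronglyMeasurable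

/-- Attenuation and collision term are Carathéodory functions, continuous in x and measurable in v,
hence jointly measurable. -/
theorem aestronglyMeasurable_uncurry_field (H : WeakInteraction ν τ δ₁ δ₂ δ₃ p W Ω Ψ)
    (hG : ContinuousOn (fun q : Moments × V => q.1.gaussian ν q.2) (Ω ×ˢ univ))
    (hm : Continuous m) (hmΩ : ∀ y, m y ∈ Ω)
    (hh : Integrable fun v : V => h v * (1 + ‖v‖ ^ 2)) (μ : Measure ℝ) [SFinite μ] :
    AEStronglyMeasurable (Function.uncurry (field ν τ δ₁ δ₂ δ₃ p W m h)) (μ.prod volume) := by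
  have h1 : StronglyMeasurable (Function.uncurry fun x v => attenuation τ x v) :=
    stronglyMeasurable_uncurry_of_continuous_of_stronglyMeasurable (continuous_attenuation τ)
      fun x => (measurable_attenuation τ x).stronglyMeasurable
  have h2 : StronglyMeasurable (Function.uncurry fun x v =>
      collision τ (fun y v => (m y).gaussian ν v) x v) :=
    stronglyMeasurable_uncurry_of_continuous_of_stronglyMeasurable
      (fun v => continuous_collision τ v (continuous_gaussian_path hG hm hmΩ v))
      fun x => stronglyMeasurable_collision τ x (continuous_gaussian_comp hG hm hmΩ).measurable
  exact (h1.aestronglyMeasurable.mul (aestronglyMeasurable_inflow H hh).comp_snd).add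
    h2.aestronglyMeasurable

theorem integrable_field (H : WeakInteraction ν τ δ₁ δ₂ δ₃ p W Ω Ψ)
    (hG : ContinuousOn (fun q : Moments × V => q.1.gaussian ν q.2) (Ω ×ˢ univ))
    (hm : Continuous m) (hmΩ : ∀ y, m y ∈ Ω)
    (hh : Integrable fun v : V => h v * (1 + ‖v‖ ^ 2)) {x : ℝ} (hx : x ∈ Icc (0 : ℝ) 1) :
    Integrable fun v : V => field ν τ δ₁ δ₂ δ₃ p W m h x v * (1 + ‖v‖ ^ 2) :=
  integrable_energy_of_le (integrable_envelope H hh) (aestronglyMeasurable_field H hG hm hmΩ hh x)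
    (ae_of_all _ fun v => (abs_field_le H hmΩ hx v).trans (le_abs_self _))

theorem continuous_integral_field (H : WeakInteraction ν τ δ₁ δ₂ δ₃ p W Ω Ψ)
    (hG : ContinuousOn (fun q : Moments × V => q.1.gaussian ν q.2) (Ω ×ˢ univ))
    (hm : Continuous m) (hmΩ : ∀ y, m y ∈ Ω)
    (hh : Integrable fun v : V => h v * (1 + ‖v‖ ^ 2)) {q : V → ℝ} (hq : Continuous q)
    (hle : ∀ v, |q v| ≤ 1 * (1 + ‖v‖ ^ 2)) :
    Continuous fun x : Icc (0 : ℝ) 1 => ∫ v, field ν τ δ₁ δ₂ δ₃ p W m h x v * q v := by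
  refine continuous_of_dominated (fun x => (aestronglyMeasurable_field H hG hm hmΩ hh x).mul
    (by fun_prop)) (fun x => ae_of_all _ fun v => ?_) (integrable_envelope H hh)
    (ae_of_all _ fun v => ((continuous_field hG hm hmΩ v).comp continuous_subtype_val).mul
      continuous_const)
  rw [norm_mul]
  have h1 := abs_field_le (h := h) H hmΩ x.2 v
  exact mul_le_mul h1 (by simpa using hle v) (norm_nonneg _) ((abs_nonneg _).trans h1)

/-- By dominated convergence with the position-free majorant `envelope`; this places the new moments
in the space of continuous paths. -/
theorem continuous_moments_field (H : WeakInteraction ν τ δ₁ δ₂ δ₃ p W Ω Ψ)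
    (hG : ContinuousOn (fun q : Moments × V => q.1.gaussian ν q.2) (Ω ×ˢ univ))
    (hm : Continuous m) (hmΩ : ∀ y, m y ∈ Ω)
    (hh : Integrable fun v : V => h v * (1 + ‖v‖ ^ 2)) :
    Continuous fun x : Icc (0 : ℝ) 1 => moments (field ν τ δ₁ δ₂ δ₃ p W m h x) := by
  refine Continuous.prodMk ?_ (Continuous.prodMk (continuous_pi fun i => ?_)
    (continuous_pi fun i => continuous_pi fun j => ?_))
  · simpa using continuous_integral_field H hG hm hmΩ hh (q := fun _ => 1) (by fun_prop)
      fun v => by simp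
  · exact continuous_integral_field H hG hm hmΩ hh (by fun_prop) fun v => abs_apply_le v i
  · exact continuous_integral_field H hG hm hmΩ hh (by fun_prop) fun v => abs_apply_mul_le v i j

theorem outgoing_eq (f : ℝ → V → ℝ) (v : V) :
    outgoing f v = f (if 0 < v 0 then 1 else 0) v := by
  unfold outgoing
  split_ifs <;> rfl

theorem exit_mem (v : V) : (if 0 < v 0 then (1 : ℝ) else 0) ∈ Icc (0 : ℝ) 1 := by
  split_ifs <;> simp

theorem integrable_outgoing {f : ℝ → V → ℝ}
    (h0 : Integrable fun v : V => f 0 v * (1 + ‖v‖ ^ 2))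
    (h1 : Integrable fun v : V => f 1 v * (1 + ‖v‖ ^ 2)) :
    Integrable fun v : V => outgoing f v * (1 + ‖v‖ ^ 2) := by
  have hS : MeasurableSet {v : V | 0 < v 0} := measurableSet_lt (by fun_prop) (by fun_prop)
  refine ((h1.indicator hS).add (h0.indicator hS.compl)).congr (ae_of_all _ fun v => ?_)
  by_cases hv : 0 < v 0 <;> simp [outgoing, indicator, hv]

end Field

end Contraction

/-! ### The fixed point -/

/-- Moment paths together with weighted outgoing traces. -/
abbrev State : Type := C(Icc (0 : ℝ) 1, Moments) × Lp ℝ 1 (volume : Measure V)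

/-- The moment path, extended constantly to all positions. -/
def State.path (q : State) (y : ℝ) : Moments := q.1 (projIcc 0 1 zero_le_one y)

/-- The outgoing trace. -/
def State.trace (q : State) (v : V) : ℝ := q.2 v / (1 + ‖v‖ ^ 2)

/-- States with moments in `Ω` and nonnegative trace of energy at most `B`. -/
def stateSet (Ω : Set Moments) (B : ℝ) : Set State :=
  {q | (∀ x, q.1 x ∈ Ω) ∧ 0 ≤ q.2 ∧ ‖q.2‖ ≤ B}

section State

variable {Ω : Set Moments} {B : ℝ} (q q' : State)

theorem isClosed_stateSet (hΩ : IsClosed Ω) : IsClosed (stateSet Ω B) := by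
  have h1 : IsClosed {q : State | ∀ x, q.1 x ∈ Ω} := by
    simp only [ofPred_forall]
    exact isClosed_iInter fun x =>
      hΩ.preimage ((ContinuousEvalConst.continuous_eval_const x).comp continuous_fst)
  have h2 : IsClosed {q : State | 0 ≤ q.2} := isClosed_le continuous_const continuous_snd
  have h3 : IsClosed {q : State | ‖q.2‖ ≤ B} := isClosed_le continuous_snd.norm continuous_const
  exact h1.inter (h2.inter h3)

theorem continuous_path : Continuous q.path := q.1.continuous.comp continuous_projIcc

theorem trace_mul (v : V) : q.trace v * (1 + ‖v‖ ^ 2) = q.2 v :=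
  div_mul_cancel₀ _ (by positivity)

theorem integrable_trace : Integrable fun v : V => q.trace v * (1 + ‖v‖ ^ 2) := by
  simp only [trace_mul]
  exact L1.integrable_coeFn q.2

theorem abs_trace_mul (v : V) : |q.trace v| * (1 + ‖v‖ ^ 2) = ‖q.2 v‖ := by
  rw [← trace_mul, norm_mul, Real.norm_eq_abs, Real.norm_of_nonneg (by positivity)]

theorem integral_abs_trace : ∫ v, |q.trace v| * (1 + ‖v‖ ^ 2) = ‖q.2‖ := by
  simp only [abs_trace_mul, L1.norm_eq_integral_norm]

theorem integral_abs_trace_sub :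
    ∫ v, |q.trace v - q'.trace v| * (1 + ‖v‖ ^ 2) = dist q.2 q'.2 := by
  rw [dist_eq_norm, L1.norm_eq_integral_norm]
  refine integral_congr_ae ?_
  filter_upwards [Lp.coeFn_sub q.2 q'.2] with v hv
  rw [hv, Pi.sub_apply, ← trace_mul, ← trace_mul, ← sub_mul, norm_mul, Real.norm_eq_abs,
    Real.norm_of_nonneg (by positivity : 0 ≤ 1 + ‖v‖ ^ 2)]

theorem norm_path_sub_le (y : ℝ) : ‖q.path y - q'.path y‖ ≤ dist q.1 q'.1 := by
  rw [← dist_eq_norm]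
  exact ContinuousMap.dist_apply_le_dist _

theorem trace_nonneg (h : 0 ≤ q.2) : ∀ᵐ v, 0 ≤ q.trace v := by
  filter_upwards [(Lp.coeFn_nonneg q.2).2 h] with v hv
  exact div_nonneg hv (by positivity)

end State

theorem dist_toL1 {f g : V → ℝ} (hf : Integrable f) (hg : Integrable g) :
    dist (hf.toL1 f) (hg.toL1 g) = ∫ v, |f v - g v| := by
  rw [dist_eq_norm, L1.norm_eq_integral_norm]
  refine integral_congr_ae ?_
  filter_upwards [Lp.coeFn_sub (hf.toL1 f) (hg.toL1 g), hf.coeFn_toL1, hg.coeFn_toL1]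
    with v h1 h2 h3
  rw [h1, Pi.sub_apply, h2, h3, Real.norm_eq_abs]

section Existence

variable {ν τ δ₁ δ₂ δ₃ : ℝ} {p W : V → ℝ} {Ω : Set Moments} {Ψ : V → ℝ} {B η : ℝ}

theorem data_nearFree (H : WeakInteraction ν τ δ₁ δ₂ δ₃ p W Ω Ψ) (hη : 0 ≤ η) {x : ℝ}
    (hx : x ∈ Icc (0 : ℝ) 1) :
    NearFree η δ₁ τ x p fun v => δ₁ * (attenuation τ x v * p v) := by
  refine ⟨?_, ae_of_all _ fun v => le_rfl, by simpa using hη⟩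
  refine (integrable_energy_of_le H.data_integrable ((measurable_attenuation τ
    x).aestronglyMeasurable.mul (aestronglyMeasurable_of_energy H.data_integrable))
    (ae_of_all _ fun v => ?_)).const_mul δ₁ |>.congr (ae_of_all _ fun v => ?_)
  · rw [Pi.mul_apply, abs_mul, abs_of_pos (attenuation_pos _ _ _)]
    exact mul_le_of_le_one_left (abs_nonneg _) (attenuation_le_one H.time_pos.le hx v)
  · simp only [Pi.mul_apply]
    ring

theorem field_nearFree (H : WeakInteraction ν τ δ₁ δ₂ δ₃ p W Ω Ψ)
    (hG : ContinuousOn (fun q : Moments × V => q.1.gaussian ν q.2) (Ω ×ˢ univ))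
    (hη : (δ₂ * (∫ v, W v * (1 + ‖v‖ ^ 2)) + δ₃) * B +
      ∫ v, absorbed τ v * (Ψ v * (1 + ‖v‖ ^ 2)) ≤ η)
    {m : ℝ → Moments} (hm : Continuous m) (hmΩ : ∀ y, m y ∈ Ω) {h : V → ℝ}
    (hh : Integrable fun v : V => h v * (1 + ‖v‖ ^ 2)) (hh0 : ∀ᵐ v, 0 ≤ h v)
    (hB : ∫ v, |h v| * (1 + ‖v‖ ^ 2) ≤ B) {x : ℝ} (hx : x ∈ Icc (0 : ℝ) 1) :
    NearFree η δ₁ τ x p (field ν τ δ₁ δ₂ δ₃ p W m h x) := by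
  obtain ⟨h1, h2⟩ := transport_remainder (x := fun _ => x) H (fun _ => hx) hh hh0 hB
    (fun y _ v => H.gaussian_mem _ (hmΩ y) v) hη (ae_of_all _ fun v => rfl)
  exact ⟨integrable_field H hG hm hmΩ hh hx, h1, h2⟩

/-- Invariance of the trace component: the energy of the data plus that of the remainder fits in the
ball of radius `B`. -/
theorem outgoing_field (H : WeakInteraction ν τ δ₁ δ₂ δ₃ p W Ω Ψ)
    (hG : ContinuousOn (fun q : Moments × V => q.1.gaussian ν q.2) (Ω ×ˢ univ))
    (hη : (δ₂ * (∫ v, W v * (1 + ‖v‖ ^ 2)) + δ₃) * B +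
      ∫ v, absorbed τ v * (Ψ v * (1 + ‖v‖ ^ 2)) ≤ η)
    (hδ₁ : δ₁ ≤ 1) (hBη : (∫ v, p v * (1 + ‖v‖ ^ 2)) + η ≤ B)
    {m : ℝ → Moments} (hm : Continuous m) (hmΩ : ∀ y, m y ∈ Ω) {h : V → ℝ}
    (hh : Integrable fun v : V => h v * (1 + ‖v‖ ^ 2)) (hh0 : ∀ᵐ v, 0 ≤ h v)
    (hB : ∫ v, |h v| * (1 + ‖v‖ ^ 2) ≤ B) :
    (Integrable fun v => outgoing (field ν τ δ₁ δ₂ δ₃ p W m h) v * (1 + ‖v‖ ^ 2)) ∧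
    (∀ᵐ v, 0 ≤ outgoing (field ν τ δ₁ δ₂ δ₃ p W m h) v) ∧
    ∫ v, outgoing (field ν τ δ₁ δ₂ δ₃ p W m h) v * (1 + ‖v‖ ^ 2) ≤ B := by
  set f := field ν τ δ₁ δ₂ δ₃ p W m h with hf
  set x : V → ℝ := fun v => if 0 < v 0 then 1 else 0 with hx
  obtain ⟨h1, h2⟩ := transport_remainder (x := x) (f := outgoing f) H exit_mem hh hh0 hB
    (fun y _ v => H.gaussian_mem _ (hmΩ y) v) hη (ae_of_all _ fun v => outgoing_eq f v)
  have hi : Integrable fun v => outgoing f v * (1 + ‖v‖ ^ 2) :=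
    integrable_outgoing (integrable_field H hG hm hmΩ hh (by simp))
      (integrable_field H hG hm hmΩ hh (by simp))
  have hatt : ∀ᵐ v, 0 ≤ δ₁ * (attenuation τ (x v) v * p v) ∧
      δ₁ * (attenuation τ (x v) v * p v) ≤ p v := by
    filter_upwards [H.data_nonneg] with v hv
    have h3 := attenuation_pos τ (x v) v
    have h4 := attenuation_le_one H.time_pos.le (exit_mem v) v
    have := H.inflow_nonneg
    refine ⟨by positivity, ?_⟩
    calc _ ≤ 1 * (1 * p v) := by gcongr
      _ = p v := by ring
  refine ⟨hi, ?_, ?_⟩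
  · filter_upwards [h1, hatt] with v h1 h3 using h3.1.trans h1
  · have hmx : Measurable x :=
      Measurable.ite (measurableSet_lt (by fun_prop) (by fun_prop)) measurable_const
        measurable_const
    have hma : AEStronglyMeasurable fun v => attenuation τ (x v) v := by
      have : (fun v => attenuation τ (x v) v) = fun v : V =>
          if 0 < v 0 then attenuation τ 1 v else attenuation τ 0 v := by
        ext v
        simp only [hx]
        split_ifs <;> rfl
      rw [this]
      exact (Measurable.ite (measurableSet_lt (by fun_prop) (by fun_prop))
        (measurable_attenuation τ 1) (measurable_attenuation τ 0)).aestronglyMeasurable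
    have hpa : Integrable fun v => δ₁ * (attenuation τ (x v) v * p v) * (1 + ‖v‖ ^ 2) :=
      integrable_energy_of_le H.data_integrable
        ((hma.mul (aestronglyMeasurable_of_energy H.data_integrable)).const_mul δ₁)
        (by
          filter_upwards [hatt, H.data_nonneg] with v h3 h4
          rw [abs_of_nonneg h4]
          exact (abs_of_nonneg h3.1).trans_le h3.2)
    have h5 : ∫ v, δ₁ * (attenuation τ (x v) v * p v) * (1 + ‖v‖ ^ 2) ≤
        ∫ v, p v * (1 + ‖v‖ ^ 2) := by
      refine integral_mono_ae hpa H.data_integrable ?_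
      filter_upwards [hatt] with v h3
      exact mul_le_mul_of_nonneg_right h3.2 (by positivity)
    have h6 : ∫ v, outgoing f v * (1 + ‖v‖ ^ 2) =
        (∫ v, (outgoing f v - δ₁ * (attenuation τ (x v) v * p v)) * (1 + ‖v‖ ^ 2)) +
          ∫ v, δ₁ * (attenuation τ (x v) v * p v) * (1 + ‖v‖ ^ 2) := by
      simp only [sub_mul]
      rw [integral_sub hi hpa]
      ring
    linarith

/-- Banach's theorem on a closed set of states. `hinv` keeps the moments in `Ω`, `hBη` keeps the
trace in its ball, and `integral_diff_le` gives the factor 1/2 in both components. -/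
theorem exists_fixed_field (H : WeakInteraction ν τ δ₁ δ₂ δ₃ p W Ω Ψ)
    (hG : ContinuousOn (fun q : Moments × V => q.1.gaussian ν q.2) (Ω ×ˢ univ))
    (hΩ : IsClosed Ω)
    (hinv : ∀ x ∈ Icc (0 : ℝ) 1, ∀ f, NearFree η δ₁ τ x p f → moments f ∈ Ω)
    (hη0 : 0 ≤ η) (hη : (δ₂ * (∫ v, W v * (1 + ‖v‖ ^ 2)) + δ₃) * B +
      ∫ v, absorbed τ v * (Ψ v * (1 + ‖v‖ ^ 2)) ≤ η)
    (hδ₁ : δ₁ ≤ 1) (hBη : (∫ v, p v * (1 + ‖v‖ ^ 2)) + η ≤ B) :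
    ∃ (m : ℝ → Moments) (h : V → ℝ), Continuous m ∧ (∀ y, m y ∈ Ω) ∧
      (Integrable fun v : V => h v * (1 + ‖v‖ ^ 2)) ∧ (∀ᵐ v, 0 ≤ h v) ∧
      (∫ v, |h v| * (1 + ‖v‖ ^ 2) ≤ B) ∧
      (∀ y ∈ Icc (0 : ℝ) 1, moments (field ν τ δ₁ δ₂ δ₃ p W m h y) = m y) ∧
      ∀ᵐ v, outgoing (field ν τ δ₁ δ₂ δ₃ p W m h) v = h v := by
  let S := stateSet Ω B
  have hS : IsClosed S := isClosed_stateSet hΩ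
  have : CompleteSpace S := hS.completeSpace_coe
  have hp0 : 0 ≤ ∫ v, p v * (1 + ‖v‖ ^ 2) := integral_nonneg_of_ae (by
    filter_upwards [H.data_nonneg] with v hv
    exact mul_nonneg hv (by positivity))
  -- A state to start from: the moments of the attenuated data at x = 0, taken constant in x, with
  -- zero trace.
  have : Nonempty S := ⟨⟨(ContinuousMap.const _ _, 0),
    fun x => hinv 0 (by simp) _ (data_nearFree H hη0 (by simp)), le_rfl, by
      rw [norm_zero]; linarith⟩⟩
  have hpΩ : ∀ q : S, ∀ y, q.1.path y ∈ Ω := fun q y => q.2.1 _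
  let F : S → ℝ → V → ℝ := fun q => field ν τ δ₁ δ₂ δ₃ p W q.1.path q.1.trace
  have hO : ∀ q : S, (Integrable fun v => outgoing (F q) v * (1 + ‖v‖ ^ 2)) ∧
      (∀ᵐ v, 0 ≤ outgoing (F q) v) ∧ ∫ v, outgoing (F q) v * (1 + ‖v‖ ^ 2) ≤ B := fun q =>
    outgoing_field H hG hη hδ₁ hBη (continuous_path q.1) (hpΩ q) (integrable_trace q.1)
      (trace_nonneg q.1 q.2.2.1) (by rw [integral_abs_trace]; exact q.2.2.2)
  have hN : ∀ q : S, ∀ x ∈ Icc (0 : ℝ) 1, NearFree η δ₁ τ x p (F q x) := fun q x hx =>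
    field_nearFree H hG hη (continuous_path q.1) (hpΩ q) (integrable_trace q.1)
      (trace_nonneg q.1 q.2.2.1) (by rw [integral_abs_trace]; exact q.2.2.2) hx
  let Φ : S → S := fun q => ⟨(⟨fun x => moments (F q x), continuous_moments_field H hG
      (continuous_path q.1) (hpΩ q) (integrable_trace q.1)⟩, (hO q).1.toL1 _),
    fun x => hinv x x.2 _ (hN q x x.2),
    (Lp.coeFn_nonneg _).1 (by
      filter_upwards [(hO q).1.coeFn_toL1, (hO q).2.1] with v h1 h2
      rw [h1]
      exact mul_nonneg h2 (by positivity)),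
    by
      rw [L1.norm_eq_integral_norm]
      refine le_trans (le_of_eq (integral_congr_ae ?_)) (hO q).2.2
      filter_upwards [(hO q).1.coeFn_toL1, (hO q).2.1] with v h1 h2
      rw [h1, Real.norm_of_nonneg (mul_nonneg h2 (by positivity))]⟩
  -- Letting `x` depend on `v` serves both components: constant `x` for the moments, the exit wall
  -- for the trace.
  have hest : ∀ q q' : S, ∀ x : V → ℝ, (∀ v, x v ∈ Icc (0 : ℝ) 1) →
      ∫ v, |F q (x v) v - F q' (x v) v| * (1 + ‖v‖ ^ 2) ≤ dist q q' / 2 := by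
    intro q q' x hx
    refine integral_diff_le H (integrable_trace q.1) (integrable_trace q'.1)
      ((integral_abs_trace_sub q.1 q'.1).trans_le (le_max_right _ _)) (ae_of_all _ fun v => ?_)
    refine abs_transport_sub_le H.time_pos.le (hx v)
      ((continuous_gaussian_path hG (continuous_path q.1) (hpΩ q) v).intervalIntegrable _ _)
      ((continuous_gaussian_path hG (continuous_path q'.1) (hpΩ q') v).intervalIntegrable _ _)
      fun y _ => (H.gaussian_lipschitz _ (hpΩ q y) _ (hpΩ q' y) v).trans ?_
    exact mul_le_mul_of_nonneg_right ((norm_path_sub_le q.1 q'.1 y).trans (le_max_left _ _))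
      (H.bound_nonneg v)
  have hΦ : ContractingWith (1 / 2) Φ := by
    refine ⟨by norm_num, LipschitzWith.of_dist_le_mul fun q q' => ?_⟩
    have e : (((1 / 2 : NNReal) : ℝ)) * dist q q' = dist q q' / 2 := by push_cast; ring
    rw [e, Subtype.dist_eq, Prod.dist_eq]
    refine max_le ((ContinuousMap.dist_le (by positivity)).2 fun x => ?_) ?_
    · rw [dist_eq_norm]
      exact (norm_moments_sub_le (hN q x x.2).integrable (hN q' x x.2).integrable).trans
        (hest q q' (fun _ => x) fun _ => x.2)
    · refine (dist_toL1 (hO q).1 (hO q').1).trans_le (le_trans (le_of_eq (integral_congr_ae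
        (ae_of_all _ fun v => ?_))) (hest q q' (fun v => if 0 < v 0 then 1 else 0) exit_mem))
      simp only [← outgoing_eq]
      rw [← sub_mul, abs_mul, abs_of_nonneg (by positivity : 0 ≤ 1 + ‖v‖ ^ 2)]
  obtain ⟨q, hq⟩ : ∃ q, Φ q = q := ⟨_, hΦ.fixedPoint_isFixedPt⟩
  refine ⟨q.1.path, q.1.trace, continuous_path q.1, hpΩ q, integrable_trace q.1,
    trace_nonneg q.1 q.2.2.1, by rw [integral_abs_trace]; exact q.2.2.2, fun y hy => ?_, ?_⟩
  · have h1 : (Φ q).1.1 ⟨y, hy⟩ = q.1.1 ⟨y, hy⟩ := by rw [hq]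
    refine Eq.trans h1 ?_
    rw [State.path, projIcc_of_mem zero_le_one hy]
  · have h1 : (Φ q).1.2 = q.1.2 := by rw [hq]
    have h2 := (hO q).1.coeFn_toL1
    filter_upwards [h2] with v hv
    have h3 : q.1.2 v = outgoing (F q) v * (1 + ‖v‖ ^ 2) := by rw [← hv, ← h1]
    rw [State.trace, h3, mul_div_cancel_right₀ _ (by positivity)]

end Existence

/-! ### Mild solutions as fixed points of the transport operator -/

section Mild

variable {ν τ δ₁ δ₂ δ₃ θ₀ θ₁ : ℝ} {fL fR : V → ℝ} {f g : ℝ → V → ℝ}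

theorem measurableSet_pos : MeasurableSet {v : V | 0 < v 0} :=
  measurableSet_lt (by fun_prop) (by fun_prop)

theorem measurableSet_neg : MeasurableSet {v : V | v 0 < 0} :=
  measurableSet_lt (by fun_prop) (by fun_prop)

theorem wallFlux_outgoing_of_pos (f : ℝ → V → ℝ) {v : V} (hv : 0 < v 0) :
    wallFlux (outgoing f) v = ∫ w in {w : V | w 0 < 0}, f 0 w * |w 0| := by
  rw [wallFlux, if_pos hv]
  refine setIntegral_congr_fun measurableSet_neg fun w hw => ?_
  simp only [outgoing, if_neg (not_lt.2 (le_of_lt (show w 0 < 0 from hw)))]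

theorem wallFlux_outgoing_of_neg (f : ℝ → V → ℝ) {v : V} (hv : v 0 < 0) :
    wallFlux (outgoing f) v = ∫ w in {w : V | 0 < w 0}, f 1 w * |w 0| := by
  rw [wallFlux, if_neg hv.not_gt]
  refine setIntegral_congr_fun measurableSet_pos fun w hw => ?_
  simp only [outgoing, if_pos (show 0 < w 0 from hw)]

theorem inflow_outgoing_of_pos (f : ℝ → V → ℝ) {v : V} (hv : 0 < v 0) :
    inflow δ₁ δ₂ δ₃ (glue fL fR) (glue (wallMaxwellian θ₀) (wallMaxwellian θ₁)) (outgoing f) v =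
      δ₁ * fL v + δ₂ * (∫ w in {w : V | w 0 < 0}, f 0 w * |w 0|) * wallMaxwellian θ₀ v +
        δ₃ * f 0 (reflect v) := by
  rw [inflow, wallFlux_outgoing_of_pos f hv]
  simp only [glue, if_pos hv, outgoing, reflect_zero_apply, Left.neg_pos_iff, if_neg hv.not_gt]

theorem inflow_outgoing_of_neg (f : ℝ → V → ℝ) {v : V} (hv : v 0 < 0) :
    inflow δ₁ δ₂ δ₃ (glue fL fR) (glue (wallMaxwellian θ₀) (wallMaxwellian θ₁)) (outgoing f) v =
      δ₁ * fR v + δ₂ * (∫ w in {w : V | 0 < w 0}, f 1 w * |w 0|) * wallMaxwellian θ₁ v +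
        δ₃ * f 1 (reflect v) := by
  rw [inflow, wallFlux_outgoing_of_neg f hv]
  simp only [glue, if_neg hv.not_gt, outgoing, reflect_zero_apply, Left.neg_pos_iff, if_pos hv]

theorem transport_of_pos (k : V → ℝ) (Q : ℝ → V → ℝ) (x : ℝ) {v : V} (hv : 0 < v 0) :
    transport τ k Q x v = Real.exp (-(x / (τ * |v 0|))) * k v +
      1 / (τ * |v 0|) * ∫ y in (0 : ℝ)..x, Real.exp (-((x - y) / (τ * |v 0|))) * Q y v := by
  simp only [transport, attenuation, collision, relax, depth, if_pos hv]

/-- The substitution y ↦ 1 - y turns distance from the right wall back into position. -/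
theorem transport_of_neg (k : V → ℝ) (Q : ℝ → V → ℝ) (x : ℝ) {v : V} (hv : v 0 < 0) :
    transport τ k Q x v = Real.exp (-((1 - x) / (τ * |v 0|))) * k v +
      1 / (τ * |v 0|) * ∫ y in x..(1 : ℝ), Real.exp (-((y - x) / (τ * |v 0|))) * Q y v := by
  have h := intervalIntegral.integral_comp_sub_left (a := 0) (b := 1 - x)
    (fun y => Real.exp (-((y - x) / (τ * |v 0|))) * Q y v) 1
  rw [sub_sub_cancel, sub_zero] at h
  rw [← h]
  simp only [transport, attenuation, collision, relax, depth, if_neg hv.not_gt, sub_right_comm]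

/-- For almost every velocity the two integral equations and the two boundary conditions merge into
one fixed-point equation. -/
theorem IsMildSolution.eq_transport (hf : IsMildSolution ν τ δ₁ δ₂ δ₃ θ₀ θ₁ fL fR f) :
    ∀ᵐ v, ∀ x ∈ Icc (0 : ℝ) 1, f x v = transport τ
      (inflow δ₁ δ₂ δ₃ (glue fL fR) (glue (wallMaxwellian θ₀) (wallMaxwellian θ₁)) (outgoing f))
      (fun y v => ellipsoidalGaussian ν (f y) v) x v := by
  filter_upwards [hf.mild_pos, hf.mild_neg, hf.boundary_left, hf.boundary_right,
    ae_apply_zero_ne_zero] with v h1 h2 h3 h4 h5 x hx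
  rcases h5.lt_or_gt with hv | hv
  · rw [transport_of_neg _ _ _ hv, inflow_outgoing_of_neg f hv, ← h4 hv, ← h2 hv x hx]
  · rw [transport_of_pos _ _ _ hv, inflow_outgoing_of_pos f hv, ← h3 hv, ← h1 hv x hx]

theorem transport_incoming (k : V → ℝ) (Q : ℝ → V → ℝ) (v : V) :
    (0 < v 0 → transport τ k Q 0 v = k v) ∧ (v 0 < 0 → transport τ k Q 1 v = k v) :=
  ⟨fun hv => by simp [transport_of_pos _ _ _ hv], fun hv => by simp [transport_of_neg _ _ _ hv]⟩

theorem isMildSolution_of_eq_transport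
    (hmeas : AEStronglyMeasurable (Function.uncurry f)
      ((volume.restrict (Icc (0 : ℝ) 1)).prod (volume : Measure V)))
    (hint : ∀ x ∈ Icc (0 : ℝ) 1, Integrable fun v : V => f x v * (1 + ‖v‖ ^ 2))
    (hbdd : ∃ B : ℝ, ∀ x ∈ Icc (0 : ℝ) 1, ∫ v : V, |f x v| * (1 + ‖v‖ ^ 2) ≤ B)
    (hgauss : ∀ᵐ v : V, IntervalIntegrable (fun y => ellipsoidalGaussian ν (f y) v) volume 0 1)
    (hf : ∀ᵐ v, ∀ x ∈ Icc (0 : ℝ) 1, f x v = transport τ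
      (inflow δ₁ δ₂ δ₃ (glue fL fR) (glue (wallMaxwellian θ₀) (wallMaxwellian θ₁)) (outgoing f))
      (fun y v => ellipsoidalGaussian ν (f y) v) x v) :
    IsMildSolution ν τ δ₁ δ₂ δ₃ θ₀ θ₁ fL fR f where
  measurable := hmeas
  integrable := hint
  bounded := hbdd
  gaussian_integrable := hgauss
  mild_pos := by
    filter_upwards [hf] with v hv hv0 x hx
    rw [hv x hx, hv 0 (by simp), (transport_incoming _ _ v).1 hv0, transport_of_pos _ _ _ hv0]
  mild_neg := by
    filter_upwards [hf] with v hv hv0 x hx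
    rw [hv x hx, hv 1 (by simp), (transport_incoming _ _ v).2 hv0, transport_of_neg _ _ _ hv0]
  boundary_left := by
    filter_upwards [hf] with v hv hv0
    rw [hv 0 (by simp), (transport_incoming _ _ v).1 hv0, inflow_outgoing_of_pos f hv0]
  boundary_right := by
    filter_upwards [hf] with v hv hv0
    rw [hv 1 (by simp), (transport_incoming _ _ v).2 hv0, inflow_outgoing_of_neg f hv0]

variable {Ω : Set Moments} {Ψ : V → ℝ} {B η : ℝ}

theorem inflow_congr {p W h h' : V → ℝ} (hh : ∀ᵐ v, h v = h' v) :
    ∀ᵐ v, inflow δ₁ δ₂ δ₃ p W h v = inflow δ₁ δ₂ δ₃ p W h' v := by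
  have hw : ∀ v, wallFlux h v = wallFlux h' v := fun v => by
    unfold wallFlux
    split_ifs <;>
    exact integral_congr_ae (ae_restrict_of_ae (hh.mono fun w hw => by simp only [hw]))
  filter_upwards [ae_comp_reflect hh] with v hv
  rw [inflow, inflow, hw, hv]

/-- Existence of a mild solution that is close to free transport. -/
theorem exists_mild_solution
    (H : WeakInteraction ν τ δ₁ δ₂ δ₃ (glue fL fR) (glue (wallMaxwellian θ₀) (wallMaxwellian θ₁))
      Ω Ψ)
    (hG : ContinuousOn (fun q : Moments × V => q.1.gaussian ν q.2) (Ω ×ˢ univ))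
    (hΩ : IsClosed Ω) (hΩ0 : ∀ m ∈ Ω, m.1 ≠ 0)
    (hinv : ∀ x ∈ Icc (0 : ℝ) 1, ∀ f, NearFree η δ₁ τ x (glue fL fR) f → moments f ∈ Ω)
    (hη0 : 0 ≤ η)
    (hη : (δ₂ * (∫ v, glue (wallMaxwellian θ₀) (wallMaxwellian θ₁) v * (1 + ‖v‖ ^ 2)) + δ₃) * B +
      ∫ v, absorbed τ v * (Ψ v * (1 + ‖v‖ ^ 2)) ≤ η)
    (hδ₁ : δ₁ ≤ 1) (hBη : (∫ v, glue fL fR v * (1 + ‖v‖ ^ 2)) + η ≤ B) :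
    ∃ f, IsMildSolution ν τ δ₁ δ₂ δ₃ θ₀ θ₁ fL fR f ∧ Nonneg f ∧
      ∀ x ∈ Icc (0 : ℝ) 1, NearFree η δ₁ τ x (glue fL fR) (f x) := by
  obtain ⟨m, h, hm, hmΩ, hh, hh0, hB, hfix, hout⟩ :=
    exists_fixed_field H hG hΩ hinv hη0 hη hδ₁ hBη
  set p := glue fL fR
  set W := glue (wallMaxwellian θ₀) (wallMaxwellian θ₁)
  set f := field ν τ δ₁ δ₂ δ₃ p W m h with hf
  have hNF : ∀ x ∈ Icc (0 : ℝ) 1, NearFree η δ₁ τ x p (f x) := fun x hx =>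
    field_nearFree H hG hη hm hmΩ hh hh0 hB hx
  have hint : ∀ x ∈ Icc (0 : ℝ) 1, Integrable fun v : V => f x v * (1 + ‖v‖ ^ 2) :=
    fun x hx => (hNF x hx).integrable
  -- At the fixed point the prescribed moments are those of the field itself, so the prescribed
  -- Gaussians become the nonlinear ones.
  have hgauss : ∀ y ∈ Icc (0 : ℝ) 1, ∀ v, ellipsoidalGaussian ν (f y) v = (m y).gaussian ν v := by
    intro y hy v
    have hρ : density (f y) ≠ 0 := by
      have : (moments (f y)).1 ≠ 0 := by rw [hfix y hy]; exact hΩ0 _ (hmΩ y)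
      exact this
    rw [ellipsoidalGaussian_eq (hint y hy) hρ, hfix y hy]
  refine ⟨f, isMildSolution_of_eq_transport ?_ hint ?_ ?_ ?_, ?_, hNF⟩
  · exact aestronglyMeasurable_uncurry_field H hG hm hmΩ hh _
  · refine ⟨_, fun x hx => integral_mono_of_nonneg (ae_of_all _ fun v => by positivity)
      (integrable_envelope H hh) (ae_of_all _ fun v => ?_)⟩
    exact mul_le_mul_of_nonneg_right (abs_field_le H hmΩ hx v) (by positivity)
  · refine ae_of_all _ fun v => ((continuous_gaussian_path hG hm hmΩ v).intervalIntegrable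
      0 1).congr fun y hy => ?_
    rw [uIoc_of_le zero_le_one] at hy
    exact (hgauss y ⟨hy.1.le, hy.2⟩ v).symm
  -- The field is built from the trace `h`; its own outgoing trace agrees with `h` only almost
  -- everywhere, which suffices for the inflow.
  · filter_upwards [inflow_congr (δ₁ := δ₁) (δ₂ := δ₂) (δ₃ := δ₃) (p := p) (W := W) hout]
      with v hv x hx
    rw [transport, hv, collision_congr hx fun y hy => hgauss y hy v]
    rfl
  · filter_upwards [hh0, ae_comp_reflect hh0, H.data_nonneg] with v h1 h2 h3 x hx
    have := H.inflow_nonneg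
    have := H.diffuse_nonneg
    have := H.specular_nonneg
    have := H.wall_nonneg v
    have := wallFlux_nonneg hh0 v
    have h4 : 0 ≤ inflow δ₁ δ₂ δ₃ p W h v := by
      rw [inflow]
      positivity
    exact add_nonneg (mul_nonneg (attenuation_pos _ _ _).le h4)
      (collision_nonneg H.time_pos.le hx fun y _ => (H.gaussian_mem _ (hmΩ y) v).1)

/-- Uniqueness of mild solutions with moments in `Ω`. -/
theorem mild_solution_unique
    (H : WeakInteraction ν τ δ₁ δ₂ δ₃ (glue fL fR) (glue (wallMaxwellian θ₀) (wallMaxwellian θ₁))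
      Ω Ψ) (hΩ0 : ∀ m ∈ Ω, m.1 ≠ 0)
    (hf : IsMildSolution ν τ δ₁ δ₂ δ₃ θ₀ θ₁ fL fR f)
    (hg : IsMildSolution ν τ δ₁ δ₂ δ₃ θ₀ θ₁ fL fR g)
    (hfΩ : ∀ x ∈ Icc (0 : ℝ) 1, moments (f x) ∈ Ω)
    (hgΩ : ∀ x ∈ Icc (0 : ℝ) 1, moments (g x) ∈ Ω) : SameSolution f g := by
  have hfo : Integrable fun v : V => outgoing f v * (1 + ‖v‖ ^ 2) :=
    integrable_outgoing (hf.integrable 0 (by simp)) (hf.integrable 1 (by simp))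
  have hgo : Integrable fun v : V => outgoing g v * (1 + ‖v‖ ^ 2) :=
    integrable_outgoing (hg.integrable 0 (by simp)) (hg.integrable 1 (by simp))
  have hfe : ∀ y ∈ Icc (0 : ℝ) 1, ∀ v,
      ellipsoidalGaussian ν (f y) v = (moments (f y)).gaussian ν v := fun y hy v =>
    ellipsoidalGaussian_eq (hf.integrable y hy) (hΩ0 _ (hfΩ y hy)) ν v
  have hge : ∀ y ∈ Icc (0 : ℝ) 1, ∀ v,
      ellipsoidalGaussian ν (g y) v = (moments (g y)).gaussian ν v := fun y hy v =>
    ellipsoidalGaussian_eq (hg.integrable y hy) (hΩ0 _ (hgΩ y hy)) ν v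
  -- A common bound for the distance of moments and of traces. It can be halved indefinitely, hence
  -- is zero; no continuity of the moment paths is required.
  let P : ℝ → Prop := fun D => (∀ x ∈ Icc (0 : ℝ) 1, ‖moments (f x) - moments (g x)‖ ≤ D) ∧
    ∫ v, |outgoing f v - outgoing g v| * (1 + ‖v‖ ^ 2) ≤ D
  have hpt : ∀ D, P D → ∀ᵐ v, ∀ x ∈ Icc (0 : ℝ) 1, |f x v - g x v| ≤
      |inflow δ₁ δ₂ δ₃ (glue fL fR) (glue (wallMaxwellian θ₀) (wallMaxwellian θ₁)) (outgoing f) v -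
        inflow δ₁ δ₂ δ₃ (glue fL fR) (glue (wallMaxwellian θ₀) (wallMaxwellian θ₁))
          (outgoing g) v| + absorbed τ v * (D * Ψ v) := by
    intro D hD
    filter_upwards [hf.eq_transport, hg.eq_transport, hf.gaussian_integrable,
      hg.gaussian_integrable] with v h1 h2 h3 h4 x hx
    rw [h1 x hx, h2 x hx]
    refine abs_transport_sub_le H.time_pos.le hx h3 h4 fun y hy => ?_
    rw [hfe y hy, hge y hy]
    exact (H.gaussian_lipschitz _ (hfΩ y hy) _ (hgΩ y hy) v).trans
      (mul_le_mul_of_nonneg_right (hD.1 y hy) (H.bound_nonneg v))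
  have hhalf : ∀ D, P D → P (D / 2) := fun D hD => by
    refine ⟨fun x hx => (norm_moments_sub_le (hf.integrable x hx) (hg.integrable x hx)).trans
      (integral_diff_le H hfo hgo hD.2 ?_), integral_diff_le H hfo hgo hD.2 ?_⟩
    · filter_upwards [hpt D hD] with v hv using hv x hx
    · filter_upwards [hpt D hD] with v hv
      rw [outgoing_eq, outgoing_eq]
      exact hv _ (exit_mem v)
  obtain ⟨D, hD⟩ : ∃ D, P D := by
    obtain ⟨B₁, hB₁⟩ := hf.bounded
    obtain ⟨B₂, hB₂⟩ := hg.bounded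
    refine ⟨max (B₁ + B₂) _, fun x hx => le_trans ?_ (le_max_left _ _), le_max_right _ _⟩
    exact (norm_sub_le _ _).trans (add_le_add
      ((norm_moments_le (hf.integrable x hx)).trans (hB₁ x hx))
      ((norm_moments_le (hg.integrable x hx)).trans (hB₂ x hx)))
  have hpow : ∀ n : ℕ, P (D * (1 / 2) ^ n) := by
    intro n
    induction n with
    | zero => simpa using hD
    | succ n ih => convert! hhalf _ ih using 1; ring
  have hlim : Filter.Tendsto (fun n : ℕ => D * (1 / 2 : ℝ) ^ n) Filter.atTop (nhds 0) := by
    simpa using (tendsto_pow_atTop_nhds_zero_of_lt_one (r := (1 / 2 : ℝ)) (by norm_num)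
      (by norm_num)).const_mul D
  have hzero : P 0 := ⟨fun x hx => ge_of_tendsto' hlim fun n => (hpow n).1 x hx,
    ge_of_tendsto' hlim fun n => (hpow n).2⟩
  have hout : ∀ᵐ v, outgoing f v = outgoing g v := by
    have hd : Integrable fun v => |outgoing f v - outgoing g v| * (1 + ‖v‖ ^ 2) :=
      integrable_abs_energy (g := fun v => outgoing f v - outgoing g v)
        ((hfo.sub hgo).congr (ae_of_all _ fun v => by simp [sub_mul]))
    have h0 := (integral_eq_zero_iff_of_nonneg (fun v => by positivity) hd).1
      (le_antisymm hzero.2 (integral_nonneg fun v => by positivity))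
    filter_upwards [h0] with v hv
    have h1 : (1 + ‖v‖ ^ 2) ≠ 0 := by positivity
    have h2 := (mul_eq_zero.1 hv).resolve_right h1
    exact sub_eq_zero.1 (abs_eq_zero.1 h2)
  filter_upwards [hpt 0 hzero, inflow_congr (δ₁ := δ₁) (δ₂ := δ₂) (δ₃ := δ₃) (p := glue fL fR)
    (W := glue (wallMaxwellian θ₀) (wallMaxwellian θ₁)) hout] with v h1 h2 x hx
  have h3 := h1 x hx
  rw [h2] at h3
  simp only [sub_self, abs_zero, zero_mul, mul_zero, add_zero] at h3
  exact sub_eq_zero.1 (abs_eq_zero.1 (le_antisymm h3 (abs_nonneg _)))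

end Mild

/-! ### The boundary data -/

section HalfSpaces

theorem setIntegral_nonpos_eq (F : V → ℝ) :
    ∫ v in {v : V | 0 < v 0}ᶜ, F v = ∫ v in {v : V | v 0 < 0}, F v := by
  refine setIntegral_congr_set ?_
  filter_upwards [ae_apply_zero_ne_zero] with v hv
  refine propext ⟨fun h => lt_of_le_of_ne (not_lt.1 h) hv, fun h => not_lt.2 (le_of_lt h)⟩

theorem integral_eq_halves {F : V → ℝ} (hF : Integrable F) :
    ∫ v, F v = (∫ v in {v : V | 0 < v 0}, F v) + ∫ v in {v : V | v 0 < 0}, F v := by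
  rw [← integral_add_compl measurableSet_pos hF, setIntegral_nonpos_eq]

theorem setIntegral_reflect (F : V → ℝ) (hF : ∀ v, F (reflect v) = F v) :
    ∫ v in {v : V | v 0 < 0}, F v = ∫ v in {v : V | 0 < v 0}, F v := by
  have h := measurePreserving_reflect.setIntegral_preimage_emb measurableEmbedding_reflect F
    {v : V | 0 < v 0}
  simp only [hF] at h
  rw [← h]
  congr 2
  ext v
  simp [reflect_zero_apply]

theorem half_integral {F : V → ℝ} (hF : Integrable F) (hr : ∀ v, F (reflect v) = F v) :
    (∫ v in {v : V | 0 < v 0}, F v = (∫ v, F v) / 2) ∧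
      ∫ v in {v : V | v 0 < 0}, F v = (∫ v, F v) / 2 := by
  have h1 := integral_eq_halves hF
  have h2 := setIntegral_reflect F hr
  constructor <;> linarith

theorem traceNorm_eq {h : V → ℝ} (hh : Integrable fun v : V => h v * (1 + ‖v‖ ^ 2)) :
    traceNorm h = 2 * ∫ v, |h v| * (1 + ‖v‖ ^ 2) := by
  rw [traceNorm, traceNormOut, traceNormIn, integral_eq_halves (integrable_abs_energy hh)]
  ring

theorem setIntegral_glue_pos (hL hR q : V → ℝ) :
    ∫ v in {v : V | 0 < v 0}, glue hL hR v * q v = ∫ v in {v : V | 0 < v 0}, hL v * q v :=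
  setIntegral_congr_fun measurableSet_pos fun v hv => by
    simp only [glue, if_pos (show 0 < v 0 from hv)]

theorem setIntegral_glue_neg (hL hR q : V → ℝ) :
    ∫ v in {v : V | v 0 < 0}, glue hL hR v * q v = ∫ v in {v : V | v 0 < 0}, hR v * q v :=
  setIntegral_congr_fun measurableSet_neg fun v hv => by
    simp only [glue, if_neg (not_lt.2 (le_of_lt (show v 0 < 0 from hv))),
      if_pos (show v 0 < 0 from hv)]

end HalfSpaces

/-! ### Energy of the wall Maxwellians -/

section Wall

variable {θ θ₀ θ₁ : ℝ}

theorem wallMaxwellian_nonneg (hθ : 0 < θ) (v : V) : 0 ≤ wallMaxwellian θ v := by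
  unfold wallMaxwellian
  positivity

theorem integrable_wallMaxwellian (hθ : 0 < θ) :
    Integrable fun v : V => wallMaxwellian θ v * (1 + ‖v‖ ^ 2) := by
  refine ((Moments.integrable_pow_mul_exp (l := 1 / (2 * θ)) (by positivity) 1).const_mul
    (1 / (2 * Real.pi * θ ^ 2))).congr (ae_of_all _ fun v => ?_)
  have : -(1 / (2 * θ)) * ‖v‖ ^ 2 = -(‖v‖ ^ 2) / (2 * θ) := by field_simp
  simp only [wallMaxwellian, this]
  ring

theorem integral_exp_norm_sq {b : ℝ} (hb : 0 < b) :
    ∫ v : V, Real.exp (-b * ‖v‖ ^ 2) = Real.sqrt (Real.pi / b) ^ 3 := by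
  rw [GaussianFourier.integral_rexp_neg_mul_sq_norm hb, finrank_euclideanSpace_fin,
    Real.sqrt_eq_rpow, ← Real.rpow_natCast, ← Real.rpow_mul (by positivity)]
  norm_num

/-- Makes `CLR` dominate the energy of the data. The second moment is not computed: with t =
|v|²/(2θ), the inequality t e⁻ᵗ ≥ e⁻ᵗ - e⁻²ᵗ bounds the integrand below by a combination of two pure
Gaussians. -/
theorem one_le_wallMaxwellian (hθ : 0 < θ) :
    1 ≤ ∫ v : V, wallMaxwellian θ v * (1 + ‖v‖ ^ 2) := by
  have hπ := Real.pi_pos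
  set c := 1 / (2 * Real.pi * θ ^ 2) with hc
  have hc0 : 0 < c := by positivity
  have i1 := (Moments.integrable_pow_mul_exp (l := 1 / (2 * θ)) (by positivity) 0)
  have i2 := (Moments.integrable_pow_mul_exp (l := 1 / θ) (by positivity) 0)
  simp only [pow_zero, one_mul] at i1 i2
  have h1 : ∫ v : V, (c * (1 + 2 * θ) * Real.exp (-(1 / (2 * θ)) * ‖v‖ ^ 2) -
      c * (2 * θ) * Real.exp (-(1 / θ) * ‖v‖ ^ 2)) ≤
      ∫ v : V, wallMaxwellian θ v * (1 + ‖v‖ ^ 2) := by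
    refine integral_mono ((i1.const_mul _).sub (i2.const_mul _)) (integrable_wallMaxwellian hθ)
      fun v => ?_
    set t := ‖v‖ ^ 2 / (2 * θ) with ht
    have e1 : -(1 / (2 * θ)) * ‖v‖ ^ 2 = -t := by rw [ht]; ring
    have e2 : -(1 / θ) * ‖v‖ ^ 2 = -t + -t := by rw [ht]; field_simp; ring
    have e3 : -(‖v‖ ^ 2) / (2 * θ) = -t := by rw [ht]; ring
    have e4 : ‖v‖ ^ 2 = 2 * θ * t := by rw [ht]; field_simp
    simp only [wallMaxwellian, e1, e2, e3]
    rw [e4, Real.exp_add]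
    have h2 := Real.add_one_le_exp (-t)
    have h3 := Real.exp_pos (-t)
    have h4 : 0 ≤ Real.exp (-t) * (t - 1 + Real.exp (-t)) := mul_nonneg h3.le (by linarith)
    have h5 : 0 ≤ c * (2 * θ) * (Real.exp (-t) * (t - 1 + Real.exp (-t))) := by positivity
    linarith
  rw [integral_sub (i1.const_mul _) (i2.const_mul _), integral_const_mul, integral_const_mul,
    integral_exp_norm_sq (by positivity), integral_exp_norm_sq (by positivity)] at h1
  set y := Real.sqrt (Real.pi / (1 / θ)) with hy
  have hy0 : 0 < y := Real.sqrt_pos.2 (by positivity)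
  have hy2 : y ^ 2 = Real.pi * θ := by rw [hy, Real.sq_sqrt (by positivity)]; field_simp
  have hz : 2 * y ^ 3 ≤ Real.sqrt (Real.pi / (1 / (2 * θ))) ^ 3 := by
    have : Real.pi / (1 / (2 * θ)) = 2 * (Real.pi / (1 / θ)) := by field_simp
    rw [this, Real.sqrt_mul (by norm_num), mul_pow, ← hy]
    have h2 : (1 : ℝ) ≤ Real.sqrt 2 := by
      rw [Real.one_le_sqrt]; norm_num
    have h3 : Real.sqrt 2 ^ 2 = 2 := Real.sq_sqrt (by norm_num)
    have h4 : 2 ≤ Real.sqrt 2 ^ 3 := by nlinarith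
    gcongr
  have h5 : c * (1 + 2 * θ) * (2 * y ^ 3) - c * (2 * θ) * y ^ 3 ≤
      ∫ v : V, wallMaxwellian θ v * (1 + ‖v‖ ^ 2) := by
    refine le_trans ?_ h1
    gcongr
  refine le_trans ?_ h5
  have h6 : c * (1 + 2 * θ) * (2 * y ^ 3) - c * (2 * θ) * y ^ 3 = y * (1 + θ) / θ := by
    have : y ^ 3 = y * (Real.pi * θ) := by rw [← hy2]; ring
    rw [this, hc]
    field_simp
    ring
  rw [h6, le_div_iff₀ hθ, one_mul]
  -- As y² = πθ, this is θ² ≤ πθ(1 + θ)², already clear from the cross term 2πθ².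
  have h7 : θ ^ 2 ≤ (y * (1 + θ)) ^ 2 := by
    rw [mul_pow, hy2]
    have := Real.pi_gt_three
    nlinarith [mul_pos hπ hθ, mul_pos hθ hθ, pow_pos hθ 3, mul_pos hπ (pow_pos hθ 2),
      mul_pos hπ (pow_pos hθ 3)]
  exact (abs_le_of_sq_le_sq' h7 (by positivity)).2

theorem glue_wall_nonneg (hθ₀ : 0 < θ₀) (hθ₁ : 0 < θ₁) (v : V) :
    0 ≤ glue (wallMaxwellian θ₀) (wallMaxwellian θ₁) v := by
  unfold glue
  split_ifs
  exacts [wallMaxwellian_nonneg hθ₀ v, wallMaxwellian_nonneg hθ₁ v, le_rfl]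

theorem integrable_glue {hL hR : V → ℝ} (h1 : Integrable fun v : V => hL v * (1 + ‖v‖ ^ 2))
    (h2 : Integrable fun v : V => hR v * (1 + ‖v‖ ^ 2)) :
    Integrable fun v : V => glue hL hR v * (1 + ‖v‖ ^ 2) := by
  refine ((h1.indicator measurableSet_pos).add (h2.indicator measurableSet_neg)).congr
    (ae_of_all _ fun v => ?_)
  rcases lt_trichotomy (v 0) 0 with h | h | h
  · simp [glue, indicator, h, h.not_gt]
  · simp [glue, indicator, h]
  · simp [glue, indicator, h, h.not_gt]

theorem integrable_glue_wall (hθ₀ : 0 < θ₀) (hθ₁ : 0 < θ₁) :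
    Integrable fun v : V => glue (wallMaxwellian θ₀) (wallMaxwellian θ₁) v * (1 + ‖v‖ ^ 2) :=
  integrable_glue (integrable_wallMaxwellian hθ₀) (integrable_wallMaxwellian hθ₁)

theorem one_le_glue_wall (hθ₀ : 0 < θ₀) (hθ₁ : 0 < θ₁) :
    1 ≤ ∫ v, glue (wallMaxwellian θ₀) (wallMaxwellian θ₁) v * (1 + ‖v‖ ^ 2) := by
  have hr : ∀ θ, ∀ v : V, wallMaxwellian θ (reflect v) * (1 + ‖reflect v‖ ^ 2) =
      wallMaxwellian θ v * (1 + ‖v‖ ^ 2) := fun θ v => by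
    simp only [wallMaxwellian, norm_reflect]
  rw [integral_eq_halves (integrable_glue_wall hθ₀ hθ₁), setIntegral_glue_pos,
    setIntegral_glue_neg, (half_integral (integrable_wallMaxwellian hθ₀) (hr θ₀)).1,
    (half_integral (integrable_wallMaxwellian hθ₁) (hr θ₁)).2]
  linarith [one_le_wallMaxwellian hθ₀, one_le_wallMaxwellian hθ₁]

end Wall

/-! ### Positivity of the data constants and vanishing vertical momentum -/

section Data

variable {θ₀ θ₁ : ℝ} {fL fR : V → ℝ}

theorem aestronglyMeasurable_exp_mul {p : V → ℝ} (hp : AEStronglyMeasurable p) :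
    AEStronglyMeasurable fun v : V => Real.exp (-(1 / |v 0|)) * p v :=
  AEStronglyMeasurable.mul (Measurable.aestronglyMeasurable (by fun_prop)) hp

theorem exp_neg_le_one (v : V) : Real.exp (-(1 / |v 0|)) ≤ 1 := by
  have : 0 ≤ 1 / |v 0| := by positivity
  exact Real.exp_le_one_iff.2 (by linarith)

theorem integrable_damped {p : V → ℝ} (hp : Integrable fun v : V => p v * (1 + ‖v‖ ^ 2)) :
    Integrable fun v : V => Real.exp (-(1 / |v 0|)) * p v * (1 + ‖v‖ ^ 2) :=
  integrable_energy_of_le hp (aestronglyMeasurable_exp_mul (aestronglyMeasurable_of_energy hp))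
    (ae_of_all _ fun v => by
      rw [abs_mul, abs_of_pos (Real.exp_pos _)]
      exact mul_le_of_le_one_left (abs_nonneg _) (exp_neg_le_one v))

theorem CLR_eq (hθ₀ : 0 < θ₀) (hθ₁ : 0 < θ₁) (hP : P1 fL fR) :
    CLR θ₀ θ₁ fL fR = 4 * (∫ v, glue fL fR v * (1 + ‖v‖ ^ 2)) *
      ∫ v, glue (wallMaxwellian θ₀) (wallMaxwellian θ₁) v * (1 + ‖v‖ ^ 2) := by
  rw [CLR, traceNorm_eq hP.finite, traceNorm_eq (integrable_glue_wall hθ₀ hθ₁)]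
  have h1 : ∫ v, |glue fL fR v| * (1 + ‖v‖ ^ 2) = ∫ v, glue fL fR v * (1 + ‖v‖ ^ 2) := by
    refine integral_congr_ae ?_
    filter_upwards [hP.nonneg] with v hv
    simp only [abs_of_nonneg hv]
  simp only [h1, abs_of_nonneg (glue_wall_nonneg hθ₀ hθ₁ _)]
  ring

theorem integral_pos_of_weight (hP : P1 fL fR) {q : V → ℝ} (hq0 : ∀ v, 0 ≤ q v)
    (hq : ∀ᵐ v, glue fL fR v ≠ 0 → q v ≠ 0) (hi : Integrable fun v => glue fL fR v * q v) :
    0 < ∫ v, glue fL fR v * q v := by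
  have h0 : 0 ≤ᵐ[volume] fun v => glue fL fR v * q v := by
    filter_upwards [hP.nonneg] with v hv using mul_nonneg hv (hq0 v)
  refine lt_of_le_of_ne (integral_nonneg_of_ae h0) fun h => hP.nontrivial ?_
  filter_upwards [(integral_eq_zero_iff_of_nonneg_ae h0 hi).1 h.symm, hq] with v h1 h2
  by_contra h3
  exact (mul_ne_zero h3 (h2 h3)) h1

theorem energy_data_pos (hP : P1 fL fR) : 0 < ∫ v, glue fL fR v * (1 + ‖v‖ ^ 2) :=
  integral_pos_of_weight hP (fun v => by positivity)
    (ae_of_all _ fun v _ => by positivity) hP.finite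

/-- Each trace norm doubles the integral, whence the factor 4. It leaves room for the remainder in
the energy estimates. -/
theorem energy_data_le_CLR (hθ₀ : 0 < θ₀) (hθ₁ : 0 < θ₁) (hP : P1 fL fR) :
    4 * (∫ v, glue fL fR v * (1 + ‖v‖ ^ 2)) ≤ CLR θ₀ θ₁ fL fR := by
  rw [CLR_eq hθ₀ hθ₁ hP]
  exact le_mul_of_one_le_right (by linarith [energy_data_pos hP]) (one_le_glue_wall hθ₀ hθ₁)

theorem CLR_pos (hθ₀ : 0 < θ₀) (hθ₁ : 0 < θ₁) (hP : P1 fL fR) : 0 < CLR θ₀ θ₁ fL fR := by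
  linarith [energy_data_le_CLR hθ₀ hθ₁ hP, energy_data_pos hP]

theorem aEll_pos (hP : P1 fL fR) : 0 < aEll fL fR := by
  have h := integral_pos_of_weight hP (q := fun v => Real.exp (-(1 / |v 0|)))
    (fun v => (Real.exp_pos _).le) (ae_of_all _ fun v _ => (Real.exp_pos _).ne')
    ((integrable_of_energy (integrable_damped hP.finite)).congr
      (ae_of_all _ fun v => mul_comm _ _))
  simpa only [aEll, mul_comm] using h

theorem aCrit_integrand_nonneg {κ : V} (hκ : ‖κ‖ = 1) (v : V) :
    0 ≤ ‖v‖ ^ 2 - inner ℝ v κ ^ 2 := by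
  have h := abs_real_inner_le_norm v κ
  rw [hκ, mul_one] at h
  have := sq_le_sq' (by linarith [neg_abs_le (inner ℝ v κ : ℝ)]) ((le_abs_self _).trans h)
  linarith

/-- Equality in Cauchy–Schwarz forces `v` onto the line through `κ`, a null set. -/
theorem ae_norm_sq_sub_ne_zero {κ : V} (hκ : ‖κ‖ = 1) :
    ∀ᵐ v : V, ‖v‖ ^ 2 - inner ℝ v κ ^ 2 ≠ 0 := by
  have h := Measure.addHaar_submodule (volume : Measure V) (Submodule.span ℝ {κ}) (by
    intro h
    have h1 := finrank_span_le_card (R := ℝ) ({κ} : Set V)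
    rw [h, finrank_top, finrank_euclideanSpace_fin] at h1
    simp at h1)
  rw [ae_iff]
  refine measure_mono_null (fun v hv => ?_) h
  have h0 : ‖v‖ ^ 2 - inner ℝ v κ ^ 2 = 0 := not_not.1 hv
  have h1 : ‖v - (inner ℝ v κ : ℝ) • κ‖ ^ 2 = 0 := by
    rw [norm_sub_sq_real, real_inner_smul_right, norm_smul, hκ, mul_one, Real.norm_eq_abs, sq_abs]
    linarith
  have h2 : v = (inner ℝ v κ : ℝ) • κ := sub_eq_zero.1 (norm_eq_zero.1 (pow_eq_zero_iff two_ne_zero |>.1 h1))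
  exact Submodule.mem_span_singleton.2 ⟨_, h2.symm⟩

theorem integrable_aCrit_integrand {q : V → ℝ} (hq : Integrable fun v : V => q v * (1 + ‖v‖ ^ 2))
    (κ : V) : Integrable fun v => q v * (‖v‖ ^ 2 - inner ℝ v κ ^ 2) :=
  ((integrable_mul_norm_sq hq).sub (integrable_mul_inner_sq hq κ)).congr
    (ae_of_all _ fun v => by simp only [Pi.sub_apply]; ring)

theorem aCrit_le (hP : P1 fL fR) {κ : V} (hκ : ‖κ‖ = 1) :
    aCrit fL fR ≤ ∫ v : V, Real.exp (-(1 / |v 0|)) * glue fL fR v *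
      (‖v‖ ^ 2 - inner ℝ v κ ^ 2) := by
  refine ciInf_le (f := fun κ : Metric.sphere (0 : V) 1 => ∫ v : V, Real.exp (-(1 / |v 0|)) *
    glue fL fR v * (‖v‖ ^ 2 - inner ℝ v (κ : V) ^ 2)) ⟨0, ?_⟩ ⟨κ, by simpa using hκ⟩
  rintro _ ⟨κ, rfl⟩
  refine integral_nonneg_of_ae ?_
  filter_upwards [hP.nonneg] with v hv
  exact mul_nonneg (mul_nonneg (Real.exp_pos _).le hv)
    (aCrit_integrand_nonneg (by simp) v)

/-- The integral is continuous in κ, so its infimum over the compact sphere is attained, and it is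
positive at every κ. -/
theorem aCrit_pos (hP : P1 fL fR) : 0 < aCrit fL fR := by
  have hd := integrable_damped hP.finite
  set I : Metric.sphere (0 : V) 1 → ℝ := fun κ => ∫ v : V, Real.exp (-(1 / |v 0|)) *
    glue fL fR v * (‖v‖ ^ 2 - inner ℝ v (κ : V) ^ 2) with hI
  have hcont : Continuous I := by
    refine continuous_of_dominated
      (fun κ => (integrable_aCrit_integrand hd (κ : V)).aestronglyMeasurable)
      (fun κ => ae_of_all _ fun v => ?_) (integrable_mul_norm_sq hd).norm
      (ae_of_all _ fun v => by fun_prop)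
    rw [norm_mul, norm_mul _ (‖v‖ ^ 2)]
    have h1 := aCrit_integrand_nonneg (κ := (κ : V)) (by simp) v
    rw [Real.norm_of_nonneg h1, Real.norm_of_nonneg (sq_nonneg ‖v‖)]
    exact mul_le_mul_of_nonneg_left (by linarith [sq_nonneg (inner ℝ v (κ : V))]) (norm_nonneg _)
  have hne : Nonempty (Metric.sphere (0 : V) 1) := ⟨⟨EuclideanSpace.single 0 1, by simp⟩⟩
  have : CompactSpace (Metric.sphere (0 : V) 1) :=
    isCompact_iff_compactSpace.1 (isCompact_sphere (0 : V) 1)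
  obtain ⟨κ, -, hκ⟩ := isCompact_univ.exists_isMinOn univ_nonempty hcont.continuousOn
  have hκ1 : ‖(κ : V)‖ = 1 := by simp
  refine lt_of_lt_of_le ?_ (le_ciInf fun κ' => hκ (mem_univ κ'))
  have h := integral_pos_of_weight hP
    (q := fun v => Real.exp (-(1 / |v 0|)) * (‖v‖ ^ 2 - inner ℝ v (κ : V) ^ 2))
    (fun v => mul_nonneg (Real.exp_pos _).le (aCrit_integrand_nonneg hκ1 v))
    (by
      filter_upwards [ae_norm_sq_sub_ne_zero hκ1] with v hv _
      exact mul_ne_zero (Real.exp_pos _).ne' hv)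
    ((integrable_aCrit_integrand hd (κ : V)).congr (ae_of_all _ fun v => by
      simp only
      ring))
  refine h.trans_eq (integral_congr_ae (ae_of_all _ fun v => ?_))
  simp only
  ring

theorem gammaEll_pos (hP : P1 fL fR) (hL : ¬ ∀ᵐ v : V, 0 < v 0 → fL v = 0)
    (hR : ¬ ∀ᵐ v : V, v 0 < 0 → fR v = 0) : 0 < gammaEll fL fR := by
  have hd := integrable_flux (integrable_damped hP.finite)
  have key : ∀ {S : Set V} {g : V → ℝ}, MeasurableSet S → (∀ v ∈ S, v 0 ≠ 0) →
      (∀ v ∈ S, glue fL fR v = g v) → (¬ ∀ᵐ v, v ∈ S → g v = 0) →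
      0 < ∫ v in S, Real.exp (-(1 / |v 0|)) * g v * |v 0| := by
    intro S g hS hS0 hg hne
    have e : ∫ v in S, Real.exp (-(1 / |v 0|)) * g v * |v 0| =
        ∫ v in S, Real.exp (-(1 / |v 0|)) * glue fL fR v * |v 0| :=
      setIntegral_congr_fun hS fun v hv => by simp only [hg v hv]
    rw [e]
    have h0 : 0 ≤ᵐ[volume.restrict S] fun v =>
        Real.exp (-(1 / |v 0|)) * glue fL fR v * |v 0| := by
      filter_upwards [ae_restrict_of_ae hP.nonneg] with v hv
      exact mul_nonneg (mul_nonneg (Real.exp_pos _).le hv) (abs_nonneg _)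
    refine lt_of_le_of_ne (integral_nonneg_of_ae h0) fun h => hne ?_
    filter_upwards [(ae_restrict_iff' hS).1
      ((integral_eq_zero_iff_of_nonneg_ae h0 hd.integrableOn).1 h.symm)] with v hv hvS
    have h1 := hv hvS
    simp only [Pi.zero_apply, mul_eq_zero, Real.exp_ne_zero, false_or, abs_eq_zero] at h1
    rw [← hg v hvS]
    exact h1.resolve_right (hS0 v hvS)
  refine mul_pos (key measurableSet_pos (fun v hv => ne_of_gt hv) (fun v hv => ?_) hL)
    (key measurableSet_neg (fun v hv => ne_of_lt hv) (fun v hv => ?_) hR)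
  · rw [glue, if_pos (show 0 < v 0 from hv)]
  · rw [glue, if_neg (not_lt.2 (le_of_lt (show v 0 < 0 from hv))), if_pos (show v 0 < 0 from hv)]

/-- Splitting off the first component. -/
def splitEquiv : V ≃ᵐ ℝ × ℝ × ℝ :=
  ((MeasurableEquiv.toLp 2 (Fin 3 → ℝ)).symm.trans
    (MeasurableEquiv.piFinSuccAbove (fun _ => ℝ) 0)).trans
    ((MeasurableEquiv.refl ℝ).prodCongr MeasurableEquiv.finTwoArrow)

theorem measurePreserving_splitEquiv : MeasurePreserving splitEquiv :=
  ((EuclideanSpace.volume_preserving_symm_measurableEquiv_toLp (Fin 3)).trans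
    (volume_preserving_piFinSuccAbove (fun _ => ℝ) 0)).trans
    ((MeasurePreserving.id volume).prod (volume_preserving_finTwoArrow ℝ))

theorem integral_eq_iterated {G : V → ℝ} (hG : Integrable G) :
    ∫ v, G v = ∫ s : ℝ, ∫ w : ℝ × ℝ, G !₂[s, w.1, w.2] := by
  have e : ∀ v, G !₂[(splitEquiv v).1, (splitEquiv v).2.1, (splitEquiv v).2.2] = G v := by
    intro v
    congr 1
    ext i
    fin_cases i <;> rfl
  have h1 := measurePreserving_splitEquiv.integral_comp'
    (fun z : ℝ × ℝ × ℝ => G !₂[z.1, z.2.1, z.2.2])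
  have h2 := (measurePreserving_splitEquiv.integrable_comp_emb
    splitEquiv.measurableEmbedding (g := fun z : ℝ × ℝ × ℝ => G !₂[z.1, z.2.1, z.2.2])).1
    (hG.congr (ae_of_all _ fun v => (e v).symm))
  simp only [e] at h1
  rw [h1]
  exact integral_prod _ h2

/-- A weight depending on v₁ alone leaves the inner integrals over (v₂, v₃), which (P₂) annihilates.
Both the damping exp(-1/|v₁|) and the attenuation at fixed x are such weights. -/
theorem vertical_momentum_eq_zero (hP : P1 fL fR) (hP2 : P2 fL fR) {φ : ℝ → ℝ}
    (hφ : Measurable φ) (hφ1 : ∀ s, |φ s| ≤ 1) {i : Fin 3} (hi : i ≠ 0) :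
    ∫ v : V, φ (v 0) * glue fL fR v * v i = 0 := by
  have hint : Integrable fun v : V => φ (v 0) * glue fL fR v * v i := by
    refine ((integrable_mul_apply hP.finite i).bdd_mul (c := 1)
      (Measurable.aestronglyMeasurable (f := fun v : V => φ (v 0)) (by fun_prop))
      (ae_of_all _ fun v => hφ1 _)).congr (ae_of_all _ fun v => ?_)
    simp only
    ring
  rw [integral_eq_iterated hint]
  refine integral_eq_zero_of_ae ?_
  have hs0 : ∀ᵐ s : ℝ, s ≠ 0 := by simp [ae_iff]
  have key : ∀ (q : ℝ × ℝ → ℝ), (∀ s (w : ℝ × ℝ), (!₂[s, w.1, w.2] : V) i = q w) →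
      (∀ᵐ s : ℝ, 0 < s → ∫ w : ℝ × ℝ, fL !₂[s, w.1, w.2] * q w = 0) →
      (∀ᵐ s : ℝ, s < 0 → ∫ w : ℝ × ℝ, fR !₂[s, w.1, w.2] * q w = 0) →
      (fun s : ℝ => ∫ w : ℝ × ℝ, φ ((!₂[s, w.1, w.2] : V) 0) * glue fL fR !₂[s, w.1, w.2] *
        (!₂[s, w.1, w.2] : V) i) =ᵐ[volume] 0 := by
    intro q hq h1 h2
    filter_upwards [h1, h2, hs0] with s h1 h2 h3
    rcases h3.lt_or_gt with h | h
    · have e : ∀ w : ℝ × ℝ, φ ((!₂[s, w.1, w.2] : V) 0) * glue fL fR !₂[s, w.1, w.2] *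
          (!₂[s, w.1, w.2] : V) i = φ s * (fR !₂[s, w.1, w.2] * q w) := fun w => by
        rw [hq, glue, if_neg (show ¬ 0 < (!₂[s, w.1, w.2] : V) 0 from h.not_gt), if_pos (show (!₂[s, w.1, w.2] : V) 0 < 0 from h),
          mul_assoc]
        rfl
      simp only [e, integral_const_mul, h2 h, mul_zero, Pi.zero_apply]
    · have e : ∀ w : ℝ × ℝ, φ ((!₂[s, w.1, w.2] : V) 0) * glue fL fR !₂[s, w.1, w.2] *
          (!₂[s, w.1, w.2] : V) i = φ s * (fL !₂[s, w.1, w.2] * q w) := fun w => by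
        rw [hq, glue, if_pos (show 0 < (!₂[s, w.1, w.2] : V) 0 from h), mul_assoc]
        rfl
      simp only [e, integral_const_mul, h1 h, mul_zero, Pi.zero_apply]
  match i, hi with
  | 1, _ => exact key (fun w => w.1) (fun s w => rfl) hP2.left₂ hP2.right₂
  | 2, _ => exact key (fun w => w.2) (fun s w => rfl) hP2.left₃ hP2.right₃

end Data

/-! ### Bounds on the macroscopic fields -/

theorem ellipsoidalGaussian_nonneg {g : V → ℝ} (hg : ∀ᵐ v, 0 ≤ g v) (ν : ℝ) (v : V) :
    0 ≤ ellipsoidalGaussian ν g v :=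
  mul_nonneg (div_nonneg (integral_nonneg_of_ae hg) (Real.sqrt_nonneg _)) (Real.exp_pos _).le

theorem exp_inv_le_attenuation {τ x : ℝ} (hτ : 1 ≤ τ) (hx : x ∈ Icc (0 : ℝ) 1) (v : V) :
    Real.exp (-(1 / |v 0|)) ≤ attenuation τ x v := by
  refine le_trans (Real.exp_le_exp.2 (neg_le_neg ?_)) (exp_le_attenuation (by linarith) hx v)
  rcases eq_or_ne (v 0) 0 with h | h
  · simp [h]
  · have := abs_pos.2 h
    exact one_div_le_one_div_of_le this (le_mul_of_one_le_left this.le hτ)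

/-! ### Density and temperature bounds for fields above the damped data -/

section Lower

variable {fL fR f : V → ℝ} {δ : ℝ}

/-- `f` lies above the free transport of the data over one unit of time. -/
structure AboveData (δ : ℝ) (fL fR f : V → ℝ) : Prop where
  weight_nonneg : 0 ≤ δ
  data : P1 fL fR
  integrable : Integrable fun v : V => f v * (1 + ‖v‖ ^ 2)
  ge : ∀ᵐ v : V, δ * (Real.exp (-(1 / |v 0|)) * glue fL fR v) ≤ f v

theorem AboveData.nonneg (h : AboveData δ fL fR f) : ∀ᵐ v, 0 ≤ f v := by
  filter_upwards [h.ge, h.data.nonneg] with v h1 h2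
  have := h.weight_nonneg
  exact le_trans (by positivity) h1

theorem AboveData.integral_ge (h : AboveData δ fL fR f) {q : V → ℝ} (hq : ∀ v, 0 ≤ q v)
    (hi : Integrable fun v => Real.exp (-(1 / |v 0|)) * glue fL fR v * q v)
    (hf : Integrable fun v => f v * q v) :
    δ * (∫ v, Real.exp (-(1 / |v 0|)) * glue fL fR v * q v) ≤ ∫ v, f v * q v := by
  rw [← integral_const_mul]
  refine integral_mono_ae (hi.const_mul δ) hf ?_
  filter_upwards [h.ge] with v hv
  calc _ = δ * (Real.exp (-(1 / |v 0|)) * glue fL fR v) * q v := by ring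
    _ ≤ _ := mul_le_mul_of_nonneg_right hv (hq v)

theorem AboveData.density_ge (h : AboveData δ fL fR f) : δ * aEll fL fR ≤ density f := by
  have := h.integral_ge (q := fun _ => 1) (fun _ => zero_le_one)
    (by simpa using integrable_of_energy (integrable_damped h.data.finite))
    (by simpa using integrable_of_energy h.integrable)
  simpa [aEll, density] using this

theorem AboveData.density_pos (h : AboveData δ fL fR f) (hδ : 0 < δ) : 0 < density f :=
  lt_of_lt_of_le (mul_pos hδ (aEll_pos h.data)) h.density_ge

/-- Nothing is assumed about `U`. For the damped data the cross terms with U₂ and U₃ integrate to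
zero, so the energy in the directions 2 and 3 survives recentring. -/
theorem AboveData.variance_ge (h : AboveData δ fL fR f) (h2 : P2 fL fR) :
    δ * aCrit fL fR ≤ ∫ v, f v * ‖v - bulkVelocity f‖ ^ 2 := by
  set U := bulkVelocity f
  set q : V → ℝ := fun v => Real.exp (-(1 / |v 0|)) * glue fL fR v with hq
  have hqi : Integrable fun v : V => q v * (1 + ‖v‖ ^ 2) := integrable_damped h.data.finite
  have hq0 : ∀ᵐ v, 0 ≤ q v := h.data.nonneg.mono fun v hv => mul_nonneg (Real.exp_pos _).le hv
  have hi : Integrable fun v => q v * ‖v - U‖ ^ 2 := by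
    refine ((integrable_mul_norm_sq hqi).add ((integrable_mul_inner hqi U).const_mul (-2))).add
      ((integrable_of_energy hqi).const_mul (‖U‖ ^ 2)) |>.congr (ae_of_all _ fun v => ?_)
    simp only [Pi.add_apply]
    rw [norm_sub_sq_real]
    ring
  refine le_trans ?_ (h.integral_ge (fun v => sq_nonneg _) hi
    (integrable_mul_norm_sub_sq h.integrable))
  refine mul_le_mul_of_nonneg_left ?_ h.weight_nonneg
  -- In the infimum defining `aCrit` the direction e₁ leaves precisely v₂² + v₃².
  have hκ : ‖(EuclideanSpace.single 0 1 : V)‖ = 1 := by simp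
  refine (aCrit_le h.data hκ).trans ?_
  have hv : ∀ i : Fin 3, i ≠ 0 → ∫ v, q v * v i = 0 := fun i hi =>
    vertical_momentum_eq_zero h.data h2 (φ := fun s => Real.exp (-(1 / |s|))) (by fun_prop)
      (fun s => by
        rw [abs_of_pos (Real.exp_pos _), Real.exp_le_one_iff]
        have : 0 ≤ 1 / |s| := by positivity
        linarith) hi
  have h3 : ∫ v : V, q v * (‖v‖ ^ 2 - inner ℝ v (EuclideanSpace.single 0 1 : V) ^ 2) =
      ∫ v, (q v * (‖v‖ ^ 2 - inner ℝ v (EuclideanSpace.single 0 1 : V) ^ 2) +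
        -(2 * U 1) * (q v * v 1) + -(2 * U 2) * (q v * v 2) + 0 * q v) := by
    rw [integral_combination (integrable_aCrit_integrand hqi _) (integrable_mul_apply hqi 1)
      (integrable_mul_apply hqi 2) (integrable_of_energy hqi), hv 1 (by decide), hv 2 (by decide)]
    ring
  rw [h3]
  refine integral_mono_ae ((((integrable_aCrit_integrand hqi _).add
    ((integrable_mul_apply hqi 1).const_mul _)).add ((integrable_mul_apply hqi 2).const_mul _)).add
    ((integrable_of_energy hqi).const_mul _)) hi ?_
  filter_upwards [hq0] with v hv
  have e1 : inner ℝ v (EuclideanSpace.single 0 1 : V) = v 0 := by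
    simp [EuclideanSpace.inner_single_right]
  have e2 : ∀ w : V, ‖w‖ ^ 2 = w 0 ^ 2 + w 1 ^ 2 + w 2 ^ 2 := fun w => by
    simp [EuclideanSpace.norm_sq_eq, Fin.sum_univ_three]
  rw [e1, e2, e2]
  simp only [PiLp.sub_apply]
  have h4 : 0 ≤ q v * ((v 0 - U 0) ^ 2 + U 1 ^ 2 + U 2 ^ 2) := by positivity
  linarith

/-- With A = A₊ + A₋ the absolute flux and J = A₊ - A₋ the net flux, Cauchy–Schwarz gives ρ∫f v₁² -
J² ≥ A² - J² = 4 A₊A₋. Each half flux is at least δ times its damped data flux. -/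
theorem AboveData.flux_variance_ge (h : AboveData δ fL fR f) (hδ : 0 < δ) :
    4 * δ ^ 2 * gammaEll fL fR ≤ density f * ∫ v, f v * ‖v - bulkVelocity f‖ ^ 2 := by
  have hf := h.integrable
  have hρ := h.density_pos hδ
  set e : V := EuclideanSpace.single 0 1 with he
  have hie : ∀ v : V, inner ℝ v e = v 0 := fun v => by
    simp [he, EuclideanSpace.inner_single_right]
  set A := ∫ v, f v * |v 0| with hA
  set Ap := ∫ v in {v : V | 0 < v 0}, f v * |v 0| with hAp
  set Am := ∫ v in {v : V | v 0 < 0}, f v * |v 0| with hAm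
  set J := ∫ v, f v * v 0 with hJ
  set E := ∫ v, f v * v 0 ^ 2 with hE
  have hif := integrable_flux hf
  have hiE : Integrable fun v => f v * v 0 ^ 2 := by simpa [hie] using integrable_mul_inner_sq hf e
  have hA1 : A = Ap + Am := integral_eq_halves hif
  have hJ1 : J = Ap - Am := by
    rw [hJ, integral_eq_halves (integrable_mul_apply hf 0), sub_eq_add_neg, hAm, ← integral_neg]
    congr 1
    · exact setIntegral_congr_fun measurableSet_pos fun v hv => by
        simp only [abs_of_pos (show 0 < v 0 from hv)]
    · exact setIntegral_congr_fun measurableSet_neg fun v hv => by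
        simp only [abs_of_neg (show v 0 < 0 from hv)]
        ring
  have hCS : A ^ 2 ≤ density f * E := by
    have h1 : 0 ≤ ∫ v, (f v * v 0 ^ 2 + -(2 * (A / density f)) * (f v * |v 0|) +
        (A / density f) ^ 2 * f v + 0 * f v) := by
      refine integral_nonneg_of_ae ?_
      filter_upwards [h.nonneg] with v hv
      have : 0 ≤ f v * (|v 0| - A / density f) ^ 2 := by positivity
      have e1 : v 0 ^ 2 = |v 0| ^ 2 := (sq_abs _).symm
      rw [e1]
      simp only [Pi.zero_apply]
      linarith
    rw [integral_combination hiE hif (integrable_of_energy hf) (integrable_of_energy hf),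
      ← hA, ← hE] at h1
    change 0 ≤ _ + _ + _ * density f + _ at h1
    have e2 : E + -(2 * (A / density f)) * A + (A / density f) ^ 2 * density f +
        0 * density f = E - A ^ 2 / density f := by field_simp; ring
    have h2 : 0 ≤ E - A ^ 2 / density f := by rw [← e2]; exact h1
    have h3 := (div_le_iff₀ hρ).1 (sub_nonneg.1 h2)
    linarith
  have hvar : density f * ∫ v, f v * inner ℝ (v - bulkVelocity f) e ^ 2 =
      density f * E - J ^ 2 := by
    have h1 := integral_mul_inner_eq hf hρ.ne' e
    rw [integral_mul_inner_sub_sq hf hρ.ne']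
    simp only [hie] at h1 ⊢
    rw [← hJ] at h1
    rw [← hE, h1]
    ring
  have hle : ∫ v, f v * inner ℝ (v - bulkVelocity f) e ^ 2 ≤
      ∫ v, f v * ‖v - bulkVelocity f‖ ^ 2 := by
    refine integral_mono_ae (integrable_mul_inner_sub_sq hf e) (integrable_mul_norm_sub_sq hf) ?_
    filter_upwards [h.nonneg] with v hv
    refine mul_le_mul_of_nonneg_left ?_ hv
    have := aCrit_integrand_nonneg (κ := e) (by simp [he]) (v - bulkVelocity f)
    linarith
  have hd := integrable_flux (integrable_damped h.data.finite)
  have hG : δ ^ 2 * gammaEll fL fR ≤ Ap * Am := by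
    have key : ∀ {S : Set V} {g : V → ℝ}, MeasurableSet S → (∀ v ∈ S, glue fL fR v = g v) →
        0 ≤ (∫ v in S, Real.exp (-(1 / |v 0|)) * g v * |v 0|) ∧
        δ * (∫ v in S, Real.exp (-(1 / |v 0|)) * g v * |v 0|) ≤ ∫ v in S, f v * |v 0| := by
      intro S g hS hg
      have e1 : ∫ v in S, Real.exp (-(1 / |v 0|)) * g v * |v 0| =
          ∫ v in S, Real.exp (-(1 / |v 0|)) * glue fL fR v * |v 0| :=
        setIntegral_congr_fun hS fun v hv => by simp only [hg v hv]
      rw [e1, ← integral_const_mul]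
      refine ⟨integral_nonneg_of_ae ?_,
        integral_mono_ae (hd.integrableOn.const_mul δ) hif.integrableOn ?_⟩
      · filter_upwards [ae_restrict_of_ae h.data.nonneg] with v hv
        exact mul_nonneg (mul_nonneg (Real.exp_pos _).le hv) (abs_nonneg _)
      · filter_upwards [ae_restrict_of_ae h.ge] with v hv
        calc _ = δ * (Real.exp (-(1 / |v 0|)) * glue fL fR v) * |v 0| := by ring
          _ ≤ _ := mul_le_mul_of_nonneg_right hv (abs_nonneg _)
    have k1 := key (g := fL) measurableSet_pos fun v hv => by
      rw [glue, if_pos (show 0 < v 0 from hv)]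
    have k2 := key (g := fR) measurableSet_neg fun v hv => by
      rw [glue, if_neg (not_lt.2 (le_of_lt (show v 0 < 0 from hv))),
        if_pos (show v 0 < 0 from hv)]
    calc δ ^ 2 * gammaEll fL fR = (δ * _) * (δ * _) := by rw [gammaEll]; ring
      _ ≤ Ap * Am := mul_le_mul k1.2 k2.2 (mul_nonneg hδ.le k2.1)
        ((mul_nonneg hδ.le k1.1).trans k1.2)
  have h1 := mul_le_mul_of_nonneg_left hle hρ.le
  rw [hvar, hJ1] at h1
  rw [hA1] at hCS
  linarith

theorem gammaEll_nonneg (hP : P1 fL fR) : 0 ≤ gammaEll fL fR := by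
  by_cases hL : ∀ᵐ v : V, 0 < v 0 → fL v = 0
  · have : ∫ v in {v : V | 0 < v 0}, Real.exp (-(1 / |v 0|)) * fL v * |v 0| = 0 := by
      refine integral_eq_zero_of_ae ((ae_restrict_iff' measurableSet_pos).2 ?_)
      filter_upwards [hL] with v hv hv0
      simp [hv hv0]
    rw [gammaEll, this, zero_mul]
  by_cases hR : ∀ᵐ v : V, v 0 < 0 → fR v = 0
  · have : ∫ v in {v : V | v 0 < 0}, Real.exp (-(1 / |v 0|)) * fR v * |v 0| = 0 := by
      refine integral_eq_zero_of_ae ((ae_restrict_iff' measurableSet_neg).2 ?_)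
      filter_upwards [hR] with v hv hv0
      simp [hv hv0]
    rw [gammaEll, this, mul_zero]
  exact (gammaEll_pos hP hL hR).le

theorem directional_variance_le (hf : Integrable fun v : V => f v * (1 + ‖v‖ ^ 2))
    (hf0 : ∀ᵐ v, 0 ≤ f v) (κ : V) :
    0 ≤ (∫ v, f v * inner ℝ (v - bulkVelocity f) κ ^ 2) ∧
      ∫ v, f v * inner ℝ (v - bulkVelocity f) κ ^ 2 ≤
        ‖κ‖ ^ 2 * ∫ v, f v * ‖v - bulkVelocity f‖ ^ 2 := by
  refine ⟨integral_nonneg_of_ae ?_, ?_⟩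
  · filter_upwards [hf0] with v hv
    exact mul_nonneg hv (sq_nonneg _)
  · rw [← integral_const_mul]
    refine integral_mono_ae (integrable_mul_inner_sub_sq hf κ)
      ((integrable_mul_norm_sub_sq hf).const_mul _) ?_
    filter_upwards [hf0] with v hv
    have h1 := abs_real_inner_le_norm (v - bulkVelocity f) κ
    have h2 : inner ℝ (v - bulkVelocity f) κ ^ 2 ≤ ‖κ‖ ^ 2 * ‖v - bulkVelocity f‖ ^ 2 := by
      rw [← sq_abs]
      calc _ ≤ (‖v - bulkVelocity f‖ * ‖κ‖) ^ 2 := by gcongr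
        _ = _ := by ring
    calc _ ≤ f v * (‖κ‖ ^ 2 * ‖v - bulkVelocity f‖ ^ 2) := mul_le_mul_of_nonneg_left h2 hv
      _ = _ := by ring

/-- The form is affine in the directional variance, which ranges between 0 and |κ|² times the total
variance; the two endpoints give (1 - ν)/3 and (1 + 2ν)/3. -/
theorem quadForm_temperatureTensor_mem (hf : Integrable fun v : V => f v * (1 + ‖v‖ ^ 2))
    (hf0 : ∀ᵐ v, 0 ≤ f v) (hρ : 0 < density f) (ν : ℝ) (κ : V) :
    min (1 - ν) (1 + 2 * ν) / 3 * (‖κ‖ ^ 2 * ∫ v, f v * ‖v - bulkVelocity f‖ ^ 2) ≤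
        density f * quadForm (temperatureTensor ν f) κ ∧
      density f * quadForm (temperatureTensor ν f) κ ≤
        max (1 - ν) (1 + 2 * ν) / 3 * (‖κ‖ ^ 2 * ∫ v, f v * ‖v - bulkVelocity f‖ ^ 2) := by
  obtain ⟨h0, h1⟩ := directional_variance_le hf hf0 κ
  rw [density_mul_quadForm hf hρ.ne']
  set Y := ∫ v, f v * inner ℝ (v - bulkVelocity f) κ ^ 2
  set X := ∫ v, f v * ‖v - bulkVelocity f‖ ^ 2
  rw [mul_assoc]
  set Z := ‖κ‖ ^ 2 * X
  rcases le_total (1 - ν) (1 + 2 * ν) with h | h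
  · rw [min_eq_left h, max_eq_right h]
    constructor <;> nlinarith
  · rw [min_eq_right h, max_eq_left h]
    constructor <;> nlinarith

theorem variance_le_energy (hf : Integrable fun v : V => f v * (1 + ‖v‖ ^ 2))
    (hρ : 0 < density f) :
    ∫ v, f v * ‖v - bulkVelocity f‖ ^ 2 ≤ ∫ v, f v * ‖v‖ ^ 2 := by
  rw [integral_mul_norm_sub_sq hf hρ.ne']
  have := mul_nonneg hρ.le (sq_nonneg ‖bulkVelocity f‖)
  linarith

theorem energy_split (hf : Integrable fun v : V => f v * (1 + ‖v‖ ^ 2)) :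
    ∫ v, f v * (1 + ‖v‖ ^ 2) = density f + ∫ v, f v * ‖v‖ ^ 2 := by
  rw [density, ← integral_add (integrable_of_energy hf) (integrable_mul_norm_sq hf)]
  refine integral_congr_ae (ae_of_all _ fun v => ?_)
  simp only
  ring

theorem energy_nonneg (hf0 : ∀ᵐ v, 0 ≤ f v) : 0 ≤ ∫ v, f v * ‖v‖ ^ 2 :=
  integral_nonneg_of_ae (hf0.mono fun _ hv => mul_nonneg hv (sq_nonneg _))

theorem norm_moments_le_of_nonneg (hf : Integrable fun v : V => f v * (1 + ‖v‖ ^ 2))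
    (hf0 : ∀ᵐ v, 0 ≤ f v) : ‖moments f‖ ≤ ∫ v, f v * (1 + ‖v‖ ^ 2) := by
  refine (norm_moments_le hf).trans_eq (integral_congr_ae ?_)
  filter_upwards [hf0] with v hv
  simp only [abs_of_nonneg hv]

theorem moments_mem_admissible (hf : Integrable fun v : V => f v * (1 + ‖v‖ ^ 2))
    (hf0 : ∀ᵐ v, 0 ≤ f v) {ν r B c : ℝ} (hr : 0 < r) (h1 : r ≤ density f)
    (h2 : ∫ v, f v * (1 + ‖v‖ ^ 2) ≤ B)
    (h3 : ∀ κ : V, ‖κ‖ = 1 → c ≤ quadForm (temperatureTensor ν f) κ) :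
    moments f ∈ Moments.Admissible ν r B c := by
  refine ⟨h1, (norm_moments_le_of_nonneg hf hf0).trans h2, fun κ => ?_, fun i j => ?_⟩
  · rw [← temperatureTensor_eq hf (hr.trans_le h1).ne']
    rcases eq_or_ne κ 0 with rfl | hκ
    · simp [quadForm]
    have hκ' : 0 < ‖κ‖ := norm_pos_iff.2 hκ
    have h4 := h3 (‖κ‖⁻¹ • κ) (by simp [norm_smul, hκ'.ne'])
    have h5 : quadForm (temperatureTensor ν f) (‖κ‖⁻¹ • κ) =
        (‖κ‖⁻¹) ^ 2 * quadForm (temperatureTensor ν f) κ := by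
      simp only [quadForm_eq_sum, PiLp.smul_apply, smul_eq_mul, Fin.sum_univ_three]
      ring
    rw [h5] at h4
    calc _ ≤ (‖κ‖⁻¹) ^ 2 * quadForm (temperatureTensor ν f) κ * ‖κ‖ ^ 2 := by gcongr
      _ = _ := by field_simp
  · simp only [moments, mul_comm]

/-- The ellipticity used to define the invariant set. Unlike the bound through `gammaEll` it never
degenerates. -/
theorem quadForm_noncritical_ge (h : AboveData δ fL fR f) (h2 : P2 fL fR) (hδ : 1 / 2 ≤ δ)
    {ν C : ℝ} (hν : -1 / 2 < ν) (hν1 : ν < 1) (hC : 0 < C)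
    (hE : ∫ v, f v * (1 + ‖v‖ ^ 2) ≤ 2 * C) {κ : V} (hκ : ‖κ‖ = 1) :
    min (1 - ν) (1 + 2 * ν) * aCrit fL fR / (12 * C) ≤ quadForm (temperatureTensor ν f) κ := by
  have hρ := h.density_pos (by linarith)
  have h3 := (quadForm_temperatureTensor_mem h.integrable h.nonneg hρ ν κ).1
  have h4 := h.variance_ge h2
  have h5 := energy_split h.integrable
  have h6 := energy_nonneg h.nonneg
  have hm : 0 < min (1 - ν) (1 + 2 * ν) := lt_min (by linarith) (by linarith)
  have hb := aCrit_pos h.data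
  rw [hκ, one_pow, one_mul] at h3
  set X := ∫ v, f v * ‖v - bulkVelocity f‖ ^ 2
  have h7 : aCrit fL fR / 2 ≤ X := by nlinarith
  have h8 : min (1 - ν) (1 + 2 * ν) / 3 * (aCrit fL fR / 2) ≤
      density f * quadForm (temperatureTensor ν f) κ :=
    le_trans (by gcongr) h3
  have hq : 0 < quadForm (temperatureTensor ν f) κ := by
    have : 0 < density f * quadForm (temperatureTensor ν f) κ := lt_of_lt_of_le (by positivity) h8
    exact (mul_pos_iff_of_pos_left hρ).1 this
  rw [div_le_iff₀ (by positivity)]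
  have h9 : density f * quadForm (temperatureTensor ν f) κ ≤
      2 * C * quadForm (temperatureTensor ν f) κ := by
    gcongr
    linarith
  linarith

theorem quadForm_noncritical_bounds (h : AboveData δ fL fR f) (hδ : 0 < δ) (hδ1 : δ ≤ 1)
    {ν C : ℝ} (hν : -1 / 2 < ν) (hν1 : ν < 1) (hC : 0 < C)
    (hE : ∫ v, f v * (1 + ‖v‖ ^ 2) ≤ 2 * C) (ha : aEll fL fR ≤ density f) {κ : V} (hκ : ‖κ‖ = 1) :
    min (1 - ν) (1 + 2 * ν) * δ ^ 2 * (gammaEll fL fR / (3 * C ^ 2)) ≤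
        quadForm (temperatureTensor ν f) κ ∧
      quadForm (temperatureTensor ν f) κ ≤
        2 / (3 * aEll fL fR * δ) * max (1 - ν) (1 + 2 * ν) * C := by
  have ha0 := aEll_pos h.data
  have hρ := ha0.trans_le ha
  have h3 := quadForm_temperatureTensor_mem h.integrable h.nonneg hρ ν κ
  have h4 := h.flux_variance_ge hδ
  have h5 := energy_split h.integrable
  have h6 := energy_nonneg h.nonneg
  have h7 := variance_le_energy h.integrable hρ
  have hm : 0 < min (1 - ν) (1 + 2 * ν) := lt_min (by linarith) (by linarith)
  have hM : 0 < max (1 - ν) (1 + 2 * ν) := lt_max_of_lt_left (by linarith)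
  have hγ := gammaEll_nonneg h.data
  rw [hκ, one_pow, one_mul] at h3
  set X := ∫ v, f v * ‖v - bulkVelocity f‖ ^ 2
  set Z := quadForm (temperatureTensor ν f) κ
  set ρ := density f
  set mn := min (1 - ν) (1 + 2 * ν)
  set mx := max (1 - ν) (1 + 2 * ν)
  have hρC : ρ ≤ 2 * C := by linarith
  constructor
  · have h8 : mn / 3 * (4 * δ ^ 2 * gammaEll fL fR) ≤ ρ ^ 2 * Z := by
      calc _ ≤ mn / 3 * (ρ * X) := by gcongr
        _ = ρ * (mn / 3 * X) := by ring
        _ ≤ ρ * (ρ * Z) := mul_le_mul_of_nonneg_left h3.1 hρ.le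
        _ = _ := by ring
    have hZ : 0 ≤ Z := by
      have : 0 ≤ ρ ^ 2 * Z := le_trans (by positivity) h8
      exact nonneg_of_mul_nonneg_right this (by positivity)
    have h9 : ρ ^ 2 * Z ≤ (2 * C) ^ 2 * Z := by gcongr
    rw [← mul_div_assoc, div_le_iff₀ (by positivity)]
    linarith
  · have hX : X ≤ 2 * C := by linarith
    have h8 : aEll fL fR * Z ≤ mx / 3 * (2 * C) := by
      rcases le_total 0 Z with hZ | hZ
      · calc _ ≤ ρ * Z := by gcongr
          _ ≤ mx / 3 * X := h3.2
          _ ≤ _ := by gcongr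
      · exact (mul_nonpos_of_nonneg_of_nonpos ha0.le hZ).trans (by positivity)
    have h9 : Z ≤ 2 / (3 * aEll fL fR) * mx * C := by
      have : 2 / (3 * aEll fL fR) * mx * C = (mx / 3 * (2 * C)) / aEll fL fR := by
        field_simp
      rw [this, le_div_iff₀ ha0]
      linarith
    -- The upper bound holds without δ; the stated factor 1/δ only weakens it.
    have h10 : 2 / (3 * aEll fL fR) ≤ 2 / (3 * aEll fL fR * δ) :=
      div_le_div_of_nonneg_left (by norm_num) (by positivity)
        (mul_le_of_le_one_right (by positivity) hδ1)
    exact h9.trans (by gcongr)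

theorem density_mul_quadForm_critical (hf : Integrable fun v : V => f v * (1 + ‖v‖ ^ 2))
    (hρ : 0 < density f) {κ : V} (hκ : ‖κ‖ = 1) :
    density f * quadForm (temperatureTensor (-1 / 2) f) κ =
      1 / 2 * ((∫ v, f v * ‖v - bulkVelocity f‖ ^ 2) -
        ∫ v, f v * inner ℝ (v - bulkVelocity f) κ ^ 2) := by
  rw [density_mul_quadForm hf hρ.ne', hκ]
  ring

theorem density_mul_norm_sq_le (hf : Integrable fun v : V => f v * (1 + ‖v‖ ^ 2))
    (hρ : 0 < density f) {s : ℝ} (hs : ∀ i, |∫ v, f v * v i| ≤ s) :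
    density f * ‖bulkVelocity f‖ ^ 2 ≤ 3 * s ^ 2 / density f := by
  rw [le_div_iff₀ hρ]
  have e : density f * ‖bulkVelocity f‖ ^ 2 * density f = ∑ i, (∫ v, f v * v i) ^ 2 := by
    simp only [EuclideanSpace.norm_sq_eq, bulkVelocity_apply hf, Real.norm_eq_abs, sq_abs,
      Fin.sum_univ_three]
    field_simp
  rw [e]
  have h1 : ∀ i, (∫ v, f v * v i) ^ 2 ≤ s ^ 2 := fun i => by
    rw [← sq_abs]
    have := hs i
    gcongr
  calc _ ≤ ∑ _i : Fin 3, s ^ 2 := Finset.sum_le_sum fun i _ => h1 i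
    _ = _ := by simp

/-- Twice ρκᵀ𝒯κ is ∫f(|v|² - (v·κ)²) - ρ|U|² + ρ(U·κ)². The first term is at least δ times `aCrit`,
and small momentum keeps the second from consuming it. -/
theorem quadForm_critical_bounds (h : AboveData δ fL fR f) (hδ : 1 / 2 ≤ δ) {C s : ℝ}
    (hE : ∫ v, f v * (1 + ‖v‖ ^ 2) ≤ C / 2) (hs : ∀ i, |∫ v, f v * v i| ≤ s)
    (hsab : 24 * s ^ 2 ≤ aEll fL fR * aCrit fL fR) {κ : V} (hκ : ‖κ‖ = 1) :
    δ * (aCrit fL fR / (2 * C)) ≤ quadForm (temperatureTensor (-1 / 2) f) κ ∧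
      quadForm (temperatureTensor (-1 / 2) f) κ ≤ 3 / (2 * aEll fL fR) * C := by
  have hf := h.integrable
  have ha := aEll_pos h.data
  have hb := aCrit_pos h.data
  have hρ := h.density_pos (by linarith)
  have hρa := h.density_ge
  have h5 := energy_split hf
  have h6 := energy_nonneg h.nonneg
  have h7 := variance_le_energy hf hρ
  have h8 := density_mul_quadForm_critical hf hρ hκ
  have h9 := density_mul_norm_sq_le hf hρ hs
  obtain ⟨h10, -⟩ := directional_variance_le hf h.nonneg κ
  have h11 := h.integral_ge (fun v => aCrit_integrand_nonneg hκ v)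
    (integrable_aCrit_integrand (integrable_damped h.data.finite) κ)
    (integrable_aCrit_integrand hf κ)
  have h12 := mul_le_mul_of_nonneg_left (aCrit_le h.data hκ) h.weight_nonneg
  have e1 : (∫ v, f v * ‖v - bulkVelocity f‖ ^ 2) -
      (∫ v, f v * inner ℝ (v - bulkVelocity f) κ ^ 2) =
      (∫ v, f v * (‖v‖ ^ 2 - inner ℝ v κ ^ 2)) - density f * ‖bulkVelocity f‖ ^ 2 +
        density f * inner ℝ (bulkVelocity f) κ ^ 2 := by
    rw [integral_mul_norm_sub_sq hf hρ.ne', integral_mul_inner_sub_sq hf hρ.ne']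
    simp only [mul_sub]
    rw [integral_sub (integrable_mul_norm_sq hf) (integrable_mul_inner_sq hf κ)]
    ring
  have hρ2 : aEll fL fR / 2 ≤ density f := by nlinarith
  -- With ρ ≥ a/2 the left side is at most 6s²/a, which explains the 24 in `hsab`.
  have h13 : 3 * s ^ 2 / density f ≤ aCrit fL fR / 4 := by
    rw [div_le_iff₀ hρ]
    nlinarith
  have h14 := mul_nonneg hρ.le (sq_nonneg (inner ℝ (bulkVelocity f) κ : ℝ))
  set Z := quadForm (temperatureTensor (-1 / 2) f) κ
  set ρ := density f
  have hC : 0 < C := by linarith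
  -- As δ ≥ 1/2, the loss b/4 is at most half of δb.
  have h15 : δ * aCrit fL fR / 4 ≤ ρ * Z := by
    rw [h8, e1]
    nlinarith
  constructor
  · have hZ : 0 < Z := by
      have : 0 < ρ * Z := lt_of_lt_of_le (by positivity) h15
      exact (mul_pos_iff_of_pos_left hρ).1 this
    have h16 : ρ * Z ≤ C / 2 * Z := by
      gcongr
      linarith
    rw [← mul_div_assoc, div_le_iff₀ (by positivity)]
    linarith
  · have h16 : ρ * Z ≤ C / 4 := by rw [h8]; linarith
    have h17 : Z ≤ C / (2 * aEll fL fR) := by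
      rw [le_div_iff₀ (by positivity)]
      rcases le_total 0 Z with hZ | hZ
      · nlinarith
      · nlinarith
    refine h17.trans ?_
    rw [div_mul_eq_mul_div]
    gcongr
    linarith

end Lower

/-! ### Energy, momentum and density of fields close to free transport -/

section NearFreeBounds

variable {fL fR f : V → ℝ} {η δ τ x : ℝ}

theorem integrable_attenuated {p : V → ℝ} (hp : Integrable fun v : V => p v * (1 + ‖v‖ ^ 2))
    (hτ : 0 ≤ τ) (hx : x ∈ Icc (0 : ℝ) 1) :
    Integrable fun v : V => attenuation τ x v * p v * (1 + ‖v‖ ^ 2) :=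
  integrable_energy_of_le hp ((measurable_attenuation τ x).aestronglyMeasurable.mul
    (aestronglyMeasurable_of_energy hp)) (ae_of_all _ fun v => by
      rw [abs_mul, abs_of_pos (attenuation_pos _ _ _)]
      exact mul_le_of_le_one_left (abs_nonneg _) (attenuation_le_one hτ hx v))

theorem NearFree.aboveData (h : NearFree η δ τ x (glue fL fR) f) (hP : P1 fL fR) (hδ : 0 ≤ δ)
    (hτ : 1 ≤ τ) (hx : x ∈ Icc (0 : ℝ) 1) : AboveData δ fL fR f := by
  refine ⟨hδ, hP, h.integrable, ?_⟩
  filter_upwards [h.ge, hP.nonneg] with v h1 h2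
  refine le_trans ?_ h1
  have := exp_inv_le_attenuation hτ hx v
  gcongr

theorem NearFree.energy_le (h : NearFree η δ τ x (glue fL fR) f) (hP : P1 fL fR)
    (hδ : δ ≤ 1) (hτ : 0 ≤ τ) (hx : x ∈ Icc (0 : ℝ) 1) :
    ∫ v, f v * (1 + ‖v‖ ^ 2) ≤ (∫ v, glue fL fR v * (1 + ‖v‖ ^ 2)) + η := by
  have hi := (integrable_attenuated hP.finite hτ hx).const_mul δ
  have h1 := h.le
  have e : ∀ v : V, (f v - δ * (attenuation τ x v * glue fL fR v)) * (1 + ‖v‖ ^ 2) =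
      f v * (1 + ‖v‖ ^ 2) - δ * (attenuation τ x v * glue fL fR v * (1 + ‖v‖ ^ 2)) := fun v => by
    ring
  simp only [e] at h1
  rw [integral_sub h.integrable hi] at h1
  have h2 : ∫ v, δ * (attenuation τ x v * glue fL fR v * (1 + ‖v‖ ^ 2)) ≤
      ∫ v, glue fL fR v * (1 + ‖v‖ ^ 2) := by
    refine integral_mono_ae hi hP.finite ?_
    filter_upwards [hP.nonneg] with v hv
    have h3 := attenuation_le_one hτ hx v
    have h4 := (attenuation_pos τ x v).le
    calc _ ≤ 1 * (1 * glue fL fR v * (1 + ‖v‖ ^ 2)) := by gcongr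
      _ = _ := by ring
  linarith

/-- The remainder is nonnegative, so its first moments are at most its energy. -/
theorem NearFree.abs_moment_le (h : NearFree η δ τ x (glue fL fR) f) (hP : P1 fL fR)
    (hτ : 0 ≤ τ) (hx : x ∈ Icc (0 : ℝ) 1) (i : Fin 3) :
    |∫ v, f v * v i| ≤ |δ * ∫ v, attenuation τ x v * glue fL fR v * v i| + η := by
  have hp := integrable_attenuated hP.finite hτ hx
  have hr : Integrable fun v => (f v - δ * (attenuation τ x v * glue fL fR v)) * (1 + ‖v‖ ^ 2) :=
    (h.integrable.sub (hp.const_mul δ)).congr (ae_of_all _ fun v => by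
      simp only [Pi.sub_apply]; ring)
  have h1 : ∫ v, f v * v i = (δ * ∫ v, attenuation τ x v * glue fL fR v * v i) +
      ∫ v, (f v - δ * (attenuation τ x v * glue fL fR v)) * v i := by
    rw [← integral_const_mul, ← integral_add ((integrable_mul_apply hp i).const_mul δ)
      (integrable_mul_apply hr i)]
    refine integral_congr_ae (ae_of_all _ fun v => ?_)
    simp only
    ring
  rw [h1]
  refine (abs_add_le _ _).trans (add_le_add le_rfl ?_)
  refine (abs_integral_mul_le hr fun v => abs_apply_le v i).trans (le_trans (le_of_eq ?_) h.le)
  refine integral_congr_ae ?_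
  filter_upwards [h.ge] with v hv
  rw [abs_of_nonneg (sub_nonneg.2 hv)]

theorem NearFree.abs_vertical_momentum_le (h : NearFree η δ τ x (glue fL fR) f) (hP : P1 fL fR)
    (hP2 : P2 fL fR) (hτ : 0 ≤ τ) (hx : x ∈ Icc (0 : ℝ) 1) {i : Fin 3} (hi : i ≠ 0) :
    |∫ v, f v * v i| ≤ η := by
  refine (h.abs_moment_le hP hτ hx i).trans_eq ?_
  have h1 := vertical_momentum_eq_zero hP hP2
    (φ := fun s => Real.exp (-((if 0 < s then x else 1 - x) / (τ * |s|))))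
    (Real.measurable_exp.comp (((Measurable.ite (measurableSet_lt (by fun_prop) (by fun_prop))
      measurable_const measurable_const).div (by fun_prop)).neg))
    (fun s => by
      rw [abs_of_pos (Real.exp_pos _), Real.exp_le_one_iff]
      have h0 : 0 ≤ if 0 < s then x else 1 - x := by
        split_ifs
        exacts [hx.1, by linarith [hx.2]]
      have : 0 ≤ (if 0 < s then x else 1 - x) / (τ * |s|) := by positivity
      linarith) hi
  have h2 : ∫ v, attenuation τ x v * glue fL fR v * v i = 0 := h1
  rw [h2, mul_zero, abs_zero, zero_add]

theorem fluxDiscrepancy_eq (hP : P1 fL fR) :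
    fluxDiscrepancy fL fR = |∫ v, glue fL fR v * v 0| := by
  rw [fluxDiscrepancy, integral_eq_halves (integrable_mul_apply hP.finite 0),
    setIntegral_glue_pos, setIntegral_glue_neg, sub_eq_add_neg, ← integral_neg]
  congr 2
  · exact setIntegral_congr_fun measurableSet_pos fun v hv => by
      simp only [abs_of_pos (show 0 < v 0 from hv)]
  · exact setIntegral_congr_fun measurableSet_neg fun v hv => by
      simp only [abs_of_neg (show v 0 < 0 from hv)]
      ring

/-- The weight |v₁| cancels the singularity in 1 - e⁻ᵘ ≤ u ≤ 1/(τ|v₁|), giving a rate uniform in the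
velocity. -/
theorem one_sub_attenuation_mul_le (hτ : 0 < τ) (hx : x ∈ Icc (0 : ℝ) 1) (v : V) :
    (1 - attenuation τ x v) * |v 0| ≤ 1 / τ := by
  rcases eq_or_ne (v 0) 0 with h | h
  · rw [h, abs_zero, mul_zero]
    positivity
  have h0 := abs_pos.2 h
  have h1 := Real.add_one_le_exp (-(depth x v / (τ * |v 0|)))
  have h2 : depth x v / (τ * |v 0|) ≤ 1 / (τ * |v 0|) :=
    div_le_div_of_nonneg_right (depth_mem hx v).2 (by positivity)
  rw [attenuation]
  calc _ ≤ 1 / (τ * |v 0|) * |v 0| := mul_le_mul_of_nonneg_right (by linarith) h0.le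
    _ = _ := by field_simp

/-- The net flux of the undamped data is the flux discrepancy; damping and the weight δ change it by
at most 1/τ + (1 - δ) times the energy. -/
theorem NearFree.abs_horizontal_momentum_le (h : NearFree η δ τ x (glue fL fR) f) (hP : P1 fL fR)
    (hδ0 : 0 ≤ δ) (hδ : δ ≤ 1) (hτ : 0 < τ) (hx : x ∈ Icc (0 : ℝ) 1) :
    |∫ v, f v * v 0| ≤ fluxDiscrepancy fL fR +
      ((1 - δ) + 1 / τ) * (∫ v, glue fL fR v * (1 + ‖v‖ ^ 2)) + η := by
  refine (h.abs_moment_le hP hτ.le hx 0).trans (add_le_add_left ?_ _)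
  rw [fluxDiscrepancy_eq hP]
  have hp := integrable_attenuated hP.finite hτ.le hx
  have h1 : δ * (∫ v, attenuation τ x v * glue fL fR v * v 0) = (∫ v, glue fL fR v * v 0) +
      -∫ v, (1 - δ * attenuation τ x v) * glue fL fR v * v 0 := by
    have e : ∀ v : V, (1 - δ * attenuation τ x v) * glue fL fR v * v 0 =
        glue fL fR v * v 0 - δ * (attenuation τ x v * glue fL fR v * v 0) := fun v => by ring
    simp only [e]
    rw [integral_sub (integrable_mul_apply hP.finite 0) ((integrable_mul_apply hp 0).const_mul δ),
      integral_const_mul]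
    ring
  rw [h1]
  refine (abs_add_le _ _).trans (add_le_add le_rfl ?_)
  rw [abs_neg, ← integral_const_mul, ← Real.norm_eq_abs]
  refine norm_integral_le_of_norm_le (hP.finite.const_mul _) ?_
  filter_upwards [hP.nonneg] with v hv
  have h2 := one_sub_attenuation_mul_le hτ hx v
  have h3 := attenuation_le_one hτ.le hx v
  have h4 := attenuation_pos τ x v
  have h5 : δ * attenuation τ x v ≤ 1 := by nlinarith
  have h6 : |v 0| ≤ 1 + ‖v‖ ^ 2 := by simpa using abs_apply_le v 0
  rw [norm_mul, norm_mul, Real.norm_of_nonneg hv, Real.norm_eq_abs, Real.norm_eq_abs,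
    abs_of_nonneg (by linarith : 0 ≤ 1 - δ * attenuation τ x v)]
  have h7 : (1 - δ * attenuation τ x v) * |v 0| ≤ ((1 - δ) + 1 / τ) * (1 + ‖v‖ ^ 2) := by
    have h8 : (1 - δ * attenuation τ x v) * |v 0| =
        (1 - δ) * |v 0| + δ * ((1 - attenuation τ x v) * |v 0|) := by ring
    have h9 : δ * ((1 - attenuation τ x v) * |v 0|) ≤ 1 / τ := by
      have : 0 ≤ (1 - attenuation τ x v) * |v 0| := mul_nonneg (by linarith) (abs_nonneg _)
      exact (mul_le_of_le_one_left this hδ).trans h2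
    have h10 : (1 - δ) * |v 0| ≤ (1 - δ) * (1 + ‖v‖ ^ 2) :=
      mul_le_mul_of_nonneg_left h6 (by linarith)
    have h11 : 1 / τ ≤ 1 / τ * (1 + ‖v‖ ^ 2) :=
      le_mul_of_one_le_right (by positivity) (by nlinarith [sq_nonneg ‖v‖])
    rw [h8, add_mul]
    linarith
  calc _ = (1 - δ * attenuation τ x v) * |v 0| * glue fL fR v := by ring
    _ ≤ ((1 - δ) + 1 / τ) * (1 + ‖v‖ ^ 2) * glue fL fR v := mul_le_mul_of_nonneg_right h7 hv
    _ = _ := by ring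

/-- For slow collisions the attenuated data have strictly more mass than `aEll`. -/
theorem aEll_gain_le (hP : P1 fL fR) {C : ℝ} (hC : 0 < C)
    (hE : ∫ v, glue fL fR v * (1 + ‖v‖ ^ 2) ≤ C) (hτ : 2 ≤ τ) (hx : x ∈ Icc (0 : ℝ) 1) :
    aEll fL fR * (1 + aEll fL fR / (2 * C)) ≤ ∫ v, attenuation τ x v * glue fL fR v := by
  have hd := integrable_damped hP.finite
  have ha := aEll_pos hP
  set a := aEll fL fR with haE
  set q : V → ℝ := fun v => Real.exp (-(1 / |v 0|)) * glue fL fR v with hq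
  have hle : ∫ v, ((1 + a / C) * q v - (a / C) ^ 2 / 2 * (glue fL fR v * (1 + ‖v‖ ^ 2))) ≤
      ∫ v, attenuation τ x v * glue fL fR v := by
    refine integral_mono_ae (((integrable_of_energy hd).const_mul _).sub (hP.finite.const_mul _))
      (integrable_of_energy (integrable_attenuated hP.finite (by linarith) hx)) ?_
    filter_upwards [hP.nonneg, ae_apply_zero_ne_zero] with v hv hv0
    have h0 := abs_pos.2 hv0
    set s := 1 / |v 0| with hs
    -- For τ ≥ 2 the exponent is at most s/2, so the damping improves on e⁻ˢ by the factor e^{s/2} ≥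
    -- 1 + s/2.
    have h1 : Real.exp (-s) * (1 + s / 2) ≤ attenuation τ x v := by
      refine le_trans ?_ (exp_le_attenuation (by linarith) hx v)
      have e1 : 1 / (τ * |v 0|) ≤ s / 2 := by
        rw [hs, div_div, one_div_le_one_div (by positivity) (by positivity)]
        nlinarith
      calc _ ≤ Real.exp (-s) * Real.exp (s / 2) := by
            gcongr
            linarith [Real.add_one_le_exp (s / 2)]
        _ = Real.exp (-(s / 2)) := by rw [← Real.exp_add]; ring_nf
        _ ≤ _ := Real.exp_le_exp.2 (by linarith)
    -- The convex function 1/|v₁| is bounded below by its tangent at |v₁| = 1/l. This l maximizes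
    -- the resulting gain l·a - l²C/2.
    set l := a / C
    have h2 : 2 * l - l ^ 2 * |v 0| ≤ s := by
      have : s - (2 * l - l ^ 2 * |v 0|) = (1 - l * |v 0|) ^ 2 / |v 0| := by
        rw [hs]; field_simp; ring
      have h3 : 0 ≤ (1 - l * |v 0|) ^ 2 / |v 0| := by positivity
      linarith
    have h3 : |v 0| ≤ 1 + ‖v‖ ^ 2 := by simpa using abs_apply_le v 0
    have h4 := exp_neg_le_one v
    have h5 := Real.exp_pos (-s)
    have h6 : (1 + l) * Real.exp (-s) - l ^ 2 / 2 * (1 + ‖v‖ ^ 2) ≤ attenuation τ x v := by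
      refine le_trans ?_ h1
      have h7 : Real.exp (-s) * (l ^ 2 / 2 * |v 0|) ≤ 1 * (l ^ 2 / 2 * (1 + ‖v‖ ^ 2)) := by
        gcongr
      nlinarith
    calc _ = ((1 + l) * Real.exp (-s) - l ^ 2 / 2 * (1 + ‖v‖ ^ 2)) * glue fL fR v := by
          simp only [hq]; ring
      _ ≤ _ := mul_le_mul_of_nonneg_right h6 hv
  rw [integral_sub ((integrable_of_energy hd).const_mul _) (hP.finite.const_mul _),
    integral_const_mul, integral_const_mul] at hle
  have e : ∫ v, q v = a := rfl
  rw [e] at hle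
  refine le_trans ?_ hle
  have h8 : (a / C) ^ 2 / 2 * (∫ v, glue fL fR v * (1 + ‖v‖ ^ 2)) ≤ (a / C) ^ 2 / 2 * C := by
    gcongr
  have h9 : a * (1 + a / (2 * C)) = (1 + a / C) * a - (a / C) ^ 2 / 2 * C := by
    field_simp
    ring
  linarith

/-- The threshold for δ equals 2C/(2C + a), the inverse of the gain factor 1 + a/(2C). -/
theorem NearFree.aEll_le_density (h : NearFree η δ τ x (glue fL fR) f) (hP : P1 fL fR) {C : ℝ}
    (hC : 0 < C) (hE : ∫ v, glue fL fR v * (1 + ‖v‖ ^ 2) ≤ C) (hτ : 2 ≤ τ)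
    (hx : x ∈ Icc (0 : ℝ) 1) (hδ : 1 - aEll fL fR / (2 * C + aEll fL fR) ≤ δ) :
    aEll fL fR ≤ density f := by
  have ha := aEll_pos hP
  have h1 := aEll_gain_le hP hC hE hτ hx
  have h2 : δ * (∫ v, attenuation τ x v * glue fL fR v) ≤ density f := by
    rw [← integral_const_mul]
    exact integral_mono_ae ((integrable_of_energy (integrable_attenuated hP.finite (by linarith)
      hx)).const_mul δ) (integrable_of_energy h.integrable) h.ge
  refine le_trans ?_ h2
  have h3 : 1 - aEll fL fR / (2 * C + aEll fL fR) = 2 * C / (2 * C + aEll fL fR) := by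
    field_simp
    ring
  have h4 : 0 < 2 * C / (2 * C + aEll fL fR) := by positivity
  calc aEll fL fR = 2 * C / (2 * C + aEll fL fR) * (aEll fL fR * (1 + aEll fL fR / (2 * C))) := by
        field_simp
    _ ≤ _ := by
      rw [h3] at hδ
      have h5 : 0 ≤ δ := h4.le.trans hδ
      gcongr

end NearFreeBounds

/-! ### From the constants of the data to the smallness thresholds -/

section MildBounds

variable {ν τ δ₁ δ₂ δ₃ θ₀ θ₁ : ℝ} {fL fR : V → ℝ} {f : ℝ → V → ℝ}

/-- Re-emission and collisions are nonnegative and can be dropped. Thus the competitors in the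
uniqueness statement need not be known to be close to free transport. -/
theorem IsMildSolution.aboveData (hf : IsMildSolution ν τ δ₁ δ₂ δ₃ θ₀ θ₁ fL fR f)
    (hf0 : Nonneg f) (hP : P1 fL fR) (hθ₀ : 0 < θ₀) (hθ₁ : 0 < θ₁) (hδ₁ : 0 ≤ δ₁) (hδ₂ : 0 ≤ δ₂)
    (hδ₃ : 0 ≤ δ₃) (hτ : 1 ≤ τ) {x : ℝ} (hx : x ∈ Icc (0 : ℝ) 1) : AboveData δ₁ fL fR (f x) := by
  refine ⟨hδ₁, hP, hf.integrable x hx, ?_⟩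
  have ho : ∀ᵐ v, 0 ≤ outgoing f v := by
    filter_upwards [hf0] with v hv
    rw [outgoing_eq]
    exact hv _ (exit_mem v)
  have hx0 : ∀ y ∈ Icc (0 : ℝ) 1, ∀ᵐ v, 0 ≤ f y v := fun y hy => hf0.mono fun v hv => hv y hy
  filter_upwards [hf.eq_transport, ae_comp_reflect ho, hP.nonneg] with v h1 h2 h3
  rw [h1 x hx, transport, inflow]
  have h4 := collision_nonneg (τ := τ) (v := v) (by linarith) hx
    (Q := fun y v => ellipsoidalGaussian ν (f y) v)
    fun y hy => ellipsoidalGaussian_nonneg (hx0 y hy) ν v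
  have h5 := wallFlux_nonneg ho v
  have h6 := glue_wall_nonneg hθ₀ hθ₁ v
  have h7 := exp_inv_le_attenuation hτ hx v
  have h8 := attenuation_pos τ x v
  calc δ₁ * (Real.exp (-(1 / |v 0|)) * glue fL fR v) ≤
        δ₁ * (attenuation τ x v * glue fL fR v) := by gcongr
    _ = attenuation τ x v * (δ₁ * glue fL fR v) + 0 := by ring
    _ ≤ _ := by
      refine add_le_add (mul_le_mul_of_nonneg_left ?_ h8.le) h4
      rw [add_assoc]
      exact le_add_of_nonneg_right (by positivity)

/-- Weak re-emission and slow collisions make the solution map contract. -/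
theorem exists_weakInteraction (ν : ℝ) (hθ₀ : 0 < θ₀) (hθ₁ : 0 < θ₁) {r c B : ℝ} (hr : 0 < r)
    (hc : 0 < c) {C η : ℝ} (hC : 0 < C) (hη : 0 < η) :
    ∃ Ψ : V → ℝ, ∃ ε > (0 : ℝ), ∃ K > (0 : ℝ), ∀ fL fR : V → ℝ, P1 fL fR →
      ∀ τ δ₁ δ₂ δ₃ : ℝ, 0 ≤ δ₁ → 0 ≤ δ₂ → 0 ≤ δ₃ → K < τ → δ₂ + δ₃ < ε →
        WeakInteraction ν τ δ₁ δ₂ δ₃ (glue fL fR) (glue (wallMaxwellian θ₀) (wallMaxwellian θ₁))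
          (Moments.Admissible ν r B c) Ψ ∧
        (δ₂ * (∫ v, glue (wallMaxwellian θ₀) (wallMaxwellian θ₁) v * (1 + ‖v‖ ^ 2)) + δ₃) * C +
          ∫ v, absorbed τ v * (Ψ v * (1 + ‖v‖ ^ 2)) ≤ η := by
  obtain ⟨Ψ, -, hΨ0, hΨ, h1, h2⟩ :=
    Moments.exists_gaussian_lipschitz (ν := ν) (r := r) (B := B) (c := c) hr hc
  set w := ∫ v, glue (wallMaxwellian θ₀) (wallMaxwellian θ₁) v * (1 + ‖v‖ ^ 2) with hw
  have hw1 : 1 ≤ w := one_le_glue_wall hθ₀ hθ₁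
  have hm : 0 < min (1 / 4) (η / 2) := by positivity
  obtain ⟨K, hK⟩ := Filter.eventually_atTop.1
    ((tendsto_integral_absorbed hΨ).eventually (gt_mem_nhds hm))
  refine ⟨Ψ, min (1 / 4) (η / (2 * C)) / w, by positivity, max K 1, by positivity,
    fun fL fR hP τ δ₁ δ₂ δ₃ hδ₁ hδ₂ hδ₃ hτ hε => ?_⟩
  have h3 := hK τ ((le_max_left _ _).trans hτ.le)
  have hτ1 : 1 < τ := (le_max_right _ _).trans_lt hτ
  rw [lt_div_iff₀ (by linarith)] at hε
  -- Since `w ≥ 1`, the left side is at most (δ₂ + δ₃)w.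
  have h4 : δ₂ * w + δ₃ ≤ min (1 / 4) (η / (2 * C)) := by nlinarith
  refine ⟨⟨by linarith, hδ₁, hδ₂, hδ₃, hP.nonneg, hP.finite, glue_wall_nonneg hθ₀ hθ₁,
    integrable_glue_wall hθ₀ hθ₁, hΨ0, hΨ, h1, h2, h4.trans (min_le_left _ _),
    h3.le.trans (min_le_left _ _)⟩, ?_⟩
  have h5 : (δ₂ * w + δ₃) * C ≤ η / 2 := by
    calc _ ≤ η / (2 * C) * C := by gcongr; exact h4.trans (min_le_right _ _)
      _ = η / 2 := by field_simp
  have h6 := h3.le.trans (min_le_right _ _)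
  linarith

end MildBounds

/-- The non-critical case, for given values of the constants of the data. -/
theorem noncritical_case {θ₀ θ₁ : ℝ} (hθ₀ : 0 < θ₀) (hθ₁ : 0 < θ₁) {ν : ℝ} (hν : -1 / 2 < ν)
    (hν1 : ν < 1) {C a b : ℝ} (hC : 0 < C) (ha : 0 < a) (hb : 0 < b) :
    ∃ K₁ > (0 : ℝ), ∃ ε > (0 : ℝ), ∀ fL fR : V → ℝ, P1 fL fR → P2 fL fR →
      CLR θ₀ θ₁ fL fR = C → aEll fL fR = a → aCrit fL fR = b →
      ∀ τ δ₁ δ₂ δ₃ : ℝ, 0 ≤ δ₁ → 0 ≤ δ₂ → 0 ≤ δ₃ → δ₁ + δ₂ + δ₃ = 1 → K₁ < τ → δ₂ + δ₃ < ε →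
        ∃ f : ℝ → V → ℝ,
          (IsMildSolution ν τ δ₁ δ₂ δ₃ θ₀ θ₁ fL fR f ∧ Nonneg f ∧
            NoncriticalBounds ν δ₁ θ₀ θ₁ fL fR f) ∧
          ∀ g : ℝ → V → ℝ, IsMildSolution ν τ δ₁ δ₂ δ₃ θ₀ θ₁ fL fR g → Nonneg g →
            NoncriticalBounds ν δ₁ θ₀ θ₁ fL fR g → SameSolution g f := by
  set c := min (1 - ν) (1 + 2 * ν) * b / (12 * C) with hc
  have hm : 0 < min (1 - ν) (1 + 2 * ν) := lt_min (by linarith) (by linarith)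
  have hc0 : 0 < c := by positivity
  -- The data have energy at most C/4, so a remainder C/4 keeps every field below C/2. The set is
  -- chosen larger, with bound 2C, to contain all competitors in the uniqueness statement.
  obtain ⟨Ψ, ε, hε, K, hK, hW⟩ := exists_weakInteraction ν hθ₀ hθ₁ (B := 2 * C) ha hc0 hC
    (η := C / 4) (by positivity)
  -- Here τ > 2 and the threshold a/(2C + a) give the density bound, and 1/2 keeps δ₁ above 1/2.
  refine ⟨max K 2, by positivity, min ε (min (1 / 2) (a / (2 * C + a))), by positivity, ?_⟩
  intro fL fR hP hP2 hCe hae hbe τ δ₁ δ₂ δ₃ hδ₁ hδ₂ hδ₃ hsum hτ hδ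
  have hτK : K < τ := (le_max_left _ _).trans_lt hτ
  have hτ2 : 2 < τ := (le_max_right _ _).trans_lt hτ
  have hδε : δ₂ + δ₃ < ε := hδ.trans_le (min_le_left _ _)
  have hδh : δ₂ + δ₃ < 1 / 2 := hδ.trans_le ((min_le_right _ _).trans (min_le_left _ _))
  have hδa : δ₂ + δ₃ < a / (2 * C + a) := hδ.trans_le ((min_le_right _ _).trans (min_le_right _ _))
  obtain ⟨H, hη⟩ := hW fL fR hP τ δ₁ δ₂ δ₃ hδ₁ hδ₂ hδ₃ hτK hδε
  have hF0 := energy_data_le_CLR hθ₀ hθ₁ hP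
  rw [hCe] at hF0
  have hmem : ∀ f : V → ℝ, AboveData δ₁ fL fR f → aEll fL fR ≤ density f →
      ∫ v, f v * (1 + ‖v‖ ^ 2) ≤ 2 * C → moments f ∈ Moments.Admissible ν a (2 * C) c :=
    fun f hf h1 h2 => moments_mem_admissible hf.integrable hf.nonneg ha (hae ▸ h1) h2
      fun κ hκ => by
        have := quadForm_noncritical_ge hf hP2 (by linarith) hν hν1 hC h2 hκ
        rwa [hbe] at this
  have hnear : ∀ x ∈ Icc (0 : ℝ) 1, ∀ f, NearFree (C / 4) δ₁ τ x (glue fL fR) f →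
      AboveData δ₁ fL fR f ∧ aEll fL fR ≤ density f ∧ ∫ v, f v * (1 + ‖v‖ ^ 2) ≤ 2 * C :=
    fun x hx f hf => ⟨hf.aboveData hP hδ₁ (by linarith) hx,
      hf.aEll_le_density hP hC (by linarith) hτ2.le hx (by rw [hae]; linarith),
      (hf.energy_le hP (by linarith) (by linarith) hx).trans (by linarith)⟩
  have hΩ0 : ∀ m ∈ Moments.Admissible ν a (2 * C) c, m.1 ≠ 0 := fun m hm =>
    (Moments.Admissible.pos ha hm).ne'
  obtain ⟨f, hf, hf0, hfN⟩ := exists_mild_solution H (Moments.continuousOn_gaussian ha hc0)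
    (Moments.isCompact_admissible ha).isClosed hΩ0
    (fun x hx f hf => by
      obtain ⟨h1, h2, h3⟩ := hnear x hx f hf
      exact hmem f h1 h2 h3)
    (by positivity) hη (by linarith) (by linarith)
  have hfB : ∀ x ∈ Icc (0 : ℝ) 1, moments (f x) ∈ Moments.Admissible ν a (2 * C) c :=
    fun x hx => by
      obtain ⟨h1, h2, h3⟩ := hnear x hx _ (hfN x hx)
      exact hmem _ h1 h2 h3
  refine ⟨f, ⟨hf, hf0, fun x hx => ?_⟩, fun g hg hg0 hgB => ?_⟩
  · obtain ⟨h1, h2, h3⟩ := hnear x hx _ (hfN x hx)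
    refine ⟨h2, by rw [hCe]; exact h3, fun κ hκ => ?_⟩
    rw [hCe]
    exact quadForm_noncritical_bounds h1 (by linarith) (by linarith) hν hν1 hC h3 h2 hκ
  · refine mild_solution_unique H hΩ0 hg hf (fun x hx => ?_) hfB
    obtain ⟨h1, h2, -⟩ := hgB x hx
    rw [hCe] at h2
    exact hmem _ (hg.aboveData hg0 hP hθ₀ hθ₁ hδ₁ hδ₂ hδ₃ (by linarith) hx) h1 h2

/-- The critical case, for given values of the constants of the data. -/
theorem critical_case {θ₀ θ₁ : ℝ} (hθ₀ : 0 < θ₀) (hθ₁ : 0 < θ₁) {C a b : ℝ} (hC : 0 < C)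
    (ha : 0 < a) (hb : 0 < b) :
    ∃ K₁ > (0 : ℝ), ∃ ε₁ > (0 : ℝ), ∃ ε₂ > (0 : ℝ), ∀ fL fR : V → ℝ, P1 fL fR → P2 fL fR →
      CLR θ₀ θ₁ fL fR = C → aEll fL fR = a → aCrit fL fR = b →
      ∀ τ δ₁ δ₂ δ₃ : ℝ, 0 ≤ δ₁ → 0 ≤ δ₂ → 0 ≤ δ₃ → δ₁ + δ₂ + δ₃ = 1 → K₁ < τ → δ₂ + δ₃ < ε₁ →
        fluxDiscrepancy fL fR ≤ ε₂ →
        ∃ f : ℝ → V → ℝ,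
          (IsMildSolution (-1 / 2) τ δ₁ δ₂ δ₃ θ₀ θ₁ fL fR f ∧ Nonneg f ∧
            CriticalBounds δ₁ θ₀ θ₁ fL fR f) ∧
          ∀ g : ℝ → V → ℝ, IsMildSolution (-1 / 2) τ δ₁ δ₂ δ₃ θ₀ θ₁ fL fR g → Nonneg g →
            CriticalBounds δ₁ θ₀ θ₁ fL fR g → SameSolution g f := by
  set c := b / (4 * C) with hc
  have hc0 : 0 < c := by positivity
  -- The largest momentum per component allowed by `quadForm_critical_bounds`.
  set s := Real.sqrt (a * b / 24) with hs
  have hs0 : 0 < s := Real.sqrt_pos.2 (by positivity)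
  have hs2 : s ^ 2 = a * b / 24 := Real.sq_sqrt (by positivity)
  set η := min (C / 4) (s / 4) with hη
  have hη0 : 0 < η := by positivity
  have hηC : η ≤ C / 4 := min_le_left _ _
  have hηs : η ≤ s / 4 := min_le_right _ _
  -- The critical bounds limit only ∫f|v|²; the second summand is an upper bound for the density,
  -- deduced below from ellipticity.
  set B := 2 * C + 4 * C ^ 2 / b with hB
  obtain ⟨Ψ, ε, hε, K, hK, hW⟩ := exists_weakInteraction (-1 / 2) hθ₀ hθ₁ (B := B) (r := a / 2)
    (half_pos ha) hc0 hC hη0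
  -- The first momentum component is allotted s/4 for the flux discrepancy, s/4 each for 1 - δ₁ and
  -- 1/τ, and s/4 for the remainder.
  refine ⟨max K (max 1 (4 * C / s)), by positivity, min ε (min (1 / 2) (s / (4 * C))),
    by positivity, s / 4, by positivity, ?_⟩
  intro fL fR hP hP2 hCe hae hbe τ δ₁ δ₂ δ₃ hδ₁ hδ₂ hδ₃ hsum hτ hδ hflux
  have hτK : K < τ := (le_max_left _ _).trans_lt hτ
  have hτ1 : 1 < τ := ((le_max_left _ _).trans (le_max_right _ _)).trans_lt hτ
  have hτs : 4 * C / s < τ := ((le_max_right _ _).trans (le_max_right _ _)).trans_lt hτ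
  have hδε : δ₂ + δ₃ < ε := hδ.trans_le (min_le_left _ _)
  have hδh : δ₂ + δ₃ < 1 / 2 := hδ.trans_le ((min_le_right _ _).trans (min_le_left _ _))
  have hδs : δ₂ + δ₃ < s / (4 * C) := hδ.trans_le ((min_le_right _ _).trans (min_le_right _ _))
  obtain ⟨H, hηW⟩ := hW fL fR hP τ δ₁ δ₂ δ₃ hδ₁ hδ₂ hδ₃ hτK hδε
  have hF0 := energy_data_le_CLR hθ₀ hθ₁ hP
  rw [hCe] at hF0
  have hF00 := energy_data_pos hP
  have hnear : ∀ x ∈ Icc (0 : ℝ) 1, ∀ f, NearFree η δ₁ τ x (glue fL fR) f →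
      AboveData δ₁ fL fR f ∧ ∫ v, f v * (1 + ‖v‖ ^ 2) ≤ C / 2 ∧ ∀ κ : V, ‖κ‖ = 1 →
        δ₁ * (aCrit fL fR / (2 * C)) ≤ quadForm (temperatureTensor (-1 / 2) f) κ ∧
          quadForm (temperatureTensor (-1 / 2) f) κ ≤ 3 / (2 * aEll fL fR) * C := by
    intro x hx f hf
    have h1 := hf.aboveData hP hδ₁ hτ1.le hx
    have h2 := (hf.energy_le hP (by linarith) (by linarith) hx).trans
      (by linarith : _ ≤ C / 2)
    refine ⟨h1, h2, fun κ hκ => quadForm_critical_bounds h1 (by linarith) h2 (s := s)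
      (fun i => ?_) (by rw [hs2, hae, hbe]; linarith) hκ⟩
    rcases eq_or_ne i 0 with rfl | hi
    · refine (hf.abs_horizontal_momentum_le hP hδ₁ (by linarith) (by linarith) hx).trans ?_
      have h3 : 1 / τ ≤ s / (4 * C) := by
        rw [div_le_div_iff₀ (by linarith) (by positivity)]
        rw [div_lt_iff₀ hs0] at hτs
        linarith
      have h4 : ((1 - δ₁) + 1 / τ) * (∫ v, glue fL fR v * (1 + ‖v‖ ^ 2)) ≤
          (s / (4 * C) + s / (4 * C)) * C := by
        have : 0 ≤ 1 / τ := by positivity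
        gcongr
        · linarith
        · linarith
      have h5 : (s / (4 * C) + s / (4 * C)) * C = s / 2 := by field_simp; ring
      linarith
    · exact (hf.abs_vertical_momentum_le hP hP2 (by linarith) hx hi).trans (by linarith)
  have hmem : ∀ f : V → ℝ, AboveData δ₁ fL fR f → ∫ v, f v * ‖v‖ ^ 2 ≤ 2 * C →
      (∀ κ : V, ‖κ‖ = 1 → δ₁ * (aCrit fL fR / (2 * C)) ≤
        quadForm (temperatureTensor (-1 / 2) f) κ) →
      moments f ∈ Moments.Admissible (-1 / 2) (a / 2) B c := by
    intro f hf h2 h3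
    have h4 : ∀ κ : V, ‖κ‖ = 1 → c ≤ quadForm (temperatureTensor (-1 / 2) f) κ := by
      intro κ hκ
      refine le_trans ?_ (h3 κ hκ)
      rw [hbe, hc]
      calc b / (4 * C) = 1 / 2 * (b / (2 * C)) := by field_simp; ring
        _ ≤ _ := by gcongr; linarith
    have hρa := hf.density_ge
    rw [hae] at hρa
    have hρ := hf.density_pos (by linarith)
    have hρ2 : a / 2 ≤ density f := by nlinarith
    refine moments_mem_admissible hf.integrable hf.nonneg (half_pos ha) hρ2 ?_ h4
    rw [energy_split hf.integrable]
    have hκ : ‖(EuclideanSpace.single 0 1 : V)‖ = 1 := by simp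
    have h5 := density_mul_quadForm_critical hf.integrable hρ hκ
    have h6 := (directional_variance_le hf.integrable hf.nonneg (EuclideanSpace.single 0 1)).1
    have h7 := variance_le_energy hf.integrable hρ
    have h8 := mul_le_mul_of_nonneg_left (h4 _ hκ) hρ.le
    -- In any one direction ρc is at most ρκᵀ𝒯κ, hence at most half the variance, while the variance
    -- is at most 2C.
    have h9 : density f * c ≤ C := by linarith
    have h10 : density f ≤ 4 * C ^ 2 / b := by
      rw [le_div_iff₀ hb]
      rw [hc, ← mul_div_assoc, div_le_iff₀ (by positivity)] at h9
      linarith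
    linarith
  have hΩ0 : ∀ m ∈ Moments.Admissible (-1 / 2) (a / 2) B c, m.1 ≠ 0 := fun m hm =>
    (Moments.Admissible.pos (half_pos ha) hm).ne'
  have hnearE : ∀ f : V → ℝ, AboveData δ₁ fL fR f → ∫ v, f v * (1 + ‖v‖ ^ 2) ≤ C / 2 →
      ∫ v, f v * ‖v‖ ^ 2 ≤ 2 * C := fun f hf h => by
    have h1 := energy_split hf.integrable
    have h2 := hf.density_pos (by linarith)
    linarith
  obtain ⟨f, hf, hf0, hfN⟩ := exists_mild_solution H
    (Moments.continuousOn_gaussian (half_pos ha) hc0)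
    (Moments.isCompact_admissible (half_pos ha)).isClosed hΩ0
    (fun x hx f hf => by
      obtain ⟨h1, h2, h3⟩ := hnear x hx f hf
      exact hmem f h1 (hnearE f h1 h2) fun κ hκ => (h3 κ hκ).1)
    hη0.le hηW (by linarith) (by linarith)
  refine ⟨f, ⟨hf, hf0, fun x hx => ?_⟩, fun g hg hg0 hgB => ?_⟩
  · obtain ⟨h1, h2, h3⟩ := hnear x hx _ (hfN x hx)
    rw [hCe]
    exact ⟨h1.density_ge, hnearE _ h1 h2, h3⟩
  · refine mild_solution_unique H hΩ0 hg hf (fun x hx => ?_) fun x hx => ?_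
    · obtain ⟨-, h2, h3⟩ := hgB x hx
      rw [hCe] at h2 h3
      exact hmem _ (hg.aboveData hg0 hP hθ₀ hθ₁ hδ₁ hδ₂ hδ₃ hτ1.le hx) h2 fun κ hκ => (h3 κ hκ).1
    · obtain ⟨h1, h2, h3⟩ := hnear x hx _ (hfN x hx)
      exact hmem _ h1 (hnearE _ h1 h2) fun κ hκ => (h3 κ hκ).1

end ESBGK
end

open ESBGK
theorem theorem1p1 (θ₀ θ₁ : ℝ) (hθ₀ : 0 < θ₀) (hθ₁ : 0 < θ₁) :
    -- non-critical case
    (∀ ν : ℝ, -1 / 2 < ν → ν < 1 → ∀ C a γ b : ℝ,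
      ∃ K₁ > (0 : ℝ), ∃ ε > (0 : ℝ),
        ∀ fL fR : V → ℝ, P1 fL fR → P2 fL fR →
          CLR θ₀ θ₁ fL fR = C → aEll fL fR = a → gammaEll fL fR = γ → aCrit fL fR = b →
          ((¬ ∀ᵐ v : V, 0 < v 0 → fL v = 0) → (¬ ∀ᵐ v : V, v 0 < 0 → fR v = 0) →
            0 < gammaEll fL fR) ∧
          ∀ τ δ₁ δ₂ δ₃ : ℝ, 0 ≤ δ₁ → 0 ≤ δ₂ → 0 ≤ δ₃ → δ₁ + δ₂ + δ₃ = 1 →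
            K₁ < τ → δ₂ + δ₃ < ε →
            ∃ f : ℝ → V → ℝ,
              (IsMildSolution ν τ δ₁ δ₂ δ₃ θ₀ θ₁ fL fR f ∧ Nonneg f ∧
                NoncriticalBounds ν δ₁ θ₀ θ₁ fL fR f) ∧
              ∀ g : ℝ → V → ℝ,
                IsMildSolution ν τ δ₁ δ₂ δ₃ θ₀ θ₁ fL fR g → Nonneg g →
                NoncriticalBounds ν δ₁ θ₀ θ₁ fL fR g → SameSolution g f) ∧
    -- critical case
    (∀ C a b : ℝ,
      ∃ K₁ > (0 : ℝ), ∃ ε₁ > (0 : ℝ), ∃ ε₂ > (0 : ℝ),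
        ∀ fL fR : V → ℝ, P1 fL fR → P2 fL fR →
          CLR θ₀ θ₁ fL fR = C → aEll fL fR = a → aCrit fL fR = b →
          0 < aCrit fL fR ∧
          ∀ τ δ₁ δ₂ δ₃ : ℝ, 0 ≤ δ₁ → 0 ≤ δ₂ → 0 ≤ δ₃ → δ₁ + δ₂ + δ₃ = 1 →
            K₁ < τ → δ₂ + δ₃ < ε₁ → fluxDiscrepancy fL fR ≤ ε₂ →
            ∃ f : ℝ → V → ℝ,
              (IsMildSolution (-1 / 2) τ δ₁ δ₂ δ₃ θ₀ θ₁ fL fR f ∧ Nonneg f ∧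
                CriticalBounds δ₁ θ₀ θ₁ fL fR f) ∧
              ∀ g : ℝ → V → ℝ,
                IsMildSolution (-1 / 2) τ δ₁ δ₂ δ₃ θ₀ θ₁ fL fR g → Nonneg g →
                CriticalBounds δ₁ θ₀ θ₁ fL fR g → SameSolution g f) := by
  refine ⟨fun ν hν hν1 C a γ b => ?_, fun C a b => ?_⟩
  -- The constants are quantified before the data. Values that are not all positive are attained by
  -- no data satisfying (P₁), and any thresholds do.
  · by_cases h : 0 < C ∧ 0 < a ∧ 0 < b
    · obtain ⟨K₁, hK₁, ε, hε, H⟩ := noncritical_case hθ₀ hθ₁ hν hν1 h.1 h.2.1 h.2.2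
      exact ⟨K₁, hK₁, ε, hε, fun fL fR hP hP2 hC ha _ hb =>
        ⟨gammaEll_pos hP, H fL fR hP hP2 hC ha hb⟩⟩
    · exact ⟨1, one_pos, 1, one_pos, fun fL fR hP _ hC ha _ hb =>
        absurd ⟨hC ▸ CLR_pos hθ₀ hθ₁ hP, ha ▸ aEll_pos hP, hb ▸ aCrit_pos hP⟩ h⟩
  · by_cases h : 0 < C ∧ 0 < a ∧ 0 < b
    · obtain ⟨K₁, hK₁, ε₁, hε₁, ε₂, hε₂, H⟩ := critical_case hθ₀ hθ₁ h.1 h.2.1 h.2.2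
      exact ⟨K₁, hK₁, ε₁, hε₁, ε₂, hε₂, fun fL fR hP hP2 hC ha hb =>
        ⟨aCrit_pos hP, H fL fR hP hP2 hC ha hb⟩⟩
    · exact ⟨1, one_pos, 1, one_pos, 1, one_pos, fun fL fR hP _ hC ha hb =>
        absurd ⟨hC ▸ CLR_pos hθ₀ hθ₁ hP, ha ▸ aEll_pos hP, hb ▸ aCrit_pos hP⟩ h⟩
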